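/- **Setting.** $M\ge 1$ agents interact for $T\ge 1$ episodes of $H\ge 1$ steps with parallel episodic MDPs: agent $m$ has transition probabilities $\mathbb P_{m,h}(\cdot\mid x,a)$ and deterministic rewards $r_{m,h}(x,a)\in[0,1]$, $h\in[H]$, on a common measurable state space $\mathcal S$ and a common finite action set $\mathcal A$. Each of them is a linear MDP for a common known measurable feature map $\phi:\mathcal S\times\mathcal A\to\mathbb R^d$, $\|\phi\|\le 1$: for all $m,h$ there are signed measures $\mu_{m,h}=(\mu^1_{m,h},\dots,\mu^d_{m,h})$ on $\mathcal S$ and $\theta_{m,h}\in\mathbb R^d$ with $\mathbb P_{m,h}(\cdot\mid x,a)=\langle\phi(x,a),\mu_{m,h}(\cdot)\rangle$, $r_{m,h}(x,a)=\langle\phi(x,a),\theta_{m,h}\rangle$, $\|\theta_{m,h}\|\le\sqrt d$ and $\|\mu_{m,h}(B)\|\le\sqrt d$ for every measurable $B\subseteq\mathcal S$. The deviations are small: for a known $\xi\in[0,1)$ and all $m,m',h,x,a$, $$\|(\mathbb P_{m,h}-\mathbb P_{m',h})(\cdot\mid x,a)\|_{TV}\le\xi,\qquad |(r_{m,h}-r_{m',h})(x,a)|\le\xi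 .$$ In episode $t$ agent $m$ starts in a state $x^t_{m,1}$ picked arbitrarily by the environment (possibly depending on the past). For policies $\pi$ (which may be randomized) let $V^\pi_{m,h}(x)=\mathbb E_\pi[\sum_{i=h}^H r_{m,i}(x_i,a_i)\mid x_h=x]$ in the $m$-th MDP, and $V^\star_{m,h}=\sup_\pi V^\pi_{m,h}$. **Algorithm (Coop-LSVI)** with threshold $S$, $\lambda=1$ and bonus parameter $\beta$. Let $k_t<t$ be the last episode before $t$ after which the agents synchronized ($0$ if none). In episode $t$ agent $m$ possesses the observed transitions and rewards of all agents from the episodes $\tau\le k_t$ and its own from the episodes $k_t<\tau<t$; let $\mathcal U$ be the set of these pairs (agent $n$, episode $\tau$), and $\phi^\tau_{n,h}=\phi(x^\tau_{n,h},a^\tau_{n,h})$. Set $V^t_{m,H+1}=0$ and, for $h=H,\dots,1$, $$\Lambda^t_{m,h}=\lambda I+\sum_{(n,\tau)\in\mathcal U}\phi^\tau_{n,h}(\phi^\tau_{n,h})^\top,\quad w^t_{m,h}=(\Lambda^t_{m,h})^{-1}\sum_{(n,\tau)\in\mathcal U}\phi^\tau_{n,h}\bigl[r_{n,h}(x^\tau_{n,h},a^\tau_{n,h})+V^t_{m,h+1}(x^\tau_{n,h+1})\bigr],$$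 $$Q^t_{m,h}=\min\bigl\{\phi^\top w^t_{m,h}+\beta\,(\phi^\top(\Lambda^t_{m,h})^{-1}\phi)^{1/2},\;H-h+1\bigr\},\qquad V^t_{m,h}(x)=\max_a Q^t_{m,h}(x,a).$$ Agent $m$ plays the greedy policy $\pi_{m,t}$ for $Q^t_{m,h}$ (ties are broken by any fixed rule). After the episode all agents synchronize, i.e. $k_{t+1}=t$, if for some $m,h$ $$\log\frac{\det(\Lambda^t_{m,h}+\phi^t_{m,h}(\phi^t_{m,h})^\top)}{\det\bigl(\lambda I+\sum_{n}\sum_{\tau\le k_t}\phi^\tau_{n,h}(\phi^\tau_{n,h})^\top\bigr)}>\frac{S}{t-k_t};$$ otherwise $k_{t+1}=k_t$. **Theorem.** There are absolute constants $c_0>0$ and $p\in\mathbb N$ such that for all $c\ge c_0$, $s_0>0$ and $\alpha_0\in(0,1)$ there is a constant $C=C(c,s_0,\alpha_0)>0$ with the following property. For all parallel MDPs as above, all $S\ge s_0$ and all $\alpha\in(0,\alpha_0]$, Coop-LSVI with $$\beta=c\cdot dH\Bigl(\sqrt{\log(2dMHT/\alpha)}+\xi\sqrt{dMT}\Bigr)$$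 satisfies, with probability at least $1-\alpha$, $$\mathfrak R(T)=\sum_{m=1}^M\sum_{t=1}^T\bigl[V^\star_{m,1}(x^t_{m,1})-V^{\pi_{m,t}}_{m,1}(x^t_{m,1})\bigr]\le C\,(1+\log(dMTH))^p\cdot dH^2\bigl(dM\sqrt S+\sqrt{dMT}\bigr)\Bigl(\sqrt{\log(1/\alpha)}+2\xi\sqrt{dMT}\Bigr).$$ -/

import Mathlib

open MeasureTheory ProbabilityTheory
open scoped Matrix

noncomputable section

/-- The Euclidean norm of a coordinate vector. -/
def euclNorm {d : ℕ} (v : Fin d → ℝ) : ℝ := √(v ⬝ᵥ v)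

/-- Total variation distance: the largest difference of the probabilities of an event. -/
def tvDist {S : Type*} [MeasurableSpace S] (μ ν : Measure S) : ℝ :=
  ⨆ B : {B : Set S // MeasurableSet B}, |μ.real B - ν.real B|

/-- The transition probabilities and the deterministic rewards in `[0, 1]` of an episodic MDP with
state space `S` and action space `A`. Steps are numbered from `1`. -/
structure EpisodicMDP (S A : Type*) [MeasurableSpace S] [MeasurableSpace A] where
  transition : ℕ → Kernel (S × A) S
  isMarkov : ∀ h, IsMarkovKernel (transition h)
  reward : ℕ → S × A → ℝ
  measurable_reward : ∀ h, Measurable (reward h)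
  reward_mem : ∀ h z, reward h z ∈ Set.Icc (0 : ℝ) 1

/-- A (Markov, possibly randomized) policy: a probability kernel from states to actions for every
step. -/
structure Policy (S A : Type*) [MeasurableSpace S] [MeasurableSpace A] where
  kernel : ℕ → Kernel S A
  isMarkov : ∀ h, IsMarkovKernel (kernel h)

instance {S A : Type*} [MeasurableSpace S] [MeasurableSpace A] (E : EpisodicMDP S A) (h : ℕ) :
    IsMarkovKernel (E.transition h) := E.isMarkov h

instance {S A : Type*} [MeasurableSpace S] [MeasurableSpace A] (π : Policy S A) (h : ℕ) :
    IsMarkovKernel (π.kernel h) := π.isMarkov h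

/-- A feature map in `d` dimensions, of Euclidean norm at most one. -/
structure FeatureMap (S A : Type*) [MeasurableSpace S] [MeasurableSpace A] (d : ℕ) where
  toFun : S × A → Fin d → ℝ
  measurable : Measurable toFun
  norm_le : ∀ z, euclNorm (toFun z) ≤ 1

namespace EpisodicMDP

variable {S A : Type*} [MeasurableSpace S] [MeasurableSpace A]

/-- The law of the trajectory `(x_h, a_h), …, (x_{h+n-1}, a_{h+n-1})` under the policy `π`, as a
function of the initial state `x_h`. First argument `n`, second argument `h`. -/
def traj (E : EpisodicMDP S A) (π : Policy S A) : (n : ℕ) → ℕ → Kernel S (Fin n → S × A)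
  | 0, _ => Kernel.const S (Measure.dirac Fin.elim0)
  | n + 1, h =>
    (Kernel.id ×ₖ ((π.kernel h ⊗ₖ E.transition h) ⊗ₖ
      ((traj E π n (h + 1)).comap (fun p : S × (A × S) => p.2.2) (by fun_prop)))).map
      (fun z : S × ((A × S) × (Fin n → S × A)) =>
        (Fin.cons (z.1, z.2.1.1) z.2.2 : Fin (n + 1) → S × A))

/-- All kernels in the definition of `traj` are genuine probability kernels. -/
theorem isMarkov_traj (E : EpisodicMDP S A) (π : Policy S A) (n h : ℕ) :
    IsMarkovKernel (E.traj π n h) := by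
  induction n generalizing h with
  | zero => unfold traj; infer_instance
  | succ n ih =>
    have := ih (h + 1)
    unfold traj
    apply Kernel.IsMarkovKernel.map
    refine measurable_pi_iff.2 fun i => ?_
    refine Fin.cases ?_ (fun j => ?_) i
    · simp only [Fin.cons_zero]; fun_prop
    · simp only [Fin.cons_succ]; fun_prop

/-- The value function `V^π_h(x) = 𝔼_π[∑_{i=h}^H r_i(x_i, a_i) | x_h = x]`. -/
def value (E : EpisodicMDP S A) (H : ℕ) (π : Policy S A) (h : ℕ) (x : S) : ℝ :=
  ∫ τ, ∑ i : Fin (H + 1 - h), E.reward (h + i) (τ i) ∂(E.traj π (H + 1 - h) h x)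

/-- The optimal value function `V^⋆_h(x) = sup_π V^π_h(x)`. -/
def optValue (E : EpisodicMDP S A) (H : ℕ) (h : ℕ) (x : S) : ℝ :=
  ⨆ π : Policy S A, E.value H π h x

/-- Linear MDP of horizon `H` with feature map `φ`. The signed measures `μ¹, …, μᵈ` are normalized
by `‖(μ¹(B), …, μᵈ(B))‖ ≤ √d` for all events `B`; for nonnegative measures this is the same as the
condition for `B = S`. -/
def IsLinear (E : EpisodicMDP S A) (H : ℕ) {d : ℕ} (φ : FeatureMap S A d) : Prop :=
  ∀ h ∈ Finset.Icc 1 H, ∃ (μ : Fin d → SignedMeasure S) (θ : Fin d → ℝ),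
    (∀ z B, MeasurableSet B → (E.transition h z).real B = ∑ i, φ.toFun z i * μ i B) ∧
    (∀ z, E.reward h z = φ.toFun z ⬝ᵥ θ) ∧
    (∀ B, MeasurableSet B → euclNorm (fun i => μ i B) ≤ √d) ∧
    euclNorm θ ≤ √d

/-- A family of MDPs of horizon `H`, indexed by the agents, whose transition probabilities and
rewards differ pairwise by at most `ξ`. -/
def SmallDeviation {M : ℕ} (E : Fin M → EpisodicMDP S A) (H : ℕ) (ξ : ℝ) : Prop :=
  ∀ m m' : Fin M, ∀ h ∈ Finset.Icc 1 H, ∀ z,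
    tvDist ((E m).transition h z) ((E m').transition h z) ≤ ξ ∧
    |(E m).reward h z - (E m').reward h z| ≤ ξ

end EpisodicMDP

/-- What the agents observe: states, actions and rewards, indexed by episode, agent and step.
Episodes and steps are numbered from `1`. -/
structure Observations (S A : Type*) (M : ℕ) where
  state : ℕ → Fin M → ℕ → S
  action : ℕ → Fin M → ℕ → A
  reward : ℕ → Fin M → ℕ → ℝ

/-- The inputs of the algorithm for `M` agents: horizon, feature map, ridge parameter `lam`,
communication threshold `thr`, bonus parameters `β t m h`, and a rule `tie t m h` that selects an
action from a nonempty set of maximizers. -/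
structure CoopLSVI (S A : Type*) [MeasurableSpace S] [MeasurableSpace A] (M d : ℕ) where
  H : ℕ
  φ : FeatureMap S A d
  lam : ℝ
  thr : ℝ
  β : ℕ → Fin M → ℕ → ℝ
  tie : ℕ → Fin M → ℕ → Finset A → A
  tie_mem : ∀ t m h s, s.Nonempty → tie t m h s ∈ s

namespace CoopLSVI

variable {S A : Type*} [MeasurableSpace S] [MeasurableSpace A] {M d : ℕ}

/-- The feature vector of the state-action pair of agent `n` at step `h` of episode `τ`. -/
def feat (alg : CoopLSVI S A M d) (D : Observations S A M) (h : ℕ) (n : Fin M) (τ : ℕ) :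
    Fin d → ℝ :=
  alg.φ.toFun (D.state τ n h, D.action τ n h)

/-- The (agent, episode) pairs whose transitions agent `m` possesses at the start of episode `t`, if
the last synchronization took place after episode `k`: all agents up to episode `k`, and its own
episodes up to `t - 1`. -/
def avail (m : Fin M) (t k : ℕ) : Finset (Fin M × ℕ) :=
  (Finset.univ ×ˢ Finset.Icc 1 (t - 1)).filter (fun p => p.2 ≤ k ∨ p.1 = m)

/-- `Λ^t_{m,h}`: regularized Gram matrix of the transitions that agent `m` possesses. -/
def gram (alg : CoopLSVI S A M d) (D : Observations S A M) (m : Fin M) (t k h : ℕ) :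
    Matrix (Fin d) (Fin d) ℝ :=
  ∑ p ∈ avail m t k, Matrix.vecMulVec (alg.feat D h p.1 p.2) (alg.feat D h p.1 p.2)
    + alg.lam • (1 : Matrix (Fin d) (Fin d) ℝ)

/-- The regularized Gram matrix of the transitions synchronized after episode `k`. -/
def syncGram (alg : CoopLSVI S A M d) (D : Observations S A M) (k h : ℕ) :
    Matrix (Fin d) (Fin d) ℝ :=
  ∑ p ∈ (Finset.univ : Finset (Fin M)) ×ˢ Finset.Icc 1 k,
      Matrix.vecMulVec (alg.feat D h p.1 p.2) (alg.feat D h p.1 p.2)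
    + alg.lam • (1 : Matrix (Fin d) (Fin d) ℝ)

/-- `u^t_{m,h}`: sum of features times targets `r + V(x')`, where `V` estimates the value at step
`h + 1`. -/
def bias (alg : CoopLSVI S A M d) (D : Observations S A M) (m : Fin M) (t k h : ℕ) (V : S → ℝ) :
    Fin d → ℝ :=
  ∑ p ∈ avail m t k,
    (D.reward p.2 p.1 h + V (D.state p.2 p.1 (h + 1))) • alg.feat D h p.1 p.2

/-- The optimistic `Q`-values at step `h`, from the value estimate `V` for step `h + 1`: ridge
regression plus bonus, truncated at `H - h + 1`. -/
def qStep (alg : CoopLSVI S A M d) (D : Observations S A M) (m : Fin M) (t k h : ℕ) (V : S → ℝ)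
    (z : S × A) : ℝ :=
  min (alg.φ.toFun z ⬝ᵥ ((alg.gram D m t k h)⁻¹ *ᵥ alg.bias D m t k h V)
      + alg.β t m h * √(alg.φ.toFun z ⬝ᵥ ((alg.gram D m t k h)⁻¹ *ᵥ alg.φ.toFun z)))
    ((alg.H : ℝ) - h + 1)

variable [Fintype A] [Nonempty A]

/-- The value estimate `V^t_{m,h}` at the step `h = H + 1 - j`; zero for `j = 0`. -/
def vEst (alg : CoopLSVI S A M d) (D : Observations S A M) (m : Fin M) (t k : ℕ) : ℕ → S → ℝ
  | 0, _ => 0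
  | j + 1, x => Finset.univ.sup' Finset.univ_nonempty
      (fun a => alg.qStep D m t k (alg.H - j) (vEst alg D m t k j) (x, a))

/-- The optimistic `Q`-values `Q^t_{m,h}`, for `1 ≤ h ≤ H`. -/
def qEst (alg : CoopLSVI S A M d) (D : Observations S A M) (m : Fin M) (t k h : ℕ) :
    S × A → ℝ :=
  alg.qStep D m t k h (alg.vEst D m t k (alg.H - h))

open scoped Classical in
/-- The greedy action at step `h` of episode `t` in state `x`. -/
def greedy (alg : CoopLSVI S A M d) (D : Observations S A M) (m : Fin M) (t k h : ℕ) (x : S) : A :=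
  alg.tie t m h
    (Finset.univ.filter (fun a => ∀ b, alg.qEst D m t k h (x, b) ≤ alg.qEst D m t k h (x, a)))

theorem measurable_qEst (alg : CoopLSVI S A M d) (D : Observations S A M) (m : Fin M)
    (t k h : ℕ) : Measurable (alg.qEst D m t k h) := by
  have h1 : ∀ i, Measurable fun z => alg.φ.toFun z i :=
    fun i => (measurable_pi_apply i).comp alg.φ.measurable
  unfold qEst qStep
  simp only [dotProduct, Matrix.mulVec]
  fun_prop

theorem measurable_greedy (alg : CoopLSVI S A M d) (D : Observations S A M) (m : Fin M)
    (t k h : ℕ) : Measurable (alg.greedy D m t k h) := by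
  classical
  have hQ := alg.measurable_qEst D m t k h
  let g : S → Set A := fun x =>
    {a | ∀ b, alg.qEst D m t k h (x, b) ≤ alg.qEst D m t k h (x, a)}
  have hg : ∀ s : Set A, MeasurableSet {x | g x = s} := by
    intro s
    have : {x | g x = s} = ⋂ a, {x | (∀ b, alg.qEst D m t k h (x, b) ≤ alg.qEst D m t k h (x, a))
        ↔ a ∈ s} := by
      ext x; simp [g, Set.ext_iff]
    rw [this]
    refine MeasurableSet.iInter fun a => ?_
    have hm : MeasurableSet {x | ∀ b, alg.qEst D m t k h (x, b) ≤ alg.qEst D m t k h (x, a)} := by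
      rw [Set.ofPred_forall]
      exact MeasurableSet.iInter fun b =>
        measurableSet_le (hQ.comp measurable_prodMk_right) (hQ.comp measurable_prodMk_right)
    by_cases ha : a ∈ s
    · simpa [ha] using hm
    · have hc : {x | (∀ b, alg.qEst D m t k h (x, b) ≤ alg.qEst D m t k h (x, a)) ↔ a ∈ s} =
          {x | ∀ b, alg.qEst D m t k h (x, b) ≤ alg.qEst D m t k h (x, a)}ᶜ := by
        ext x; simp [ha]
      rw [hc]
      exact hm.compl
  have hf : alg.greedy D m t k h =
      (fun s : Set A => alg.tie t m h (Finset.univ.filter (fun a => a ∈ s))) ∘ g := by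
    funext x
    simp only [greedy, Function.comp, g, Set.mem_ofPred_eq]
  intro B _
  have : alg.greedy D m t k h ⁻¹' B =
      ⋃ s ∈ {s : Set A | alg.tie t m h (Finset.univ.filter (fun a => a ∈ s)) ∈ B},
        {x | g x = s} := by
    rw [hf]; ext x; simp
  rw [this]
  exact MeasurableSet.biUnion (Set.to_countable _) fun s _ => hg s

/-- The greedy policy `π^t_m` that agent `m` plays in episode `t`. -/
def greedyPolicy (alg : CoopLSVI S A M d) (D : Observations S A M) (m : Fin M) (t k : ℕ) :
    Policy S A where
  kernel h := Kernel.deterministic (alg.greedy D m t k h) (alg.measurable_greedy D m t k h)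
  isMarkov _ := inferInstance

/-- The synchronization test in episode `t`, if the last synchronization took place after episode
`k`: for some agent and step, the log-determinant grew by more than `thr / (t - k)`. -/
def Sync (alg : CoopLSVI S A M d) (D : Observations S A M) (t k : ℕ) : Prop :=
  ∃ m : Fin M, ∃ h ∈ Finset.Icc 1 alg.H,
    Real.log ((alg.gram D m t k h + Matrix.vecMulVec (alg.feat D h m t) (alg.feat D h m t)).det
      / (alg.syncGram D k h).det) > alg.thr / ((t : ℝ) - k)

/-- The σ-algebra of everything that happened before agent `m` leaves its state at step `h` of
episode `t`: the earlier episodes, the agents before `m` in episode `t`, and the steps of agent `m`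
up to `h`. -/
@[reducible] def past {Ω : Type*} (D : Ω → Observations S A M) (H t : ℕ) (m : Fin M) (h : ℕ) :
    MeasurableSpace Ω :=
  ⨆ (τ : ℕ) (n : Fin M) (i : ℕ)
    (_ : 1 ≤ τ ∧ i ∈ Finset.Icc 1 (H + 1) ∧
      (τ < t ∨ (τ = t ∧ n < m) ∨ (τ = t ∧ n = m ∧ i ≤ h))),
    MeasurableSpace.comap (fun ω => (D ω).state τ n i) inferInstance

/-- `D` is the (random) record of `T` episodes of the algorithm, agent `m` interacting with the MDP
`E m`, and `k ω t` is the last episode before `t` after which the agents synchronized (`0` if there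
is none). The initial states `(D ω).state t m 1` are chosen by the environment and may depend on the
past. -/
structure IsRun {Ω : Type*} [MeasurableSpace Ω] (alg : CoopLSVI S A M d)
    (E : Fin M → EpisodicMDP S A) (T : ℕ) (P : Measure Ω) (D : Ω → Observations S A M)
    (k : Ω → ℕ → ℕ) : Prop where
  measurable_state : ∀ t ∈ Finset.Icc 1 T, ∀ m, ∀ h ∈ Finset.Icc 1 (alg.H + 1),
    Measurable fun ω => (D ω).state t m h
  action_eq : ∀ ω, ∀ t ∈ Finset.Icc 1 T, ∀ m, ∀ h ∈ Finset.Icc 1 alg.H,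
    (D ω).action t m h = alg.greedy (D ω) m t (k ω t) h ((D ω).state t m h)
  reward_eq : ∀ ω, ∀ t ∈ Finset.Icc 1 T, ∀ m, ∀ h ∈ Finset.Icc 1 alg.H,
    (D ω).reward t m h = (E m).reward h ((D ω).state t m h, (D ω).action t m h)
  sync_start : ∀ ω, k ω 1 = 0
  sync_of_test : ∀ ω, ∀ t ∈ Finset.Icc 1 T, alg.Sync (D ω) t (k ω t) → k ω (t + 1) = t
  sync_of_not_test : ∀ ω, ∀ t ∈ Finset.Icc 1 T, ¬ alg.Sync (D ω) t (k ω t) →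
    k ω (t + 1) = k ω t
  transition : ∀ t ∈ Finset.Icc 1 T, ∀ m, ∀ h ∈ Finset.Icc 1 alg.H, ∀ B, MeasurableSet B →
    P⟦(fun ω => (D ω).state t m (h + 1)) ⁻¹' B | past D alg.H t m h⟧ =ᵐ[P]
      fun ω => ((E m).transition h ((D ω).state t m h, (D ω).action t m h)).real B

/-- The cumulative group regret after `T` episodes. -/
def regret {Ω : Type*} (alg : CoopLSVI S A M d) (E : Fin M → EpisodicMDP S A) (T : ℕ)
    (D : Ω → Observations S A M) (k : Ω → ℕ → ℕ) (ω : Ω) : ℝ :=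
  ∑ m, ∑ t ∈ Finset.Icc 1 T,
    ((E m).optValue alg.H 1 ((D ω).state t m 1)
      - (E m).value alg.H (alg.greedyPolicy (D ω) m t (k ω t)) 1 ((D ω).state t m 1))

end CoopLSVI

end

/-! The proof combines optimism with an elliptical potential argument adapted to delayed sharing.

Confidence. A linear MDP makes `r + P V` linear in the features. The regression targets of agent `m`
differ from this linear function by martingale noise and by the heterogeneity of the other agents,
at most `(1 + L) ξ` per sample when `V` takes values in `[0, L]`. In the norm of the inverse Gram
matrix the heterogeneity costs only `(1 + L) ξ √(MT)` (`sum_smul_quad_le`). For the noise, fix the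
synchronization index, a value function and a direction: the noise is then a martingale transform,
and Hoeffding's lemma gives an exponential supermartingale along episodes, agents and steps
(`IsRun.measure_noise_le`). A union bound over all synchronization indices, a grid of directions and
a grid of value function parameters gives `NoiseControlled`; completing the square turns directions
into a self-normalized bound (`noise_quad_le`). The grid has log-cardinality of order `d² log(c d M
H T / α)`, so the confidence radius has the order of `β` (`confidence_radius_le`).

Optimism. On this event, backward induction shows that the value estimates dominate the values of
all policies and stay in the parametrized class (`Regular.vEst_spec`). The regret of an episode is
then at most twice the bonuses along the trajectory plus martingale differences
(`Regular.episode_regret_le`), whose total is controlled by Azuma–Hoeffding.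

Bonuses. Call an episode bad if the log-determinant of all data has grown by more than 1 since the
last synchronization. Bad episodes lie in at most `log det ≤ d log(d + MT)` synchronization periods,
and the unfired test limits each agent's bonuses in a period to `√(2S) + 1`. In the other episodes
the local Gram matrix is as good as the shared one up to the factor `e`, so the potential argument
gives `√(dMT)` up to logarithms (`IsSyncSchedule.sum_bonus_le`). -/

set_option linter.unusedSectionVars false

noncomputable section

/-! ### Regularized Gram matrices, determinants and the elliptical potential -/

section LinearAlgebra

variable {n : Type*} [Fintype n] [DecidableEq n] {A B : Matrix n n ℝ}

theorem Matrix.PosSemidef.dotProduct_mulVec_comm (hA : A.PosSemidef) (x y : n → ℝ) :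
    x ⬝ᵥ (A *ᵥ y) = y ⬝ᵥ (A *ᵥ x) := by
  have h : Aᵀ = A := by
    rw [← Matrix.conjTranspose_eq_transpose_of_trivial]; exact hA.isHermitian
  rw [Matrix.dotProduct_mulVec, ← Matrix.mulVec_transpose, h, dotProduct_comm]

theorem Matrix.PosSemidef.sq_dotProduct_mulVec_le (hA : A.PosSemidef) (x y : n → ℝ) :
    (x ⬝ᵥ (A *ᵥ y)) ^ 2 ≤ (x ⬝ᵥ (A *ᵥ x)) * (y ⬝ᵥ (A *ᵥ y)) := by
  have h : ∀ t : ℝ, 0 ≤ (y ⬝ᵥ (A *ᵥ y)) * (t * t) + (2 * (x ⬝ᵥ (A *ᵥ y))) * t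
      + x ⬝ᵥ (A *ᵥ x) := by
    intro t
    have := hA.dotProduct_mulVec_nonneg (x + t • y)
    simp only [star_trivial, Matrix.mulVec_add, Matrix.mulVec_smul, add_dotProduct, dotProduct_add,
      smul_dotProduct, dotProduct_smul, smul_eq_mul] at this
    rw [hA.dotProduct_mulVec_comm y x] at this
    linarith
  have := discrim_le_zero h
  rw [discrim] at this
  linarith

theorem Matrix.PosDef.mulVec_inv_mulVec (hA : A.PosDef) (v : n → ℝ) : A *ᵥ (A⁻¹ *ᵥ v) = v := by
  rw [Matrix.mulVec_mulVec, Matrix.mul_nonsing_inv _ hA.det_pos.ne'.isUnit, Matrix.one_mulVec]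

theorem Matrix.PosDef.inv_mulVec_mulVec (hA : A.PosDef) (v : n → ℝ) : A⁻¹ *ᵥ (A *ᵥ v) = v := by
  rw [Matrix.mulVec_mulVec, Matrix.nonsing_inv_mul _ hA.det_pos.ne'.isUnit, Matrix.one_mulVec]

theorem Matrix.PosDef.dotProduct_inv_nonneg (hA : A.PosDef) (v : n → ℝ) :
    0 ≤ v ⬝ᵥ (A⁻¹ *ᵥ v) := by
  simpa using hA.inv.posSemidef.dotProduct_mulVec_nonneg v

/-- Completing the square: `x ↦ 2 v·x - x·Ax` is maximal at `A⁻¹ v`. The exact remainder is needed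
later, when the maximizer is replaced by a nearby grid point. -/
theorem Matrix.PosDef.two_mul_dotProduct_sub_add (hA : A.PosDef) (v x : n → ℝ) :
    2 * (v ⬝ᵥ x) - x ⬝ᵥ (A *ᵥ x)
      + (x - A⁻¹ *ᵥ v) ⬝ᵥ (A *ᵥ (x - A⁻¹ *ᵥ v)) = v ⬝ᵥ (A⁻¹ *ᵥ v) := by
  have h1 := hA.posSemidef.dotProduct_mulVec_comm (A⁻¹ *ᵥ v) x
  rw [hA.mulVec_inv_mulVec] at h1
  simp only [Matrix.mulVec_sub, sub_dotProduct, dotProduct_sub, hA.mulVec_inv_mulVec, h1]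
  rw [dotProduct_comm v x, dotProduct_comm (A⁻¹ *ᵥ v) v]
  ring

theorem Matrix.PosDef.two_mul_dotProduct_sub_le (hA : A.PosDef) (v x : n → ℝ) :
    2 * (v ⬝ᵥ x) - x ⬝ᵥ (A *ᵥ x) ≤ v ⬝ᵥ (A⁻¹ *ᵥ v) := by
  have := hA.two_mul_dotProduct_sub_add v x
  have h2 := hA.posSemidef.dotProduct_mulVec_nonneg (x - A⁻¹ *ᵥ v)
  simp only [star_trivial] at h2
  linarith

theorem Matrix.PosDef.sq_dotProduct_le (hA : A.PosDef) (u v : n → ℝ) :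
    (u ⬝ᵥ v) ^ 2 ≤ (u ⬝ᵥ (A⁻¹ *ᵥ u)) * (v ⬝ᵥ (A *ᵥ v)) := by
  have h := hA.inv.posSemidef.sq_dotProduct_mulVec_le u (A *ᵥ v)
  rwa [hA.inv_mulVec_mulVec, dotProduct_comm (A *ᵥ v)] at h

/-- Inversion reverses the Loewner order: test the variational bound for `B` at the maximizer for `r
A`. -/
theorem Matrix.PosDef.dotProduct_inv_le_of_le (hA : A.PosDef) (hB : B.PosDef) {r : ℝ} (hr : 0 < r)
    (h : ∀ x, x ⬝ᵥ (B *ᵥ x) ≤ r * (x ⬝ᵥ (A *ᵥ x))) (v : n → ℝ) :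
    v ⬝ᵥ (A⁻¹ *ᵥ v) ≤ r * (v ⬝ᵥ (B⁻¹ *ᵥ v)) := by
  have h1 := hB.two_mul_dotProduct_sub_le v (r⁻¹ • (A⁻¹ *ᵥ v))
  have h2 := h (r⁻¹ • (A⁻¹ *ᵥ v))
  simp only [Matrix.mulVec_smul, smul_dotProduct, dotProduct_smul, smul_eq_mul,
    hA.mulVec_inv_mulVec] at h1 h2
  rw [dotProduct_comm (A⁻¹ *ᵥ v) v] at h2
  have h3 : r * (r⁻¹ * (r⁻¹ * (v ⬝ᵥ (A⁻¹ *ᵥ v)))) = r⁻¹ * (v ⬝ᵥ (A⁻¹ *ᵥ v)) := by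
    field_simp
  rw [h3] at h2
  have h4 : r⁻¹ * (v ⬝ᵥ (A⁻¹ *ᵥ v)) ≤ v ⬝ᵥ (B⁻¹ *ᵥ v) := by linarith
  rwa [inv_mul_le_iff₀ hr] at h4

/-- The Gram matrix of a finite family of vectors, regularized by the identity. -/
def regGram {ι : Type*} (v : ι → n → ℝ) (s : Finset ι) : Matrix n n ℝ :=
  ∑ i ∈ s, Matrix.vecMulVec (v i) (v i) + 1

variable {ι : Type*} {v : ι → n → ℝ} {s r : Finset ι}

theorem posDef_regGram (v : ι → n → ℝ) (s : Finset ι) : (regGram v s).PosDef := by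
  refine Matrix.PosDef.posSemidef_add (Matrix.posSemidef_sum _ fun i _ => ?_) Matrix.PosDef.one
  simpa using Matrix.posSemidef_vecMulVec_self_star (v i)

theorem regGram_mulVec (v : ι → n → ℝ) (s : Finset ι) (x : n → ℝ) :
    regGram v s *ᵥ x = ∑ i ∈ s, (v i ⬝ᵥ x) • v i + x := by
  rw [regGram, Matrix.add_mulVec, Matrix.one_mulVec, Matrix.sum_mulVec]
  congr 1
  refine Finset.sum_congr rfl fun i _ => ?_
  rw [Matrix.vecMulVec_mulVec]
  ext j
  simp [mul_comm]

theorem dotProduct_regGram (v : ι → n → ℝ) (s : Finset ι) (x : n → ℝ) :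
    x ⬝ᵥ (regGram v s *ᵥ x) = ∑ i ∈ s, (v i ⬝ᵥ x) ^ 2 + x ⬝ᵥ x := by
  rw [regGram_mulVec, dotProduct_add, dotProduct_sum]
  congr 1
  refine Finset.sum_congr rfl fun i _ => ?_
  rw [dotProduct_smul, dotProduct_comm x, smul_eq_mul, sq]

theorem dotProduct_self_nonneg' (x : n → ℝ) : 0 ≤ x ⬝ᵥ x :=
  Finset.sum_nonneg fun i _ => mul_self_nonneg (x i)

theorem sq_dotProduct_le_mul (x y : n → ℝ) : (x ⬝ᵥ y) ^ 2 ≤ (x ⬝ᵥ x) * (y ⬝ᵥ y) := by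
  simpa using (Matrix.PosDef.one (n := n) (R := ℝ)).posSemidef.sq_dotProduct_mulVec_le x y

theorem dotProduct_regGram_mono (h : s ⊆ r) (x : n → ℝ) :
    x ⬝ᵥ (regGram v s *ᵥ x) ≤ x ⬝ᵥ (regGram v r *ᵥ x) := by
  rw [dotProduct_regGram, dotProduct_regGram]
  gcongr

theorem dotProduct_inv_regGram_anti (h : s ⊆ r) (x : n → ℝ) :
    x ⬝ᵥ ((regGram v r)⁻¹ *ᵥ x) ≤ x ⬝ᵥ ((regGram v s)⁻¹ *ᵥ x) := by
  simpa using (posDef_regGram v r).dotProduct_inv_le_of_le (posDef_regGram v s) one_pos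
    (fun y => by simpa using dotProduct_regGram_mono h y) x

theorem regGram_empty : regGram v ∅ = 1 := by simp [regGram]

theorem dotProduct_inv_regGram_le (v : ι → n → ℝ) (s : Finset ι) (x : n → ℝ) :
    x ⬝ᵥ ((regGram v s)⁻¹ *ᵥ x) ≤ x ⬝ᵥ x := by
  simpa [regGram_empty] using dotProduct_inv_regGram_anti (v := v) (Finset.empty_subset s) x

theorem dotProduct_regGram_le (hv : ∀ i, v i ⬝ᵥ v i ≤ 1) (s : Finset ι) (x : n → ℝ) :
    x ⬝ᵥ (regGram v s *ᵥ x) ≤ (s.card + 1) * (x ⬝ᵥ x) := by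
  rw [dotProduct_regGram, add_mul, one_mul]
  gcongr
  rw [← nsmul_eq_mul]
  refine Finset.sum_le_card_nsmul _ _ _ fun i _ => (sq_dotProduct_le_mul _ _).trans ?_
  exact mul_le_of_le_one_left (dotProduct_self_nonneg' x) (hv i)

variable [DecidableEq ι]

theorem regGram_insert {i : ι} (hi : i ∉ s) :
    regGram v (insert i s) = regGram v s + Matrix.vecMulVec (v i) (v i) := by
  rw [regGram, regGram, Finset.sum_insert hi]
  abel

/-- The matrix determinant lemma for a rank-one update. -/
theorem det_regGram_insert {i : ι} (hi : i ∉ s) :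
    (regGram v (insert i s)).det
      = (regGram v s).det * (1 + v i ⬝ᵥ ((regGram v s)⁻¹ *ᵥ v i)) := by
  rw [regGram_insert hi, Matrix.vecMulVec_eq Unit,
    Matrix.det_add_replicateCol_mul_replicateRow (posDef_regGram v s).det_pos.ne'.isUnit]
  congr 1
  rw [Matrix.det_unique]
  simp only [Matrix.add_apply, Matrix.one_apply_eq]
  rw [Matrix.mul_assoc, ← Matrix.replicateCol_mulVec, Matrix.replicateRow_mul_replicateCol_apply]

theorem log_det_regGram_insert {i : ι} (hi : i ∉ s) :
    Real.log (regGram v (insert i s)).det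
      = Real.log (regGram v s).det + Real.log (1 + v i ⬝ᵥ ((regGram v s)⁻¹ *ᵥ v i)) := by
  have := (posDef_regGram v s).dotProduct_inv_nonneg (v i)
  rw [det_regGram_insert hi, Real.log_mul (posDef_regGram v s).det_pos.ne' (by positivity)]

theorem le_two_mul_log_one_add {x : ℝ} (h0 : 0 ≤ x) (h1 : x ≤ 1) : x ≤ 2 * Real.log (1 + x) := by
  have h := Real.one_sub_inv_le_log_of_pos (show 0 < 1 + x by positivity)
  have h2 : x / 2 ≤ 1 - (1 + x)⁻¹ := by
    rw [div_le_iff₀ two_pos]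
    have : (1 - (1 + x)⁻¹) * 2 = 2 * x / (1 + x) := by field_simp; ring
    rw [this, le_div_iff₀ (by positivity)]
    nlinarith
  linarith

theorem dotProduct_inv_le_log_det (hv : ∀ i, v i ⬝ᵥ v i ≤ 1) {i : ι} (hi : i ∉ s) :
    v i ⬝ᵥ ((regGram v s)⁻¹ *ᵥ v i)
      ≤ 2 * (Real.log (regGram v (insert i s)).det - Real.log (regGram v s).det) := by
  rw [log_det_regGram_insert hi, add_sub_cancel_left]
  exact le_two_mul_log_one_add ((posDef_regGram v s).dotProduct_inv_nonneg (v i))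
    ((dotProduct_inv_regGram_le v s _).trans (hv i))

theorem log_det_regGram_mono (h : s ⊆ r) :
    Real.log (regGram v s).det ≤ Real.log (regGram v r).det := by
  obtain ⟨u, hu, rfl⟩ : ∃ u, Disjoint s u ∧ s ∪ u = r :=
    ⟨r \ s, Finset.disjoint_sdiff, Finset.union_sdiff_of_subset h⟩
  clear h
  induction u using Finset.induction_on with
  | empty => simp
  | insert i u hi ih =>
    rw [Finset.disjoint_insert_right] at hu
    rw [Finset.union_insert, log_det_regGram_insert (by simp [hi, hu.1])]
    have := (posDef_regGram v (s ∪ u)).dotProduct_inv_nonneg (v i)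
    have := Real.log_nonneg (show 1 ≤ 1 + v i ⬝ᵥ ((regGram v (s ∪ u))⁻¹ *ᵥ v i) by linarith)
    linarith [ih hu.2]

/-- Batch form of the elliptical potential. Inserting vectors one at a time telescopes the
log-determinants, and replacing each intermediate matrix by the final, larger one only decreases the
summands. -/
theorem sum_dotProduct_inv_le_log_det (hv : ∀ i, v i ⬝ᵥ v i ≤ 1) (h : Disjoint s r) :
    ∑ i ∈ r, v i ⬝ᵥ ((regGram v (s ∪ r))⁻¹ *ᵥ v i)
      ≤ 2 * (Real.log (regGram v (s ∪ r)).det - Real.log (regGram v s).det) := by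
  induction r using Finset.induction_on with
  | empty => simp
  | insert i u hi ih =>
    rw [Finset.disjoint_insert_right] at h
    have hi' : i ∉ s ∪ u := by simp [hi, h.1]
    rw [Finset.sum_insert hi, Finset.union_insert]
    have h1 := dotProduct_inv_le_log_det hv hi'
    have h2 := ih h.2
    have h3 := dotProduct_inv_regGram_anti (v := v) (Finset.subset_insert i (s ∪ u)) (v i)
    have h4 := Finset.sum_le_sum (s := u) fun j _ =>
      dotProduct_inv_regGram_anti (v := v) (Finset.subset_insert i (s ∪ u)) (v j)
    linarith

/-- One new vector `v` multiplies the determinant by `1 + v·G⁻¹v`. By Cauchy–Schwarz `(v·x)² ≤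
(v·G⁻¹v)(x·Gx)`, so the quadratic form grows by at most the same factor. -/
theorem dotProduct_regGram_le_det_ratio (h : Disjoint s r) (x : n → ℝ) :
    x ⬝ᵥ (regGram v (s ∪ r) *ᵥ x)
      ≤ (regGram v (s ∪ r)).det / (regGram v s).det * (x ⬝ᵥ (regGram v s *ᵥ x)) := by
  induction r using Finset.induction_on with
  | empty => simp [div_self (posDef_regGram v s).det_pos.ne']
  | insert i u hi ih =>
    rw [Finset.disjoint_insert_right] at h
    have hi' : i ∉ s ∪ u := by simp [hi, h.1]
    have h1 := ih h.2
    have h0 := (posDef_regGram v (s ∪ u)).dotProduct_inv_nonneg (v i)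
    have h2 := (posDef_regGram v (s ∪ u)).sq_dotProduct_le (v i) x
    have h3 : x ⬝ᵥ (regGram v (insert i (s ∪ u)) *ᵥ x)
        = (v i ⬝ᵥ x) ^ 2 + x ⬝ᵥ (regGram v (s ∪ u) *ᵥ x) := by
      rw [dotProduct_regGram, dotProduct_regGram, Finset.sum_insert hi']; ring
    rw [Finset.union_insert, h3, det_regGram_insert hi', mul_div_right_comm, mul_assoc,
      mul_left_comm]
    have h4 := mul_le_mul_of_nonneg_left h1
      (show 0 ≤ 1 + v i ⬝ᵥ ((regGram v (s ∪ u))⁻¹ *ᵥ v i) by linarith)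
    linarith

theorem dotProduct_inv_le_det_ratio (h : s ⊆ r) (x : n → ℝ) :
    x ⬝ᵥ ((regGram v s)⁻¹ *ᵥ x)
      ≤ (regGram v r).det / (regGram v s).det * (x ⬝ᵥ ((regGram v r)⁻¹ *ᵥ x)) := by
  refine (posDef_regGram v s).dotProduct_inv_le_of_le (posDef_regGram v r)
    (div_pos (posDef_regGram v r).det_pos (posDef_regGram v s).det_pos) (fun y => ?_) x
  have := dotProduct_regGram_le_det_ratio (v := v) (s := s) (r := r \ s) Finset.disjoint_sdiff y
  rwa [Finset.union_sdiff_of_subset h] at this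

theorem log_det_regGram_nonneg : 0 ≤ Real.log (regGram v s).det := by
  simpa [regGram_empty] using log_det_regGram_mono (v := v) (Finset.empty_subset s)

/-- Each eigenvalue is at most the trace, and each vector adds at most one to the trace. -/
theorem log_det_regGram_le (hv : ∀ i, v i ⬝ᵥ v i ≤ 1) (s : Finset ι) :
    Real.log (regGram v s).det ≤ Fintype.card n * Real.log (Fintype.card n + s.card) := by
  have hA := posDef_regGram v s
  have htr : (regGram v s).trace ≤ Fintype.card n + s.card := by
    rw [regGram, Matrix.trace_add, Matrix.trace_one, Matrix.trace_sum, add_comm]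
    gcongr
    rw [← mul_one (s.card : ℝ), ← nsmul_eq_mul]
    refine Finset.sum_le_card_nsmul _ _ _ fun i _ => ?_
    rw [Matrix.trace_vecMulVec]
    exact hv i
  have heig : ∀ i, hA.isHermitian.eigenvalues i ≤ Fintype.card n + s.card := by
    intro i
    refine le_trans ?_ htr
    rw [hA.isHermitian.trace_eq_sum_eigenvalues]
    exact Finset.single_le_sum (f := fun i => hA.isHermitian.eigenvalues i)
      (fun j _ => (hA.eigenvalues_pos j).le) (Finset.mem_univ i)
  have hdet : (regGram v s).det = ∏ i, hA.isHermitian.eigenvalues i := by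
    simpa using hA.isHermitian.det_eq_prod_eigenvalues
  rw [hdet, Real.log_prod fun i _ => (hA.eigenvalues_pos i).ne', ← nsmul_eq_mul, ← Finset.card_univ]
  refine Finset.sum_le_card_nsmul _ _ _ fun i _ => ?_
  exact Real.log_le_log (hA.eigenvalues_pos i) (heig i)

end LinearAlgebra

/-! ### Sum of the bonuses under a synchronization schedule -/

section Synchronization

variable {n : Type*} [Fintype n] [DecidableEq n] {M : ℕ} {v : Fin M × ℕ → n → ℝ} {κ : ℕ → ℕ}
  {S : ℝ} {T : ℕ}

/-- The (agent, episode) pairs that are shared after a synchronization in episode `k`. -/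
def syncPairs (M k : ℕ) : Finset (Fin M × ℕ) := Finset.univ ×ˢ Finset.Icc 1 k

theorem mem_syncPairs {k : ℕ} {p : Fin M × ℕ} : p ∈ syncPairs M k ↔ 1 ≤ p.2 ∧ p.2 ≤ k := by
  simp [syncPairs]

theorem mem_avail {m : Fin M} {t k : ℕ} {p : Fin M × ℕ} :
    p ∈ CoopLSVI.avail m t k ↔ (1 ≤ p.2 ∧ p.2 ≤ t - 1) ∧ (p.2 ≤ k ∨ p.1 = m) := by
  simp [CoopLSVI.avail]

theorem syncPairs_mono {j k : ℕ} (h : j ≤ k) : syncPairs M j ⊆ syncPairs M k := fun p hp => by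
  rw [mem_syncPairs] at *; omega

theorem syncPairs_subset_avail {m : Fin M} {t k : ℕ} (h : k < t) :
    syncPairs M k ⊆ CoopLSVI.avail m t k := fun p hp => by
  rw [mem_syncPairs] at hp; rw [mem_avail]; omega

theorem avail_subset_syncPairs {m : Fin M} {t k T : ℕ} (h : t ≤ T + 1) :
    CoopLSVI.avail m t k ⊆ syncPairs M T := fun p hp => by
  rw [mem_avail] at hp; rw [mem_syncPairs]; omega

theorem card_syncPairs {k : ℕ} : (syncPairs M k).card = M * k := by
  simp [syncPairs, Finset.card_product]

theorem avail_succ_self {m : Fin M} {k : ℕ} : CoopLSVI.avail m (k + 1) k = syncPairs M k := by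
  ext p; rw [mem_avail, mem_syncPairs]; omega

theorem avail_succ {m : Fin M} {t k : ℕ} (h : k < t) :
    CoopLSVI.avail m (t + 1) k = insert (m, t) (CoopLSVI.avail m t k) := by
  ext ⟨a, τ⟩
  rw [Finset.mem_insert, mem_avail, mem_avail, Prod.mk.injEq]
  dsimp only
  by_cases ha : a = m <;> simp only [ha, or_true, and_true, true_and, or_false, false_and, false_or]
    <;> omega

theorem notMem_avail {m : Fin M} {t k : ℕ} : (m, t) ∉ CoopLSVI.avail m t k := by
  rw [mem_avail]; dsimp only; omega

/-- `κ t` is the last episode before `t` after which the agents synchronized; no synchronization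
means that all log-determinants grew by at most `S / (t - κ t)`. -/
structure IsSyncSchedule (v : Fin M × ℕ → n → ℝ) (S : ℝ) (T : ℕ) (κ : ℕ → ℕ) : Prop where
  start : κ 1 = 0
  step : ∀ t ∈ Finset.Icc 1 T, κ (t + 1) = t ∨ κ (t + 1) = κ t ∧
    ∀ m, Real.log ((regGram v (insert (m, t) (CoopLSVI.avail m t (κ t)))).det
      / (regGram v (syncPairs M (κ t))).det) ≤ S / ((t : ℝ) - κ t)

namespace IsSyncSchedule

theorem lt_self (hκ : IsSyncSchedule v S T κ) {t : ℕ} (h1 : 1 ≤ t) (hT : t ≤ T + 1) : κ t < t := by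
  induction t, h1 using Nat.le_induction with
  | base => simp [hκ.start]
  | succ t h1 ih =>
    have := ih (by omega)
    rcases hκ.step t (by simp; omega) with h | h <;> omega

theorem mono (hκ : IsSyncSchedule v S T κ) {s t : ℕ} (h1 : 1 ≤ s) (hst : s ≤ t) (hT : t ≤ T + 1) :
    κ s ≤ κ t := by
  induction t, hst using Nat.le_induction with
  | base => exact le_rfl
  | succ t h ih =>
    have := ih (by omega)
    have := hκ.lt_self (t := t) (by omega) (by omega)
    rcases hκ.step t (by simp; omega) with h | h <;> omega

/-- The first episode after the last synchronization belongs to the period of `t`. With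
monotonicity, every episode between them does too. -/
theorem succ_apply (hκ : IsSyncSchedule v S T κ) {t : ℕ} (h1 : 1 ≤ t) (hT : t ≤ T + 1) :
    κ (κ t + 1) = κ t := by
  induction t, h1 using Nat.le_induction with
  | base => simp [hκ.start]
  | succ t h1 ih =>
    have := ih (by omega)
    rcases hκ.step t (by simp; omega) with h | h
    · rw [h, h]
    · rw [h.1, this]

theorem log_det_avail_le (hκ : IsSyncSchedule v S T κ) {t : ℕ} (h1 : 1 ≤ t) (hT : t ≤ T)
    (h : κ (t + 1) = κ t) (m : Fin M) :
    Real.log (regGram v (CoopLSVI.avail m (t + 1) (κ t))).det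
      - Real.log (regGram v (syncPairs M (κ t))).det ≤ S / ((t : ℝ) - κ t) := by
  have hlt := hκ.lt_self h1 (by omega)
  rcases hκ.step t (by simp; omega) with h' | h'
  · omega
  · rw [← Real.log_div (posDef_regGram v _).det_pos.ne' (posDef_regGram v _).det_pos.ne',
      avail_succ hlt]
    exact h'.2 m

end IsSyncSchedule

/-- Between synchronizations an agent appends exactly its own feature vectors one by one, so the
potential argument telescopes from the shared Gram matrix. -/
theorem sum_local_le_log_det (hv : ∀ i, v i ⬝ᵥ v i ≤ 1) (m : Fin M) (k j : ℕ) :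
    ∑ t ∈ Finset.Icc (k + 1) (k + j), v (m, t) ⬝ᵥ ((regGram v (CoopLSVI.avail m t k))⁻¹ *ᵥ v (m, t))
      ≤ 2 * (Real.log (regGram v (CoopLSVI.avail m (k + j + 1) k)).det
        - Real.log (regGram v (syncPairs M k)).det) := by
  induction j with
  | zero => simp [avail_succ_self]
  | succ j ih =>
    rw [← add_assoc, Finset.sum_Icc_succ_top (by omega)]
    have h1 := dotProduct_inv_le_log_det hv (notMem_avail (m := m) (t := k + j + 1) (k := k))
    rw [← avail_succ (by omega)] at h1
    linarith

theorem sum_sqrt_le_sqrt_card_mul {α : Type*} (s : Finset α) {f : α → ℝ} (hf : ∀ i ∈ s, 0 ≤ f i) :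
    ∑ i ∈ s, √(f i) ≤ √(s.card * ∑ i ∈ s, f i) := by
  refine Real.le_sqrt_of_sq_le ((sq_sum_le_card_mul_sum_sq).trans_eq ?_)
  congr 1
  exact Finset.sum_congr rfl fun i hi => Real.sq_sqrt (hf i hi)

/-- Within one synchronization period the bonuses of an agent add up to at most `√(2S) + 1`. -/
theorem IsSyncSchedule.sum_period_le (hκ : IsSyncSchedule v S T κ)
    (hv : ∀ i, v i ⬝ᵥ v i ≤ 1) (m : Fin M) (k : ℕ) :
    ∑ t ∈ (Finset.Icc 1 T).filter (fun t => κ t = k),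
      √(v (m, t) ⬝ᵥ ((regGram v (CoopLSVI.avail m t (κ t)))⁻¹ *ᵥ v (m, t))) ≤ √(2 * S) + 1 := by
  set F := (Finset.Icc 1 T).filter (fun t => κ t = k) with hF
  have hcongr : ∑ t ∈ F, √(v (m, t) ⬝ᵥ ((regGram v (CoopLSVI.avail m t (κ t)))⁻¹ *ᵥ v (m, t)))
      = ∑ t ∈ F, √(v (m, t) ⬝ᵥ ((regGram v (CoopLSVI.avail m t k))⁻¹ *ᵥ v (m, t))) :=
    Finset.sum_congr rfl fun t ht => by rw [(Finset.mem_filter.1 ht).2]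
  rw [hcongr]
  have hpos : 0 ≤ √(2 * S) + 1 := by positivity
  rcases F.eq_empty_or_nonempty with h0 | hne
  · simpa [h0] using hpos
  set e := F.max' hne with he
  have heF : e ∈ F := F.max'_mem hne
  have heF' := heF
  rw [hF, Finset.mem_filter, Finset.mem_Icc] at heF'
  have hke : k < e := by
    have := hκ.lt_self heF'.1.1 (by omega); omega
  obtain ⟨j, hj⟩ : ∃ j, e = k + j + 1 := ⟨e - k - 1, by omega⟩
  have hsub : F.erase e ⊆ Finset.Icc (k + 1) (k + j) := by
    intro t ht
    rw [Finset.mem_erase] at ht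
    have h1 : t ≤ e := F.le_max' t ht.2
    have h2 := ht.2
    rw [hF, Finset.mem_filter, Finset.mem_Icc] at h2
    have := hκ.lt_self h2.1.1 (by omega)
    rw [Finset.mem_Icc]; omega
  -- The test may fire in the last episode `e` of the period, so the threshold says nothing about
  -- it; its bonus is bounded by one.
  have hlast : √(v (m, e) ⬝ᵥ ((regGram v (CoopLSVI.avail m e k))⁻¹ *ᵥ v (m, e))) ≤ 1 :=
    Real.sqrt_le_one.2 ((dotProduct_inv_regGram_le v _ _).trans (hv _))
  rw [← Finset.add_sum_erase F _ heF]
  suffices ∑ t ∈ F.erase e, √(v (m, t) ⬝ᵥ ((regGram v (CoopLSVI.avail m t k))⁻¹ *ᵥ v (m, t)))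
      ≤ √(2 * S) by linarith
  rcases (F.erase e).eq_empty_or_nonempty with h0 | ⟨t, ht⟩
  · rw [h0]; simp
  have htI := Finset.mem_Icc.1 (hsub ht)
  have ht' := (Finset.mem_erase.1 ht).2
  rw [hF, Finset.mem_filter, Finset.mem_Icc] at ht'
  -- Episode `e - 1 = k + j` is still in the period and was not followed by a synchronization, so
  -- its failed test bounds the growth by `S / j`.
  have hkj : κ (k + j) = k := by
    have h1 := hκ.mono ht'.1.1 htI.2 (by omega)
    have h2 := hκ.mono (s := k + j) (t := e) (by omega) (by omega) (by omega)
    omega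
  have h1 := hκ.log_det_avail_le (t := k + j) (by omega) (by omega)
    (by rw [hkj, ← hj]; exact heF'.2) m
  rw [hkj] at h1
  have hj0 : (0 : ℝ) < j := by
    have : 0 < j := by omega
    exact_mod_cast this
  have h2 := sum_local_le_log_det hv m k j
  calc _ ≤ ∑ t ∈ Finset.Icc (k + 1) (k + j),
        √(v (m, t) ⬝ᵥ ((regGram v (CoopLSVI.avail m t k))⁻¹ *ᵥ v (m, t))) :=
        Finset.sum_le_sum_of_subset_of_nonneg hsub fun _ _ _ => Real.sqrt_nonneg _
    _ ≤ _ := sum_sqrt_le_sqrt_card_mul _ fun t _ => (posDef_regGram v _).dotProduct_inv_nonneg _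
    -- The number `j` of episodes from Cauchy–Schwarz cancels the denominator of `S / j`; this is
    -- why the test compares with `S / (t - k)`.
    _ ≤ √(2 * S) := by
      apply Real.sqrt_le_sqrt
      have hc : ((Finset.Icc (k + 1) (k + j)).card : ℝ) = j := by simp
      rw [hc]
      have h3 : (((k + j : ℕ) : ℝ) - k) = j := by push_cast; ring
      rw [h3] at h1
      have h4 := mul_le_mul_of_nonneg_left (h2.trans (mul_le_mul_of_nonneg_left h1 zero_le_two))
        hj0.le
      refine h4.trans_eq ?_
      field_simp

/-- The number of synchronization periods that contain an episode with a large increase of the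
log-determinant. -/
theorem IsSyncSchedule.card_bad_le (hκ : IsSyncSchedule v S T κ) {t : ℕ} (hT : t ≤ T) :
    ((((Finset.Icc 1 t).filter (fun t => 1 < Real.log (regGram v (syncPairs M t)).det
        - Real.log (regGram v (syncPairs M (κ t))).det)).image κ).card : ℝ)
      ≤ Real.log (regGram v (syncPairs M t)).det := by
  set bad : ℕ → Prop := fun t => 1 < Real.log (regGram v (syncPairs M t)).det
        - Real.log (regGram v (syncPairs M (κ t))).det with hbad
  induction t using Nat.strong_induction_on with
  | _ t ih =>
  rcases Nat.eq_zero_or_pos t with rfl | ht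
  · simpa using log_det_regGram_nonneg
  obtain ⟨u, rfl⟩ : ∃ u, t = u + 1 := ⟨t - 1, by omega⟩
  have hins : Finset.Icc 1 (u + 1) = insert (u + 1) (Finset.Icc 1 u) := by
    ext x; simp; omega
  have hmono := log_det_regGram_mono (v := v) (syncPairs_mono (M := M) (Nat.le_succ u))
  by_cases hb : bad (u + 1)
  · rw [hins, Finset.filter_insert, if_pos hb, Finset.image_insert]
    have hlt := hκ.lt_self ht (by omega)
    -- Bad episodes after `κ (u + 1)` share the period of `u + 1` and add a single value of `κ`. The
    -- earlier ones are counted by induction at `κ (u + 1)`, where the log-determinant is smaller by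
    -- more than one.
    have hsub : ((Finset.Icc 1 u).filter bad).image κ
        ⊆ insert (κ (u + 1)) (((Finset.Icc 1 (κ (u + 1))).filter bad).image κ) := by
      intro x hx
      obtain ⟨s, hs, rfl⟩ := Finset.mem_image.1 hx
      rw [Finset.mem_filter, Finset.mem_Icc] at hs
      rw [Finset.mem_insert]
      by_cases hsk : s ≤ κ (u + 1)
      · right
        exact Finset.mem_image_of_mem κ (by
          rw [Finset.mem_filter, Finset.mem_Icc]; exact ⟨⟨hs.1.1, hsk⟩, hs.2⟩)
      · left
        have h1 := hκ.succ_apply ht (by omega)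
        have h2 := hκ.mono (s := κ (u + 1) + 1) (t := s) (by omega) (by omega) (by omega)
        have h3 := hκ.mono (s := s) (t := u + 1) (by omega) (by omega) (by omega)
        omega
    have hsub' : insert (κ (u + 1)) (((Finset.Icc 1 u).filter bad).image κ)
        ⊆ insert (κ (u + 1)) (((Finset.Icc 1 (κ (u + 1))).filter bad).image κ) :=
      Finset.insert_subset (Finset.mem_insert_self _ _) hsub
    have h1 := (Finset.card_le_card hsub').trans (Finset.card_insert_le _ _)
    have h2 := ih (κ (u + 1)) hlt (by omega)
    have h3 : 1 < Real.log (regGram v (syncPairs M (u + 1))).det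
        - Real.log (regGram v (syncPairs M (κ (u + 1)))).det := hb
    have h4 : ((insert (κ (u + 1)) (((Finset.Icc 1 u).filter bad).image κ)).card : ℝ)
        ≤ (((Finset.Icc 1 (κ (u + 1))).filter bad).image κ).card + 1 := by exact_mod_cast h1
    linarith
  · rw [hins, Finset.filter_insert, if_neg hb]
    exact (ih u (by omega) (by omega)).trans hmono

/-- The determinant has grown by at most the factor `e` since the last synchronization. Up to this
factor the local weights are therefore those of the Gram matrix of all data including episode `t`,
to which the batch potential bound applies. -/
theorem IsSyncSchedule.sum_good_le (hκ : IsSyncSchedule v S T κ) (hv : ∀ i, v i ⬝ᵥ v i ≤ 1)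
    {t : ℕ} (h1 : 1 ≤ t) (hT : t ≤ T)
    (hgood : Real.log (regGram v (syncPairs M t)).det
        - Real.log (regGram v (syncPairs M (κ t))).det ≤ 1) :
    ∑ m, v (m, t) ⬝ᵥ ((regGram v (CoopLSVI.avail m t (κ t)))⁻¹ *ᵥ v (m, t))
      ≤ 2 * Real.exp 1 * (Real.log (regGram v (syncPairs M t)).det
        - Real.log (regGram v (syncPairs M (t - 1))).det) := by
  have hlt := hκ.lt_self h1 (by omega)
  have hratio : (regGram v (syncPairs M t)).det / (regGram v (syncPairs M (κ t))).det
      ≤ Real.exp 1 := by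
    rw [← Real.log_div (posDef_regGram v _).det_pos.ne' (posDef_regGram v _).det_pos.ne'] at hgood
    rw [← Real.log_le_iff_le_exp
      (div_pos (posDef_regGram v _).det_pos (posDef_regGram v _).det_pos)]
    exact hgood
  have hterm : ∀ m, v (m, t) ⬝ᵥ ((regGram v (CoopLSVI.avail m t (κ t)))⁻¹ *ᵥ v (m, t))
      ≤ Real.exp 1 * (v (m, t) ⬝ᵥ ((regGram v (syncPairs M t))⁻¹ *ᵥ v (m, t))) := by
    intro m
    refine (dotProduct_inv_regGram_anti (syncPairs_subset_avail hlt) _).trans ?_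
    refine (dotProduct_inv_le_det_ratio (syncPairs_mono hlt.le) _).trans ?_
    exact mul_le_mul_of_nonneg_right hratio ((posDef_regGram v _).dotProduct_inv_nonneg _)
  have hdisj : Disjoint (syncPairs M (t - 1)) (Finset.univ.image fun m : Fin M => (m, t)) := by
    rw [Finset.disjoint_left]
    intro p hp hp'
    rw [mem_syncPairs] at hp
    obtain ⟨m, -, rfl⟩ := Finset.mem_image.1 hp'
    dsimp only at hp; omega
  have hun : syncPairs M (t - 1) ∪ (Finset.univ.image fun m : Fin M => (m, t)) = syncPairs M t := by
    ext ⟨a, τ⟩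
    simp only [Finset.mem_union, mem_syncPairs, Finset.mem_image, Finset.mem_univ, true_and,
      Prod.mk.injEq, exists_eq_left]
    omega
  have hpot := sum_dotProduct_inv_le_log_det hv hdisj
  rw [hun, Finset.sum_image (by intro a _ b _ h; simpa using h)] at hpot
  calc _ ≤ ∑ m, Real.exp 1 * (v (m, t) ⬝ᵥ ((regGram v (syncPairs M t))⁻¹ *ᵥ v (m, t))) :=
        Finset.sum_le_sum fun m _ => hterm m
    _ ≤ _ := by
      rw [← Finset.mul_sum]
      have := mul_le_mul_of_nonneg_left hpot (Real.exp_pos 1).le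
      linarith

/-- Bad episodes are grouped by period, at most `R` of them, each costing `√(2S) + 1` per agent. For
the good ones Cauchy–Schwarz is applied to the telescoping sum of squared bonuses. -/
theorem IsSyncSchedule.sum_bonus_le (hκ : IsSyncSchedule v S T κ)
    (hv : ∀ i, v i ⬝ᵥ v i ≤ 1) {R : ℝ} (hR : Real.log (regGram v (syncPairs M T)).det ≤ R) :
    ∑ m, ∑ t ∈ Finset.Icc 1 T,
        √(v (m, t) ⬝ᵥ ((regGram v (CoopLSVI.avail m t (κ t)))⁻¹ *ᵥ v (m, t)))
      ≤ √(M * T * (2 * Real.exp 1 * R)) + M * (R * (√(2 * S) + 1)) := by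
  set b : Fin M → ℕ → ℝ := fun m t =>
    v (m, t) ⬝ᵥ ((regGram v (CoopLSVI.avail m t (κ t)))⁻¹ *ᵥ v (m, t)) with hb
  have hb0 : ∀ m t, 0 ≤ b m t := fun m t => (posDef_regGram v _).dotProduct_inv_nonneg _
  set bad : ℕ → Prop := fun t => 1 < Real.log (regGram v (syncPairs M t)).det
        - Real.log (regGram v (syncPairs M (κ t))).det with hbad
  have hsplit : ∑ m, ∑ t ∈ Finset.Icc 1 T, √(b m t)
      = (∑ m, ∑ t ∈ (Finset.Icc 1 T).filter bad, √(b m t))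
        + ∑ m, ∑ t ∈ (Finset.Icc 1 T).filter (fun t => ¬ bad t), √(b m t) := by
    rw [← Finset.sum_add_distrib]
    exact Finset.sum_congr rfl fun m _ => (Finset.sum_filter_add_sum_filter_not _ _ _).symm
  have hbadsum : ∀ m, ∑ t ∈ (Finset.Icc 1 T).filter bad, √(b m t) ≤ R * (√(2 * S) + 1) := by
    intro m
    rw [← Finset.sum_fiberwise_of_maps_to (g := κ)
      (t := ((Finset.Icc 1 T).filter bad).image κ) fun t ht => Finset.mem_image_of_mem κ ht]
    calc _ ≤ ∑ k ∈ ((Finset.Icc 1 T).filter bad).image κ, (√(2 * S) + 1) := by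
          refine Finset.sum_le_sum fun k _ => le_trans ?_ (hκ.sum_period_le hv m k)
          refine Finset.sum_le_sum_of_subset_of_nonneg ?_ fun _ _ _ => Real.sqrt_nonneg _
          exact Finset.filter_subset_filter _ (Finset.filter_subset _ _)
      _ ≤ _ := by
        rw [Finset.sum_const, nsmul_eq_mul]
        exact mul_le_mul_of_nonneg_right ((hκ.card_bad_le le_rfl).trans hR) (by positivity)
  have hgoodsq : ∑ t ∈ (Finset.Icc 1 T).filter (fun t => ¬ bad t), ∑ m, b m t
      ≤ 2 * Real.exp 1 * R := by
    have htel : ∀ U, ∑ t ∈ Finset.Icc 1 U, (Real.log (regGram v (syncPairs M t)).det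
        - Real.log (regGram v (syncPairs M (t - 1))).det)
        = Real.log (regGram v (syncPairs M U)).det := by
      intro U
      induction U with
      | zero => simp [syncPairs, regGram_empty]
      | succ U ih => rw [Finset.sum_Icc_succ_top (by omega), ih]; simp
    calc _ ≤ ∑ t ∈ (Finset.Icc 1 T).filter (fun t => ¬ bad t), 2 * Real.exp 1 *
            (Real.log (regGram v (syncPairs M t)).det
              - Real.log (regGram v (syncPairs M (t - 1))).det) := by
          refine Finset.sum_le_sum fun t ht => ?_
          rw [Finset.mem_filter, Finset.mem_Icc] at ht
          exact hκ.sum_good_le hv ht.1.1 ht.1.2 (not_lt.1 ht.2)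
      _ ≤ ∑ t ∈ Finset.Icc 1 T, 2 * Real.exp 1 *
            (Real.log (regGram v (syncPairs M t)).det
              - Real.log (regGram v (syncPairs M (t - 1))).det) := by
          refine Finset.sum_le_sum_of_subset_of_nonneg (Finset.filter_subset _ _) fun t _ _ => ?_
          have := log_det_regGram_mono (v := v) (syncPairs_mono (M := M) (Nat.sub_le t 1))
          have := Real.exp_pos 1
          exact mul_nonneg (by positivity) (by linarith)
      _ ≤ _ := by
          rw [← Finset.mul_sum, htel]
          exact mul_le_mul_of_nonneg_left hR (by have := Real.exp_pos 1; positivity)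
  have hgood : ∑ m, ∑ t ∈ (Finset.Icc 1 T).filter (fun t => ¬ bad t), √(b m t)
      ≤ √(M * T * (2 * Real.exp 1 * R)) := by
    rw [Finset.sum_comm, ← Finset.sum_product']
    refine (sum_sqrt_le_sqrt_card_mul _ fun i _ => hb0 _ _).trans (Real.sqrt_le_sqrt ?_)
    rw [Finset.sum_product' (f := fun t m => b m t)]
    refine mul_le_mul ?_ hgoodsq (Finset.sum_nonneg fun _ _ => Finset.sum_nonneg fun _ _ => hb0 _ _)
      (by positivity)
    rw [Finset.card_product, Finset.card_univ, Fintype.card_fin, mul_comm]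
    push_cast
    gcongr
    have := Finset.card_filter_le (Finset.Icc 1 T) (fun t => ¬ bad t)
    simpa using this
  have hbadtot : ∑ m, ∑ t ∈ (Finset.Icc 1 T).filter bad, √(b m t)
      ≤ M * (R * (√(2 * S) + 1)) := by
    refine (Finset.sum_le_sum fun m _ => hbadsum m).trans_eq ?_
    simp
  rw [hsplit]
  linarith

end Synchronization

/-! ### Integrals of bounded functions through their level sets -/

section BoundedIntegrals

variable {S : Type*} [MeasurableSpace S]

theorem integrable_of_mem_Icc {μ : Measure S} [IsFiniteMeasure μ] {f : S → ℝ} (hf : Measurable f)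
    {a b : ℝ} (h : ∀ x, f x ∈ Set.Icc a b) : Integrable f μ :=
  Integrable.of_mem_Icc a b hf.aemeasurable (Filter.Eventually.of_forall h)

theorem integral_mem_Icc_of_forall {μ : Measure S} [IsProbabilityMeasure μ] {f : S → ℝ}
    (hf : Measurable f) {a b : ℝ} (h : ∀ x, f x ∈ Set.Icc a b) : ∫ x, f x ∂μ ∈ Set.Icc a b := by
  have hi := integrable_of_mem_Icc (μ := μ) hf h
  constructor
  · simpa using integral_mono (integrable_const a) hi fun x => (h x).1
  · simpa using integral_mono hi (integrable_const b) fun x => (h x).2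

/-- The layer cake formula reduces integrals to probabilities of events, which is all that the total
variation bound and the signed measures of a linear MDP control. -/
theorem integral_eq_setIntegral_Ioc {μ : Measure S} [IsFiniteMeasure μ] {V : S → ℝ}
    (hV : Measurable V) {L : ℝ} (h : ∀ x, V x ∈ Set.Icc 0 L) :
    ∫ x, V x ∂μ = ∫ t in Set.Ioc 0 L, μ.real {x | t ≤ V x} :=
  (integrable_of_mem_Icc hV h).integral_eq_integral_Ioc_meas_le
    (Filter.Eventually.of_forall fun x => (h x).1) (Filter.Eventually.of_forall fun x => (h x).2)

theorem integrableOn_measureReal_le (μ : Measure S) [IsFiniteMeasure μ] (V : S → ℝ) (L : ℝ) :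
    IntegrableOn (fun t => μ.real {x | t ≤ V x}) (Set.Ioc 0 L) := by
  have hanti : Antitone fun t => μ.real {x | t ≤ V x} := fun s t hst =>
    measureReal_mono fun x hx => hst.trans hx
  exact integrable_of_mem_Icc (a := 0) (b := μ.real Set.univ) hanti.measurable
    fun t => ⟨measureReal_nonneg, measureReal_mono (Set.subset_univ _)⟩

theorem abs_measureReal_sub_le_tvDist (μ ν : Measure S) [IsProbabilityMeasure μ]
    [IsProbabilityMeasure ν] {B : Set S} (hB : MeasurableSet B) :
    |μ.real B - ν.real B| ≤ tvDist μ ν := by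
  refine le_ciSup (f := fun B : {B : Set S // MeasurableSet B} => |μ.real B - ν.real B|)
    ⟨1, ?_⟩ ⟨B, hB⟩
  rintro _ ⟨C, rfl⟩
  have h1 := measureReal_nonneg (μ := μ) (s := (C : Set S))
  have h2 := measureReal_nonneg (μ := ν) (s := (C : Set S))
  have h3 := measureReal_le_one (μ := μ) (s := (C : Set S))
  have h4 := measureReal_le_one (μ := ν) (s := (C : Set S))
  rw [abs_le]; constructor <;> linarith

theorem abs_integral_sub_le_tvDist (μ ν : Measure S) [IsProbabilityMeasure μ]
    [IsProbabilityMeasure ν] {V : S → ℝ} (hV : Measurable V) {L : ℝ} (hL : 0 ≤ L)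
    (h : ∀ x, V x ∈ Set.Icc 0 L) :
    |∫ x, V x ∂μ - ∫ x, V x ∂ν| ≤ L * tvDist μ ν := by
  rw [integral_eq_setIntegral_Ioc hV h, integral_eq_setIntegral_Ioc hV h,
    ← integral_sub (integrableOn_measureReal_le μ V L) (integrableOn_measureReal_le ν V L)]
  have := norm_setIntegral_le_of_norm_le_const (μ := volume) (s := Set.Ioc 0 L)
    (f := fun t => μ.real {x | t ≤ V x} - ν.real {x | t ≤ V x}) (C := tvDist μ ν) (by simp)
    fun t _ => abs_measureReal_sub_le_tvDist μ ν (measurableSet_le measurable_const hV)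
  simpa [measureReal_def, hL, mul_comm] using this

theorem signedMeasure_apply_eq (μ : SignedMeasure S) {B : Set S} (hB : MeasurableSet B) :
    μ B = μ.toJordanDecomposition.posPart.real B - μ.toJordanDecomposition.negPart.real B := by
  conv_lhs => rw [← SignedMeasure.toSignedMeasure_toJordanDecomposition μ,
    JordanDecomposition.toSignedMeasure]
  rw [_root_.sub_apply, Measure.toSignedMeasure_apply_measurable hB,
    Measure.toSignedMeasure_apply_measurable hB]

theorem integrableOn_signedMeasure_le (μ : SignedMeasure S) {V : S → ℝ} (hV : Measurable V)
    (L : ℝ) : IntegrableOn (fun t => μ {x | t ≤ V x}) (Set.Ioc 0 L) := by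
  have h : (fun t => μ {x | t ≤ V x}) = fun t =>
      μ.toJordanDecomposition.posPart.real {x | t ≤ V x}
        - μ.toJordanDecomposition.negPart.real {x | t ≤ V x} :=
    funext fun t => signedMeasure_apply_eq μ (measurableSet_le measurable_const hV)
  rw [h]
  exact (integrableOn_measureReal_le _ V L).sub (integrableOn_measureReal_le _ V L)

end BoundedIntegrals

/-! ### The Euclidean norm of coordinate vectors -/

section EuclNorm

variable {d : ℕ}

theorem euclNorm_le_iff {v : Fin d → ℝ} {c : ℝ} (hc : 0 ≤ c) : euclNorm v ≤ c ↔ v ⬝ᵥ v ≤ c ^ 2 :=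
  Real.sqrt_le_left hc

theorem abs_dotProduct_le_euclNorm (u v : Fin d → ℝ) : |u ⬝ᵥ v| ≤ euclNorm u * euclNorm v := by
  rw [euclNorm, euclNorm, ← Real.sqrt_mul (dotProduct_self_nonneg' u)]
  exact Real.abs_le_sqrt (sq_dotProduct_le_mul u v)

theorem euclNorm_nonneg (v : Fin d → ℝ) : 0 ≤ euclNorm v := Real.sqrt_nonneg _

theorem euclNorm_mul_self (v : Fin d → ℝ) : euclNorm v * euclNorm v = v ⬝ᵥ v :=
  Real.mul_self_sqrt (dotProduct_self_nonneg' v)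

theorem euclNorm_add_le (u v : Fin d → ℝ) : euclNorm (u + v) ≤ euclNorm u + euclNorm v := by
  rw [euclNorm_le_iff (add_nonneg (euclNorm_nonneg u) (euclNorm_nonneg v))]
  have h := (le_abs_self _).trans (abs_dotProduct_le_euclNorm u v)
  have h2 := dotProduct_comm u v
  simp only [add_dotProduct, dotProduct_add]
  nlinarith [euclNorm_mul_self u, euclNorm_mul_self v]

theorem abs_apply_le_euclNorm (v : Fin d → ℝ) (i : Fin d) : |v i| ≤ euclNorm v := by
  refine Real.abs_le_sqrt ?_
  rw [sq]
  exact Finset.single_le_sum (f := fun j => v j * v j) (fun j _ => mul_self_nonneg _)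
    (Finset.mem_univ i)

theorem euclNorm_smul (a : ℝ) (v : Fin d → ℝ) : euclNorm (a • v) = |a| * euclNorm v := by
  rw [euclNorm, euclNorm, smul_dotProduct, dotProduct_smul, smul_eq_mul, smul_eq_mul, ← mul_assoc,
    Real.sqrt_mul (mul_self_nonneg a), Real.sqrt_mul_self_eq_abs]

theorem euclNorm_zero : euclNorm (0 : Fin d → ℝ) = 0 := by simp [euclNorm]

theorem euclNorm_sum_le {ι : Type*} (s : Finset ι) (f : ι → Fin d → ℝ) :
    euclNorm (∑ i ∈ s, f i) ≤ ∑ i ∈ s, euclNorm (f i) :=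
  Finset.le_sum_of_subadditive euclNorm euclNorm_zero.le (fun u v => euclNorm_add_le u v) s f

theorem FeatureMap.dotProduct_self_le {S A : Type*} [MeasurableSpace S] [MeasurableSpace A]
    (φ : FeatureMap S A d) (z : S × A) : φ.toFun z ⬝ᵥ φ.toFun z ≤ 1 := by
  simpa using (euclNorm_le_iff zero_le_one).1 (φ.norm_le z)

end EuclNorm

/-! ### Bellman equation and linearity of expected values -/

namespace EpisodicMDP

variable {S A : Type*} [MeasurableSpace S] [MeasurableSpace A]

/-- The expected sum of the rewards of the steps `h, …, h + n - 1`. -/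
def partialValue (E : EpisodicMDP S A) (π : Policy S A) (n h : ℕ) (x : S) : ℝ :=
  ∫ τ, ∑ i : Fin n, E.reward (h + i) (τ i) ∂(E.traj π n h x)

variable (E : EpisodicMDP S A) (π : Policy S A)

theorem value_eq_partialValue (H h : ℕ) (x : S) :
    E.value H π h x = E.partialValue π (H + 1 - h) h x := rfl

theorem measurable_sum_reward (n h : ℕ) :
    Measurable fun τ : Fin n → S × A => ∑ i : Fin n, E.reward (h + i) (τ i) :=
  Finset.measurable_sum _ fun i _ => (E.measurable_reward _).comp (measurable_pi_apply i)

theorem sum_reward_mem (n h : ℕ) (τ : Fin n → S × A) :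
    ∑ i : Fin n, E.reward (h + i) (τ i) ∈ Set.Icc (0 : ℝ) n := by
  refine ⟨Finset.sum_nonneg fun i _ => (E.reward_mem _ _).1, ?_⟩
  refine (Finset.sum_le_card_nsmul _ _ 1 fun i _ => (E.reward_mem _ _).2).trans_eq ?_
  simp

theorem partialValue_mem (n h : ℕ) (x : S) : E.partialValue π n h x ∈ Set.Icc (0 : ℝ) n :=
  have := E.isMarkov_traj π n h
  integral_mem_Icc_of_forall (E.measurable_sum_reward n h) (E.sum_reward_mem n h)

theorem measurable_partialValue (n h : ℕ) : Measurable (E.partialValue π n h) :=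
  have := E.isMarkov_traj π n h
  (StronglyMeasurable.integral_kernel (κ := E.traj π n h)
    (E.measurable_sum_reward n h).stronglyMeasurable).measurable

theorem partialValue_zero (h : ℕ) (x : S) : E.partialValue π 0 h x = 0 := by
  simp [partialValue]

theorem measurable_finCons (n : ℕ) : Measurable fun z : S × ((A × S) × (Fin n → S × A)) =>
    (Fin.cons (z.1, z.2.1.1) z.2.2 : Fin (n + 1) → S × A) := by
  refine measurable_pi_iff.2 fun i => ?_
  refine Fin.cases ?_ (fun j => ?_) i
  · simp only [Fin.cons_zero]; fun_prop
  · simp only [Fin.cons_succ]; fun_prop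

/-- The Bellman equation. -/
theorem partialValue_succ (n h : ℕ) (x : S) :
    E.partialValue π (n + 1) h x
      = ∫ a, (E.reward h (x, a) + ∫ y, E.partialValue π n (h + 1) y ∂(E.transition h (x, a)))
          ∂(π.kernel h x) := by
  have hn := E.isMarkov_traj π n (h + 1)
  have hr := E.measurable_reward h
  have hV := E.measurable_partialValue π n (h + 1)
  have hVb := E.partialValue_mem π n (h + 1)
  have hG := E.measurable_sum_reward n (h + 1)
  set K : Kernel S ((A × S) × (Fin n → S × A)) := (π.kernel h ⊗ₖ E.transition h) ⊗ₖ
      ((E.traj π n (h + 1)).comap (fun p : S × (A × S) => p.2.2) (by fun_prop)) with hK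
  have h1 : E.partialValue π (n + 1) h x = ∫ w, (E.reward h (x, w.1.1)
      + ∑ i : Fin n, E.reward (h + 1 + i) (w.2 i)) ∂(K x) := by
    -- The trajectory kernel carries its starting state along by `Kernel.id`; this Dirac mass is
    -- integrated out before the rest is disintegrated.
    rw [partialValue, traj, Kernel.map_apply _ (measurable_finCons n),
      integral_map (measurable_finCons n).aemeasurable
        (E.measurable_sum_reward (n + 1) h).aestronglyMeasurable, Kernel.prod_apply,
      Kernel.id_apply, Measure.dirac_prod, integral_map measurable_prodMk_left.aemeasurable ?_]
    · refine integral_congr_ae (Filter.Eventually.of_forall fun w => ?_)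
      simp [Fin.sum_univ_succ, add_comm, add_left_comm]
    · exact ((E.measurable_sum_reward (n + 1) h).comp (measurable_finCons n)).aestronglyMeasurable
  have hbound : ∀ w : (A × S) × (Fin n → S × A), E.reward h (x, w.1.1)
      + ∑ i : Fin n, E.reward (h + 1 + i) (w.2 i) ∈ Set.Icc (0 : ℝ) (1 + n) := fun w =>
    ⟨add_nonneg (E.reward_mem _ _).1 (E.sum_reward_mem n (h + 1) w.2).1,
      add_le_add (E.reward_mem _ _).2 (E.sum_reward_mem n (h + 1) w.2).2⟩
  have hmeas : Measurable fun w : (A × S) × (Fin n → S × A) => E.reward h (x, w.1.1)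
      + ∑ i : Fin n, E.reward (h + 1 + i) (w.2 i) :=
    Measurable.add (by fun_prop) (hG.comp measurable_snd)
  rw [h1, hK, integral_compProd (integrable_of_mem_Icc hmeas hbound)]
  have h2 : ∀ p : A × S, ∫ τ, (E.reward h (x, p.1) + ∑ i : Fin n, E.reward (h + 1 + i) (τ i))
      ∂((E.traj π n (h + 1)).comap (fun p : S × (A × S) => p.2.2) (by fun_prop) (x, p))
      = E.reward h (x, p.1) + E.partialValue π n (h + 1) p.2 := by
    intro p
    rw [Kernel.comap_apply, integral_add (integrable_const _)
      (integrable_of_mem_Icc hG (E.sum_reward_mem n (h + 1)))]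
    simp [partialValue]
  simp only [h2]
  rw [integral_compProd (integrable_of_mem_Icc (a := 0) (b := 1 + n) (by fun_prop) fun p =>
    ⟨add_nonneg (E.reward_mem _ _).1 (hVb _).1, add_le_add (E.reward_mem _ _).2 (hVb _).2⟩)]
  refine integral_congr_ae (Filter.Eventually.of_forall fun a => ?_)
  dsimp only
  rw [integral_add (integrable_const _) (integrable_of_mem_Icc hV hVb)]
  simp

theorem value_bellman {H h : ℕ} (hh : h ≤ H) (x : S) :
    E.value H π h x = ∫ a, (E.reward h (x, a)
      + ∫ y, E.value H π (h + 1) y ∂(E.transition h (x, a))) ∂(π.kernel h x) := by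
  have h1 : H + 1 - h = H + 1 - (h + 1) + 1 := by omega
  rw [value_eq_partialValue, h1, partialValue_succ]
  rfl

theorem value_mem (H h : ℕ) (x : S) : E.value H π h x ∈ Set.Icc (0 : ℝ) ((H + 1 - h : ℕ) : ℝ) :=
  E.partialValue_mem π _ h x

theorem measurable_value (H h : ℕ) : Measurable (E.value H π h) :=
  E.measurable_partialValue π _ h

theorem value_top (H : ℕ) (x : S) : E.value H π (H + 1) x = 0 := by
  rw [value_eq_partialValue, Nat.sub_self, partialValue_zero]

/-- The expected value after a step of a linear MDP is linear in the features. -/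
theorem IsLinear.exists_integral_eq {E : EpisodicMDP S A} {H d : ℕ} {φ : FeatureMap S A d}
    (hE : E.IsLinear H φ) {h : ℕ} (hh : h ∈ Finset.Icc 1 H) {V : S → ℝ} (hV : Measurable V)
    {L : ℝ} (hL : 0 ≤ L) (hVL : ∀ x, V x ∈ Set.Icc 0 L) :
    ∃ w : Fin d → ℝ, euclNorm w ≤ (1 + L) * √d ∧
      ∀ z, E.reward h z + ∫ y, V y ∂(E.transition h z) = φ.toFun z ⬝ᵥ w := by
  obtain ⟨μ, θ, h1, h2, h3, h4⟩ := hE h hh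
  -- The weight of the expected value is the layer cake integral of the signed measures; `θ` is
  -- added for the reward.
  set w : Fin d → ℝ := fun i => ∫ t in Set.Ioc 0 L, μ i {x | t ≤ V x} with hw
  have hint := fun i => integrableOn_signedMeasure_le (μ i) hV L
  have hdot : ∀ u : Fin d → ℝ, u ⬝ᵥ w
      = ∫ t in Set.Ioc 0 L, u ⬝ᵥ (fun i => μ i {x | t ≤ V x}) := by
    intro u
    simp only [dotProduct, hw]
    rw [integral_finsetSum _ fun i _ => (hint i).const_mul _]
    simp only [integral_const_mul]
  have hmeas : ∀ t, MeasurableSet {x | t ≤ V x} := fun t => measurableSet_le measurable_const hV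
  -- Pairing `w` with itself under the integral bounds its norm by scalar integrals, using the
  -- normalization `√d` for every level set of `V`.
  have hww : w ⬝ᵥ w ≤ L * (euclNorm w * √d) := by
    have := norm_setIntegral_le_of_norm_le_const (μ := volume) (s := Set.Ioc 0 L)
      (f := fun t => w ⬝ᵥ (fun i => μ i {x | t ≤ V x})) (C := euclNorm w * √d) (by simp)
      fun t _ => (abs_dotProduct_le_euclNorm _ _).trans
        (mul_le_mul_of_nonneg_left (h3 _ (hmeas t)) (euclNorm_nonneg w))
    rw [← hdot] at this
    simp [measureReal_def, hL] at this
    linarith [le_abs_self (w ⬝ᵥ w)]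
  have hwn : euclNorm w ≤ L * √d := by
    rw [← euclNorm_mul_self] at hww
    rcases (euclNorm_nonneg w).eq_or_lt with h0 | h0
    · rw [← h0]; positivity
    · exact le_of_mul_le_mul_right (by linarith) h0
  refine ⟨θ + w, (euclNorm_add_le θ w).trans (by linarith), fun z => ?_⟩
  rw [dotProduct_add, h2, hdot, integral_eq_setIntegral_Ioc hV hVL]
  congr 1
  refine setIntegral_congr_fun measurableSet_Ioc fun t _ => ?_
  exact h1 z _ (hmeas t)

end EpisodicMDP

/-! ### Measurability of the quantities computed by the algorithm -/

section MatrixMeasurability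

variable {Ω n : Type*} [MeasurableSpace Ω] [Fintype n] [DecidableEq n]

theorem measurable_matrix_det {f : Ω → Matrix n n ℝ} (hf : ∀ i j, Measurable fun ω => f ω i j) :
    Measurable fun ω => (f ω).det := by
  simp only [Matrix.det_apply, Units.smul_def, zsmul_eq_mul]
  exact Finset.measurable_sum _ fun σ _ =>
    (Finset.measurable_prod _ fun i _ => hf (σ i) i).const_mul _

theorem measurable_matrix_inv {f : Ω → Matrix n n ℝ} (hf : ∀ i j, Measurable fun ω => f ω i j)
    (i j : n) : Measurable fun ω => (f ω)⁻¹ i j := by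
  simp only [Matrix.inv_def, Ring.inverse_eq_inv', Matrix.smul_apply, smul_eq_mul,
    Matrix.adjugate_apply]
  refine (measurable_matrix_det hf).inv.mul (measurable_matrix_det fun a b => ?_)
  by_cases h : a = j
  · subst h
    simp only [Matrix.updateRow_self]
    exact measurable_const
  · simp only [Matrix.updateRow_ne h]
    exact hf a b

theorem measurable_dotProduct {f g : Ω → n → ℝ} (hf : ∀ i, Measurable fun ω => f ω i)
    (hg : ∀ i, Measurable fun ω => g ω i) : Measurable fun ω => f ω ⬝ᵥ g ω :=
  Finset.measurable_sum _ fun i _ => (hf i).mul (hg i)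

theorem measurable_mulVec {f : Ω → Matrix n n ℝ} {g : Ω → n → ℝ}
    (hf : ∀ i j, Measurable fun ω => f ω i j) (hg : ∀ i, Measurable fun ω => g ω i) (i : n) :
    Measurable fun ω => (f ω *ᵥ g ω) i :=
  measurable_dotProduct (hf i) hg

/-- Since an index takes countably many values, measurability for fixed indices suffices; this lets
the random synchronization time be inserted. -/
theorem measurable_apply_random {X β : Type*} [MeasurableSpace X] [MeasurableSpace β]
    {F : ℕ → X → β} (hF : ∀ k, Measurable (F k)) {K : X → ℕ} (hK : Measurable K) :
    Measurable fun x => F (K x) x := by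
  have h : Measurable fun r : ℕ × X => F r.1 r.2 := measurable_from_prod_countable_right hF
  exact h.comp (hK.prodMk measurable_id)

end MatrixMeasurability

namespace CoopLSVI

variable {S A : Type*} [MeasurableSpace S] [MeasurableSpace A] {M d : ℕ} {Ω : Type*}
  [MeasurableSpace Ω] {alg : CoopLSVI S A M d} {D : Ω → Observations S A M}

/-- The observations of the episodes before `t` are measurable. -/
structure HistoryMeasurable (alg : CoopLSVI S A M d) (D : Ω → Observations S A M) (t : ℕ) :
    Prop where
  state : ∀ τ ∈ Finset.Ico 1 t, ∀ n, ∀ h ∈ Finset.Icc 1 (alg.H + 1),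
    Measurable fun ω => (D ω).state τ n h
  action : ∀ τ ∈ Finset.Ico 1 t, ∀ n, ∀ h ∈ Finset.Icc 1 alg.H,
    Measurable fun ω => (D ω).action τ n h
  reward : ∀ τ ∈ Finset.Ico 1 t, ∀ n, ∀ h ∈ Finset.Icc 1 alg.H,
    Measurable fun ω => (D ω).reward τ n h

theorem mem_Ico_of_mem_avail {m : Fin M} {t k : ℕ} {p : Fin M × ℕ} (hp : p ∈ avail m t k) :
    p.2 ∈ Finset.Ico 1 t := by
  rw [mem_avail] at hp
  rw [Finset.mem_Ico]
  omega

namespace HistoryMeasurable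

variable {t : ℕ} (hD : HistoryMeasurable alg D t) {h : ℕ} (hh : h ∈ Finset.Icc 1 alg.H)
include hD hh

theorem feat {τ : ℕ} (hτ : τ ∈ Finset.Ico 1 t) (n : Fin M) (i : Fin d) :
    Measurable fun ω => alg.feat (D ω) h n τ i := by
  have hh' : h ∈ Finset.Icc 1 (alg.H + 1) := by rw [Finset.mem_Icc] at *; omega
  exact (measurable_pi_apply i).comp
    (alg.φ.measurable.comp ((hD.state τ hτ n h hh').prodMk (hD.action τ hτ n h hh)))

theorem gram (m : Fin M) (k : ℕ) (i j : Fin d) :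
    Measurable fun ω => alg.gram (D ω) m t k h i j := by
  simp only [CoopLSVI.gram, Matrix.add_apply, Matrix.sum_apply, Matrix.vecMulVec_apply]
  refine (Finset.measurable_sum _ fun p hp => ?_).add_const _
  have hp' := mem_Ico_of_mem_avail hp
  exact (hD.feat hh hp' _ i).mul (hD.feat hh hp' _ j)

theorem syncGram {k : ℕ} (hk : k < t) (i j : Fin d) :
    Measurable fun ω => alg.syncGram (D ω) k h i j := by
  simp only [CoopLSVI.syncGram, Matrix.add_apply, Matrix.sum_apply, Matrix.vecMulVec_apply]
  refine (Finset.measurable_sum _ fun p hp => ?_).add_const _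
  have hp' : p.2 ∈ Finset.Ico 1 t := by
    rw [Finset.mem_product, Finset.mem_Icc] at hp; rw [Finset.mem_Ico]; omega
  exact (hD.feat hh hp' _ i).mul (hD.feat hh hp' _ j)

theorem bias (m : Fin M) (k : ℕ) {V : Ω → S → ℝ} (hV : Measurable fun q : Ω × S => V q.1 q.2)
    (i : Fin d) : Measurable fun ω => alg.bias (D ω) m t k h (V ω) i := by
  simp only [CoopLSVI.bias, Finset.sum_apply, Pi.smul_apply, smul_eq_mul]
  refine Finset.measurable_sum _ fun p hp => ?_
  have hp' := mem_Ico_of_mem_avail hp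
  have hh' : h + 1 ∈ Finset.Icc 1 (alg.H + 1) := by rw [Finset.mem_Icc] at *; omega
  exact ((hD.reward _ hp' _ h hh).add
    (hV.comp (measurable_id.prodMk (hD.state _ hp' p.1 _ hh')))).mul (hD.feat hh hp' _ i)

theorem qStep (m : Fin M) (k : ℕ) {V : Ω → S → ℝ} (hV : Measurable fun q : Ω × S => V q.1 q.2) :
    Measurable fun q : Ω × (S × A) => alg.qStep (D q.1) m t k h (V q.1) q.2 := by
  have hφ : ∀ i, Measurable fun q : Ω × (S × A) => alg.φ.toFun q.2 i := fun i =>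
    (measurable_pi_apply i).comp (alg.φ.measurable.comp measurable_snd)
  have hinv : ∀ i j, Measurable fun q : Ω × (S × A) => (alg.gram (D q.1) m t k h)⁻¹ i j :=
    fun i j => (measurable_matrix_inv (hD.gram hh m k) i j).comp measurable_fst
  have hbias : ∀ i, Measurable fun q : Ω × (S × A) => alg.bias (D q.1) m t k h (V q.1) i :=
    fun i => (hD.bias hh m k hV i).comp measurable_fst
  unfold CoopLSVI.qStep
  exact ((measurable_dotProduct hφ (measurable_mulVec hinv hbias)).add
    ((measurable_dotProduct hφ (measurable_mulVec hinv hφ)).sqrt.const_mul _)).min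
    measurable_const

omit hh in
theorem vEst [Fintype A] [Nonempty A] (m : Fin M) (k : ℕ) {j : ℕ} (hj : j ≤ alg.H) :
    Measurable fun q : Ω × S => alg.vEst (D q.1) m t k j q.2 := by
  induction j with
  | zero => exact measurable_const
  | succ j ih =>
    have hq := hD.qStep (h := alg.H - j) (by rw [Finset.mem_Icc]; omega) m k
      (V := fun ω => alg.vEst (D ω) m t k j) (ih (by omega))
    have : (fun q : Ω × S => alg.vEst (D q.1) m t k (j + 1) q.2)
        = Finset.univ.sup' Finset.univ_nonempty fun (a : A) (q : Ω × S) =>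
          alg.qStep (D q.1) m t k (alg.H - j) (alg.vEst (D q.1) m t k j) (q.2, a) := by
      funext q
      rw [Finset.sup'_apply, CoopLSVI.vEst]
    rw [this]
    exact Finset.measurable_sup' _ fun a _ =>
      hq.comp (measurable_fst.prodMk (measurable_snd.prodMk measurable_const))

variable [Fintype A] [Nonempty A]

theorem qEst (m : Fin M) (k : ℕ) :
    Measurable fun q : Ω × (S × A) => alg.qEst (D q.1) m t k h q.2 := by
  have := hD.qStep hh m k (V := fun ω => alg.vEst (D ω) m t k (alg.H - h))
    (hD.vEst m k (Nat.sub_le _ _))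
  simpa only [CoopLSVI.qEst] using this

theorem greedy (m : Fin M) (k : ℕ) :
    Measurable fun q : Ω × S => alg.greedy (D q.1) m t k h q.2 := by
  classical
  have hQ : ∀ a, Measurable fun q : Ω × S => alg.qEst (D q.1) m t k h (q.2, a) := fun a =>
    (hD.qEst hh m k).comp (measurable_fst.prodMk (measurable_snd.prodMk measurable_const))
  -- The set of maximizers takes finitely many values, so any tie-breaking rule composed with it is
  -- measurable.
  let g : Ω × S → Set A := fun q =>
    {a | ∀ b, alg.qEst (D q.1) m t k h (q.2, b) ≤ alg.qEst (D q.1) m t k h (q.2, a)}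
  have hga : ∀ a, MeasurableSet {q | a ∈ g q} := fun a => by
    have : {q | a ∈ g q} = ⋂ b, {q : Ω × S |
        alg.qEst (D q.1) m t k h (q.2, b) ≤ alg.qEst (D q.1) m t k h (q.2, a)} := by
      ext q; simp [g]
    rw [this]
    exact MeasurableSet.iInter fun b => measurableSet_le (hQ b) (hQ a)
  have hg : ∀ s : Set A, MeasurableSet {q | g q = s} := by
    intro s
    have : {q | g q = s} = ⋂ a, {q | a ∈ g q ↔ a ∈ s} := by
      ext q; simp [Set.ext_iff]
    rw [this]
    refine MeasurableSet.iInter fun a => ?_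
    by_cases ha : a ∈ s
    · simpa [ha] using hga a
    · have : {q | a ∈ g q ↔ a ∈ s} = {q | a ∈ g q}ᶜ := by ext q; simp [ha]
      rw [this]
      exact (hga a).compl
  intro B _
  have : (fun q : Ω × S => alg.greedy (D q.1) m t k h q.2) ⁻¹' B =
      ⋃ s ∈ {s : Set A | alg.tie t m h (Finset.univ.filter (fun a => a ∈ s)) ∈ B},
        {q | g q = s} := by
    ext q
    simp [CoopLSVI.greedy, g]
  rw [this]
  exact MeasurableSet.biUnion (Set.to_countable _) fun s _ => hg s

theorem greedy_random (m : Fin M) {K : Ω → ℕ} (hK : Measurable K) :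
    Measurable fun q : Ω × S => alg.greedy (D q.1) m t (K q.1) h q.2 := by
  exact measurable_apply_random (F := fun k (q : Ω × S) => alg.greedy (D q.1) m t k h q.2)
    (fun k => hD.greedy hh m k) (hK.comp measurable_fst)

omit hh in
theorem vEst_random (m : Fin M) {K : Ω → ℕ} (hK : Measurable K) {j : ℕ} (hj : j ≤ alg.H) :
    Measurable fun q : Ω × S => alg.vEst (D q.1) m t (K q.1) j q.2 := by
  exact measurable_apply_random (F := fun k (q : Ω × S) => alg.vEst (D q.1) m t k j q.2)
    (fun k => hD.vEst m k hj) (hK.comp measurable_fst)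

omit hD hh in
theorem mono {s : ℕ} (hD : HistoryMeasurable alg D t) (hs : s ≤ t) : HistoryMeasurable alg D s where
  state τ hτ := hD.state τ (by rw [Finset.mem_Ico] at *; omega)
  action τ hτ := hD.action τ (by rw [Finset.mem_Ico] at *; omega)
  reward τ hτ := hD.reward τ (by rw [Finset.mem_Ico] at *; omega)

omit hD hh in
theorem measurableSet_sync (hD : HistoryMeasurable alg D (t + 1)) (ht : 1 ≤ t) {k : ℕ}
    (hk : k ≤ t) : MeasurableSet {ω | alg.Sync (D ω) t k} := by
  have : {ω | alg.Sync (D ω) t k} = ⋃ m : Fin M, ⋃ h ∈ Finset.Icc 1 alg.H,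
      {ω | Real.log ((alg.gram (D ω) m t k h
        + Matrix.vecMulVec (alg.feat (D ω) h m t) (alg.feat (D ω) h m t)).det
        / (alg.syncGram (D ω) k h).det) > alg.thr / ((t : ℝ) - k)} := by
    ext ω; simp only [Sync, Set.mem_iUnion, Set.mem_ofPred_eq, exists_prop]
  rw [this]
  refine MeasurableSet.iUnion fun m => Finset.measurableSet_biUnion _ fun h hh => ?_
  refine measurableSet_lt measurable_const (Measurable.log (Measurable.div ?_ ?_))
  · refine measurable_matrix_det fun i j => ?_
    simp only [Matrix.add_apply, Matrix.vecMulVec_apply]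
    have ht' : t ∈ Finset.Ico 1 (t + 1) := by rw [Finset.mem_Ico]; omega
    exact ((hD.mono (Nat.le_succ t)).gram hh m k i j).add
      ((hD.feat hh ht' m i).mul (hD.feat hh ht' m j))
  · exact measurable_matrix_det fun i j => hD.syncGram hh (by omega) i j

end HistoryMeasurable

end CoopLSVI

/-! ### Conditional Hoeffding bounds with the past frozen -/

section Freezing

variable {Ω Ω' S : Type*} [MeasurableSpace Ω] [MeasurableSpace Ω'] [MeasurableSpace S]
  {P : Measure Ω} [IsProbabilityMeasure P] {X : Ω → Ω'} {Y : Ω → S} {κ : Kernel Ω' S}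
  [IsMarkovKernel κ]

/-- If `κ ∘ X` is a conditional distribution of `Y` given `X`, then `X` may be frozen when
integrating over `Y`. -/
theorem lintegral_freeze (hX : Measurable X) (hY : Measurable Y)
    (hXY : ∀ G B, MeasurableSet G → MeasurableSet B →
      P (X ⁻¹' G ∩ Y ⁻¹' B) = ∫⁻ ω in X ⁻¹' G, κ (X ω) B ∂P)
    {f : Ω' × S → ENNReal} (hf : Measurable f) :
    ∫⁻ ω, f (X ω, Y ω) ∂P = ∫⁻ ω, ∫⁻ y, f (X ω, y) ∂(κ (X ω)) ∂P := by
  have hmap := hX.prodMk hY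
  have : IsProbabilityMeasure (P.map X) := Measure.isProbabilityMeasure_map hX.aemeasurable
  have : IsProbabilityMeasure (P.map fun ω => (X ω, Y ω)) :=
    Measure.isProbabilityMeasure_map hmap.aemeasurable
  have h : P.map (fun ω => (X ω, Y ω)) = (P.map X) ⊗ₘ κ := by
    refine Measure.ext_prod fun {G B} hG hB => ?_
    rw [Measure.map_apply hmap (hG.prod hB), Measure.compProd_apply_prod hG hB,
      setLIntegral_map hG (κ.measurable_coe hB) hX]
    exact hXY G B hG hB
  rw [← lintegral_map hf hmap, h, Measure.lintegral_compProd hf, lintegral_map _ hX]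
  exact hf.lintegral_kernel_prod_right'

/-- Hoeffding's lemma with the compensator moved into the exponent, so that factors of this kind
multiply to a supermartingale of initial value one. -/
theorem lintegral_exp_hoeffding_le (ν : Measure S) [IsProbabilityMeasure ν] {g : S → ℝ}
    (hg : Measurable g) {a b : ℝ} (hab : ∀ y, g y ∈ Set.Icc a b) (s : ℝ) :
    ∫⁻ y, ENNReal.ofReal (Real.exp (s * (g y - ∫ x, g x ∂ν) - s ^ 2 * (b - a) ^ 2 / 8)) ∂ν ≤ 1 := by
  have h := hasSubgaussianMGF_of_mem_Icc (μ := ν) hg.aemeasurable (Filter.Eventually.of_forall hab)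
  have h1 := h.mgf_le s
  have h2 := h.integrable_exp_mul s
  rw [mgf] at h1
  have hc : (((‖b - a‖₊ / 2) ^ 2 : NNReal) : ℝ) * s ^ 2 / 2 = s ^ 2 * (b - a) ^ 2 / 8 := by
    push_cast
    rw [div_pow, Real.norm_eq_abs, sq_abs]
    ring
  rw [hc] at h1
  simp only [Real.exp_sub]
  rw [← ofReal_integral_eq_lintegral_ofReal (h2.div_const _)
    (Filter.Eventually.of_forall fun y => by positivity), ENNReal.ofReal_le_one, integral_div,
    div_le_one (Real.exp_pos _)]
  exact h1

/-- One supermartingale step. The multiplier `s` and the weight `G` may depend on the past `X`: for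
fixed `X` they are constants, and Hoeffding's lemma applies to `Y`. -/
theorem lintegral_mul_exp_le
    (hXY : ∀ f : Ω' × S → ENNReal, Measurable f →
      ∫⁻ ω, f (X ω, Y ω) ∂P = ∫⁻ ω, ∫⁻ y, f (X ω, y) ∂(κ (X ω)) ∂P)
    {g : Ω' × S → ℝ} (hg : Measurable g) {a b : ℝ} (hab : ∀ q, g q ∈ Set.Icc a b)
    {s : Ω' → ℝ} (hs : Measurable s) {G : Ω' → ENNReal} (hG : Measurable G) :
    ∫⁻ ω, G (X ω) * ENNReal.ofReal (Real.exp (s (X ω)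
        * (g (X ω, Y ω) - ∫ y, g (X ω, y) ∂(κ (X ω))) - s (X ω) ^ 2 * (b - a) ^ 2 / 8)) ∂P
      ≤ ∫⁻ ω, G (X ω) ∂P := by
  have hint : Measurable fun x => ∫ y, g (x, y) ∂(κ x) :=
    (StronglyMeasurable.integral_kernel_prod_right' (κ := κ) hg.stronglyMeasurable).measurable
  have hf : Measurable fun q : Ω' × S => G q.1 * ENNReal.ofReal (Real.exp (s q.1
        * (g q - ∫ y, g (q.1, y) ∂(κ q.1)) - s q.1 ^ 2 * (b - a) ^ 2 / 8)) := by
    have h1 : Measurable fun q : Ω' × S => ∫ y, g (q.1, y) ∂(κ q.1) := hint.comp measurable_fst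
    have h2 : Measurable fun q : Ω' × S => s q.1 := hs.comp measurable_fst
    refine (hG.comp measurable_fst).mul (Measurable.ennreal_ofReal (Measurable.exp ?_))
    exact (h2.mul (hg.sub h1)).sub (((h2.pow_const 2).mul_const _).div_const _)
  rw [hXY _ hf]
  refine lintegral_mono fun ω => ?_
  dsimp only
  have hgω : Measurable fun y => g (X ω, y) := hg.comp measurable_prodMk_left
  rw [lintegral_const_mul _ (by fun_prop)]
  exact mul_le_of_le_one_right (zero_le) (lintegral_exp_hoeffding_le (κ (X ω)) hgω
    (fun y => hab (X ω, y)) (s (X ω)))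

end Freezing

/-- The defining property of conditional probabilities, for events of the conditioning
σ-algebra. -/
theorem measure_inter_eq_setLIntegral_of_condExp {Ω S Z : Type*} [MeasurableSpace S]
    [MeasurableSpace Z] {m m0 : MeasurableSpace Ω} (hm : m ≤ m0) {P : Measure Ω}
    [IsProbabilityMeasure P] {Y : Ω → S} (hY : Measurable Y) {κ : Kernel Z S} [IsMarkovKernel κ]
    {z : Ω → Z} (hz : Measurable[m] z) {B : Set S} (hB : MeasurableSet B)
    (hcond : P⟦Y ⁻¹' B | m⟧ =ᵐ[P] fun ω => (κ (z ω)).real B) {G : Set Ω}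
    (hG : MeasurableSet[m] G) : P (G ∩ Y ⁻¹' B) = ∫⁻ ω in G, κ (z ω) B ∂P := by
  have hG0 : MeasurableSet G := hm G hG
  have hYB : MeasurableSet (Y ⁻¹' B) := hY hB
  have h1 : ∫ ω in G, (κ (z ω)).real B ∂P = P.real (G ∩ Y ⁻¹' B) := by
    rw [← setIntegral_congr_ae (g := fun ω => (κ (z ω)).real B) hG0
      (hcond.mono fun ω h _ => h),
      setIntegral_condExp hm ((integrable_const (1 : ℝ)).indicator hYB) hG,
      integral_indicator hYB]
    simp [Set.inter_comm, hYB]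
  have h2 : Measurable fun ω => κ (z ω) B := (κ.measurable_coe hB).comp (hz.mono hm le_rfl)
  rw [← ENNReal.ofReal_toReal (measure_ne_top P _), ← measureReal_def, ← h1,
    ofReal_integral_eq_lintegral_ofReal (f := fun ω => (κ (z ω)).real B)
      (integrable_of_mem_Icc (a := 0) (b := 1) h2.ennreal_toReal
        fun ω => ⟨measureReal_nonneg, measureReal_le_one⟩)
      (Filter.Eventually.of_forall fun ω => measureReal_nonneg)]
  simp [measureReal_def]

/-! ### The history and the synchronization times as functions of the states -/

namespace CoopLSVI

variable {S A : Type*} [MeasurableSpace S] [MeasurableSpace A] {M d : ℕ} {Ω : Type*}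
  {alg : CoopLSVI S A M d} {D : Ω → Observations S A M} {E : Fin M → EpisodicMDP S A} {T : ℕ}
  {k : Ω → ℕ → ℕ} [Fintype A] [Nonempty A]

/-- The agents act, observe rewards and synchronize according to the algorithm. -/
structure Follows (alg : CoopLSVI S A M d) (E : Fin M → EpisodicMDP S A) (T : ℕ)
    (D : Ω → Observations S A M) (k : Ω → ℕ → ℕ) : Prop where
  action_eq : ∀ ω, ∀ t ∈ Finset.Icc 1 T, ∀ m, ∀ h ∈ Finset.Icc 1 alg.H,
    (D ω).action t m h = alg.greedy (D ω) m t (k ω t) h ((D ω).state t m h)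
  reward_eq : ∀ ω, ∀ t ∈ Finset.Icc 1 T, ∀ m, ∀ h ∈ Finset.Icc 1 alg.H,
    (D ω).reward t m h = (E m).reward h ((D ω).state t m h, (D ω).action t m h)
  sync_start : ∀ ω, k ω 1 = 0
  sync_of_test : ∀ ω, ∀ t ∈ Finset.Icc 1 T, alg.Sync (D ω) t (k ω t) → k ω (t + 1) = t
  sync_of_not_test : ∀ ω, ∀ t ∈ Finset.Icc 1 T, ¬ alg.Sync (D ω) t (k ω t) →
    k ω (t + 1) = k ω t

theorem IsRun.follows [MeasurableSpace Ω] {P : Measure Ω} (h : alg.IsRun E T P D k) :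
    alg.Follows E T D k :=
  ⟨h.action_eq, h.reward_eq, h.sync_start, h.sync_of_test, h.sync_of_not_test⟩

theorem Follows.sync_le (hf : alg.Follows E T D k) (ω : Ω) {t : ℕ} (h1 : 1 ≤ t) (hT : t ≤ T + 1) :
    k ω t < t := by
  induction t, h1 using Nat.le_induction with
  | base => simp [hf.sync_start]
  | succ t h1 ih =>
    have := ih (by omega)
    have ht : t ∈ Finset.Icc 1 T := by rw [Finset.mem_Icc]; omega
    by_cases hs : alg.Sync (D ω) t (k ω t)
    · rw [hf.sync_of_test ω t ht hs]; omega
    · rw [hf.sync_of_not_test ω t ht hs]; omega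

/-- By induction over episodes, actions, rewards and synchronization times are determined measurably
by the states. The σ-algebra on `Ω` is arbitrary because the statement is applied to `past`. -/
theorem Follows.historyMeasurable [MeasurableSpace Ω] (hf : alg.Follows E T D k) {t : ℕ}
    (h1 : 1 ≤ t) (hT : t ≤ T + 1)
    (hstate : ∀ τ ∈ Finset.Ico 1 t, ∀ n, ∀ h ∈ Finset.Icc 1 (alg.H + 1),
      Measurable fun ω => (D ω).state τ n h) :
    HistoryMeasurable alg D t ∧ Measurable fun ω => k ω t := by
  induction t, h1 using Nat.le_induction with
  | base =>
    refine ⟨⟨hstate, fun τ hτ => ?_, fun τ hτ => ?_⟩, by simp [hf.sync_start]⟩ <;> simp at hτ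
  | succ t h1 ih =>
    obtain ⟨hH, hk⟩ := ih (by omega) fun τ hτ => hstate τ (by rw [Finset.mem_Ico] at *; omega)
    have ht : t ∈ Finset.Icc 1 T := by rw [Finset.mem_Icc]; omega
    have hst : ∀ n, ∀ h ∈ Finset.Icc 1 alg.H, Measurable fun ω => (D ω).state t n h :=
      fun n h hh => hstate t (by rw [Finset.mem_Ico]; omega) n h
        (by rw [Finset.mem_Icc] at *; omega)
    have hact : ∀ n, ∀ h ∈ Finset.Icc 1 alg.H, Measurable fun ω => (D ω).action t n h := by
      intro n h hh
      simp only [hf.action_eq _ t ht n h hh]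
      have h2 := (hH.greedy_random hh n hk).comp (measurable_id.prodMk (hst n h hh))
      simpa only [Function.comp_def, id] using h2
    have hrew : ∀ n, ∀ h ∈ Finset.Icc 1 alg.H, Measurable fun ω => (D ω).reward t n h := by
      intro n h hh
      simp only [hf.reward_eq _ t ht n h hh]
      exact ((E n).measurable_reward h).comp ((hst n h hh).prodMk (hact n h hh))
    have hcases : ∀ τ ∈ Finset.Ico 1 (t + 1), τ ∈ Finset.Ico 1 t ∨ τ = t := fun τ hτ => by
      rw [Finset.mem_Ico] at *; omega
    have hH' : HistoryMeasurable alg D (t + 1) := by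
      refine ⟨hstate, fun τ hτ => ?_, fun τ hτ => ?_⟩
      · rcases hcases τ hτ with h | rfl
        · exact hH.action τ h
        · exact hact
      · rcases hcases τ hτ with h | rfl
        · exact hH.reward τ h
        · exact hrew
    refine ⟨hH', ?_⟩
    classical
    have hkt : (fun ω => k ω (t + 1))
        = fun ω => if ω ∈ {ω | alg.Sync (D ω) t (k ω t)} then t else k ω t := by
      funext ω
      by_cases hs : alg.Sync (D ω) t (k ω t)
      · simp [hs, hf.sync_of_test ω t ht hs]
      · simp [hs, hf.sync_of_not_test ω t ht hs]
    rw [hkt]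
    refine Measurable.ite ?_ measurable_const hk
    -- The event is split by the value of the random synchronization index.
    have : {ω | alg.Sync (D ω) t (k ω t)}
        = ⋃ j ∈ Finset.range t, ({ω | k ω t = j} ∩ {ω | alg.Sync (D ω) t j}) := by
      ext ω
      have := hf.sync_le ω h1 (by omega)
      simp [this]
    rw [this]
    refine Finset.measurableSet_biUnion _ fun j hj => ?_
    exact (hk (measurableSet_singleton j)).inter
      (hH'.measurableSet_sync h1 (Finset.mem_range.1 hj).le)

end CoopLSVI

/-! ### The filtration by episodes, agents and steps, and its exponential supermartingales -/

namespace CoopLSVI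

variable {S A : Type*} [MeasurableSpace S] [MeasurableSpace A] {M d : ℕ} {Ω : Type*}
  {alg : CoopLSVI S A M d} {D : Ω → Observations S A M} {E : Fin M → EpisodicMDP S A} {T : ℕ}
  {k : Ω → ℕ → ℕ}

theorem measurable_state_past {H t : ℕ} {m : Fin M} {h τ : ℕ} {n : Fin M} {i : ℕ} (h1 : 1 ≤ τ)
    (hi : i ∈ Finset.Icc 1 (H + 1))
    (hc : τ < t ∨ (τ = t ∧ n < m) ∨ (τ = t ∧ n = m ∧ i ≤ h)) :
    Measurable[past D H t m h] fun ω => (D ω).state τ n i := by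
  rw [measurable_iff_comap_le]
  exact le_iSup₂_of_le τ n (le_iSup₂_of_le i ⟨h1, hi, hc⟩ le_rfl)

theorem past_le {m0 : MeasurableSpace Ω} {H t : ℕ} {m : Fin M} {h : ℕ}
    (hst : ∀ τ n i, 1 ≤ τ → i ∈ Finset.Icc 1 (H + 1) →
      (τ < t ∨ (τ = t ∧ n < m) ∨ (τ = t ∧ n = m ∧ i ≤ h)) →
        Measurable[m0] fun ω => (D ω).state τ n i) : past D H t m h ≤ m0 :=
  iSup₂_le fun τ n => iSup₂_le fun i hi =>
    measurable_iff_comap_le.1 (hst τ n i hi.1 hi.2.1 hi.2.2)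

theorem past_mono {H t t' : ℕ} {m m' : Fin M} {h h' : ℕ}
    (hlt : t < t' ∨ (t = t' ∧ m < m') ∨ (t = t' ∧ m = m' ∧ h ≤ h')) :
    past D H t m h ≤ past D H t' m' h' := by
  refine past_le fun τ n i h1 hi hc => measurable_state_past h1 hi ?_
  rw [Fin.lt_def, Fin.ext_iff] at *
  omega

/-- The σ-algebra of everything that happened in the episodes before `t`. -/
@[reducible] def before (D : Ω → Observations S A M) (H t : ℕ) : MeasurableSpace Ω :=
  ⨆ (τ : ℕ) (n : Fin M) (i : ℕ) (_ : 1 ≤ τ ∧ i ∈ Finset.Icc 1 (H + 1) ∧ τ < t),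
    MeasurableSpace.comap (fun ω => (D ω).state τ n i) inferInstance

theorem measurable_state_before {H t τ : ℕ} {n : Fin M} {i : ℕ} (h1 : 1 ≤ τ)
    (hi : i ∈ Finset.Icc 1 (H + 1)) (hc : τ < t) :
    Measurable[before D H t] fun ω => (D ω).state τ n i := by
  rw [measurable_iff_comap_le]
  exact le_iSup₂_of_le τ n (le_iSup₂_of_le i ⟨h1, hi, hc⟩ le_rfl)

theorem before_le_past {H t : ℕ} (m : Fin M) (h : ℕ) : before D H t ≤ past D H t m h :=
  iSup₂_le fun _ _ => iSup₂_le fun _ hi =>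
    measurable_iff_comap_le.1 (measurable_state_past hi.1 hi.2.1 (Or.inl hi.2.2))

theorem past_le_before {H t t' : ℕ} {m : Fin M} {h : ℕ} (hlt : t < t') :
    past D H t m h ≤ before D H t' :=
  past_le fun τ n i h1 hi hc => measurable_state_before h1 hi (by omega)

section Supermartingale

variable [MeasurableSpace Ω] {P : Measure Ω} {H : ℕ} {X : ℕ → Fin M → ℕ → Ω → ℝ}

theorem ofReal_exp_add (a b : ℝ) :
    ENNReal.ofReal (Real.exp (a + b)) = ENNReal.ofReal (Real.exp a) * ENNReal.ofReal (Real.exp b) := by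
  rw [Real.exp_add, ENNReal.ofReal_mul (Real.exp_pos a).le]

/-- The last step is removed first, all earlier factors being absorbed into the weight `G`. Carrying
a weight from the past lets the same argument be nested over agents and then over episodes. -/
theorem lintegral_exp_sum_steps_le {t : ℕ} {m : Fin M}
    (hX : ∀ h ∈ Finset.Icc 1 H, Measurable[past D H t m (h + 1)] (X t m h))
    (hstep : ∀ h ∈ Finset.Icc 1 H, ∀ G : Ω → ENNReal, Measurable[past D H t m h] G →
      ∫⁻ ω, G ω * ENNReal.ofReal (Real.exp (X t m h ω)) ∂P ≤ ∫⁻ ω, G ω ∂P)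
    {j : ℕ} (hj : j ≤ H) {G : Ω → ENNReal} (hG : Measurable[past D H t m 1] G) :
    ∫⁻ ω, G ω * ENNReal.ofReal (Real.exp (∑ h ∈ Finset.Icc 1 j, X t m h ω)) ∂P
      ≤ ∫⁻ ω, G ω ∂P := by
  induction j with
  | zero => simp
  | succ j ih =>
    refine le_trans ?_ (ih (by omega))
    have hG' : Measurable[past D H t m (j + 1)] fun ω =>
        G ω * ENNReal.ofReal (Real.exp (∑ h ∈ Finset.Icc 1 j, X t m h ω)) := by
      refine Measurable.mul (hG.mono (past_mono (by omega)) le_rfl)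
        (Measurable.ennreal_ofReal (Measurable.exp (Finset.measurable_sum _ fun h hh => ?_)))
      rw [Finset.mem_Icc] at hh
      exact (hX h (by rw [Finset.mem_Icc]; omega)).mono (past_mono (by omega)) le_rfl
    have := hstep (j + 1) (by rw [Finset.mem_Icc]; omega) _ hG'
    simpa only [Finset.sum_Icc_succ_top (Nat.le_add_left 1 j), ofReal_exp_add, mul_assoc]
      using this

theorem lintegral_exp_sum_agents_le {t : ℕ}
    (hX : ∀ m, ∀ h ∈ Finset.Icc 1 H, Measurable[past D H t m (h + 1)] (X t m h))
    (hstep : ∀ m, ∀ h ∈ Finset.Icc 1 H, ∀ G : Ω → ENNReal, Measurable[past D H t m h] G →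
      ∫⁻ ω, G ω * ENNReal.ofReal (Real.exp (X t m h ω)) ∂P ≤ ∫⁻ ω, G ω ∂P)
    {a : ℕ} (ha : a ≤ M) {G : Ω → ENNReal} (hG : Measurable[before D H t] G) :
    ∫⁻ ω, G ω * ENNReal.ofReal (Real.exp (∑ m ∈ Finset.univ.filter (fun m : Fin M => (m : ℕ) < a),
      ∑ h ∈ Finset.Icc 1 H, X t m h ω)) ∂P ≤ ∫⁻ ω, G ω ∂P := by
  induction a with
  | zero => simp
  | succ a ih =>
    refine le_trans ?_ (ih (by omega))
    set b : Fin M := ⟨a, by omega⟩ with hb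
    have hins : Finset.univ.filter (fun m : Fin M => (m : ℕ) < a + 1)
        = insert b (Finset.univ.filter (fun m : Fin M => (m : ℕ) < a)) := by
      ext m; simp [hb, Fin.ext_iff]; omega
    have hnot : b ∉ Finset.univ.filter (fun m : Fin M => (m : ℕ) < a) := by simp [hb]
    have hG' : Measurable[past D H t b 1] fun ω => G ω * ENNReal.ofReal (Real.exp
        (∑ m ∈ Finset.univ.filter (fun m : Fin M => (m : ℕ) < a),
          ∑ h ∈ Finset.Icc 1 H, X t m h ω)) := by
      refine Measurable.mul (hG.mono (before_le_past _ _) le_rfl)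
        (Measurable.ennreal_ofReal (Measurable.exp (Finset.measurable_sum _ fun m hm =>
          Finset.measurable_sum _ fun h hh => ?_)))
      rw [Finset.mem_filter] at hm
      exact (hX m h hh).mono (past_mono (Or.inr (Or.inl ⟨rfl, by simp [Fin.lt_def, hb, hm.2]⟩)))
        le_rfl
    have := lintegral_exp_sum_steps_le (hX b) (hstep b) le_rfl hG'
    simp only [hins, Finset.sum_insert hnot]
    simpa only [add_comm (∑ h ∈ Finset.Icc 1 H, X t b h _), ofReal_exp_add, mul_assoc] using this

/-- Exponential supermartingales along the steps of all episodes of all agents. -/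
theorem lintegral_exp_sum_le [IsProbabilityMeasure P]
    (hX : ∀ t ∈ Finset.Icc 1 T, ∀ m, ∀ h ∈ Finset.Icc 1 H,
      Measurable[past D H t m (h + 1)] (X t m h))
    (hstep : ∀ t ∈ Finset.Icc 1 T, ∀ m, ∀ h ∈ Finset.Icc 1 H, ∀ G : Ω → ENNReal,
      Measurable[past D H t m h] G →
      ∫⁻ ω, G ω * ENNReal.ofReal (Real.exp (X t m h ω)) ∂P ≤ ∫⁻ ω, G ω ∂P) :
    ∫⁻ ω, ENNReal.ofReal (Real.exp (∑ t ∈ Finset.Icc 1 T, ∑ m, ∑ h ∈ Finset.Icc 1 H, X t m h ω)) ∂P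
      ≤ 1 := by
  suffices h : ∀ U ≤ T, ∫⁻ ω, ENNReal.ofReal (Real.exp
      (∑ t ∈ Finset.Icc 1 U, ∑ m, ∑ h ∈ Finset.Icc 1 H, X t m h ω)) ∂P ≤ 1 from h T le_rfl
  intro U hU
  induction U with
  | zero => simp
  | succ U ih =>
    refine le_trans ?_ (ih (by omega))
    have hG : Measurable[before D H (U + 1)] fun ω => ENNReal.ofReal (Real.exp
        (∑ t ∈ Finset.Icc 1 U, ∑ m, ∑ h ∈ Finset.Icc 1 H, X t m h ω)) := by
      refine Measurable.ennreal_ofReal (Measurable.exp (Finset.measurable_sum _ fun t ht =>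
        Finset.measurable_sum _ fun m _ => Finset.measurable_sum _ fun h hh => ?_))
      rw [Finset.mem_Icc] at ht
      exact (hX t (by rw [Finset.mem_Icc]; omega) m h hh).mono (past_le_before (by omega)) le_rfl
    have hU' : U + 1 ∈ Finset.Icc 1 T := by rw [Finset.mem_Icc]; omega
    have := lintegral_exp_sum_agents_le (hX (U + 1) hU') (hstep (U + 1) hU') le_rfl hG
    have hall : Finset.univ.filter (fun m : Fin M => (m : ℕ) < M) = Finset.univ := by
      ext m; simp
    rw [hall] at this
    simpa only [Finset.sum_Icc_succ_top (Nat.le_add_left 1 U), ofReal_exp_add] using this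

/-- Markov's inequality for `exp X`. -/
theorem measure_log_inv_le_sum {X : Ω → ℝ} (hX : Measurable X)
    (h : ∫⁻ ω, ENNReal.ofReal (Real.exp (X ω)) ∂P ≤ 1) {δ : ℝ} (hδ : 0 < δ) :
    P {ω | Real.log (1 / δ) ≤ X ω} ≤ ENNReal.ofReal δ := by
  have hpos : 0 < 1 / δ := by positivity
  have h1 : {ω | Real.log (1 / δ) ≤ X ω}
      = {ω | ENNReal.ofReal (1 / δ) ≤ ENNReal.ofReal (Real.exp (X ω))} := by
    ext ω
    simp only [Set.mem_ofPred_eq]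
    rw [ENNReal.ofReal_le_ofReal_iff (Real.exp_pos _).le, Real.log_le_iff_le_exp hpos]
  rw [h1]
  refine (meas_ge_le_lintegral_div (by fun_prop) (by simpa using hδ) ENNReal.ofReal_ne_top).trans ?_
  rw [one_div, ENNReal.ofReal_inv_of_pos hδ, div_eq_mul_inv, inv_inv]
  exact mul_le_of_le_one_left zero_le h

end Supermartingale

section Run

variable [MeasurableSpace Ω] {P : Measure Ω} [IsProbabilityMeasure P] [Fintype A] [Nonempty A]

theorem IsRun.past_le (hrun : alg.IsRun E T P D k) {t : ℕ} (ht : t ∈ Finset.Icc 1 T) (m : Fin M)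
    (h : ℕ) : past D alg.H t m h ≤ (inferInstance : MeasurableSpace Ω) :=
  CoopLSVI.past_le fun τ n i h1 hi hc =>
    hrun.measurable_state τ (by rw [Finset.mem_Icc] at *; omega) n i hi

theorem Follows.historyMeasurable_past (hf : alg.Follows E T D k) {t : ℕ}
    (ht : t ∈ Finset.Icc 1 T) (m : Fin M) (h : ℕ) :
    @HistoryMeasurable S A _ _ M d Ω (past D alg.H t m h) alg D t
      ∧ Measurable[past D alg.H t m h] fun ω => k ω t := by
  rw [Finset.mem_Icc] at ht
  refine @Follows.historyMeasurable S A _ _ M d Ω alg D E T k _ _ (past D alg.H t m h) hf t ht.1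
    (by omega) fun τ hτ n i hi => ?_
  rw [Finset.mem_Ico] at hτ
  exact measurable_state_past hτ.1 hi (Or.inl hτ.2)

theorem Follows.measurable_state_action (hf : alg.Follows E T D k) {t : ℕ}
    (ht : t ∈ Finset.Icc 1 T) (m : Fin M) {h : ℕ} (hh : h ∈ Finset.Icc 1 alg.H) :
    Measurable[past D alg.H t m h] fun ω => ((D ω).state t m h, (D ω).action t m h) := by
  obtain ⟨hH, hk⟩ := hf.historyMeasurable_past ht m h
  have hst : Measurable[past D alg.H t m h] fun ω => (D ω).state t m h :=
    measurable_state_past (Finset.mem_Icc.1 ht).1 (by rw [Finset.mem_Icc] at *; omega)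
      (Or.inr (Or.inr ⟨rfl, rfl, le_rfl⟩))
  simp only [hf.action_eq _ t ht m h hh]
  have h2 := (@HistoryMeasurable.greedy_random S A _ _ M d Ω (past D alg.H t m h) alg D t hH h hh
    _ _ m _ hk).comp (measurable_id.prodMk hst)
  simp only [Function.comp_def, id] at h2
  exact hst.prodMk h2

/-- Conditional Hoeffding bound for one step of a run. -/
theorem IsRun.lintegral_mul_exp_le (hrun : alg.IsRun E T P D k) {t : ℕ} (ht : t ∈ Finset.Icc 1 T)
    (m : Fin M) {h : ℕ} (hh : h ∈ Finset.Icc 1 alg.H) {g : Ω × S → ℝ}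
    (hg : Measurable[(past D alg.H t m h).prod inferInstance] g) {a b : ℝ}
    (hab : ∀ q, g q ∈ Set.Icc a b) {s : Ω → ℝ} (hs : Measurable[past D alg.H t m h] s)
    {G : Ω → ENNReal} (hG : Measurable[past D alg.H t m h] G) :
    ∫⁻ ω, G ω * ENNReal.ofReal (Real.exp (s ω * (g (ω, (D ω).state t m (h + 1))
      - ∫ y, g (ω, y) ∂((E m).transition h ((D ω).state t m h, (D ω).action t m h)))
      - s ω ^ 2 * (b - a) ^ 2 / 8)) ∂P ≤ ∫⁻ ω, G ω ∂P := by
  have hz := hrun.follows.measurable_state_action ht m hh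
  have hm := hrun.past_le ht m h
  have hY : Measurable fun ω => (D ω).state t m (h + 1) :=
    hrun.measurable_state t ht m (h + 1) (by rw [Finset.mem_Icc] at *; omega)
  -- The frozen variable is the identity into `Ω` equipped with the σ-algebra `past`; the kernel is
  -- the transition kernel pulled back along the current state-action pair.
  refine @_root_.lintegral_mul_exp_le Ω Ω S _ (past D alg.H t m h) _ P _ id
    (fun ω => (D ω).state t m (h + 1)) (@Kernel.comap _ _ _ _ _ (past D alg.H t m h)
      ((E m).transition h) _ hz) (Kernel.IsMarkovKernel.comap _ hz) (fun f hf => ?_) g hg a b hab s hs G hG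
  exact @lintegral_freeze Ω Ω S _ (past D alg.H t m h) _ P _ id
    (fun ω => (D ω).state t m (h + 1)) (@Kernel.comap _ _ _ _ _ (past D alg.H t m h)
      ((E m).transition h) _ hz) (Kernel.IsMarkovKernel.comap _ hz) (measurable_id'' hm) hY
    (fun B C hB hC => measure_inter_eq_setLIntegral_of_condExp hm hY hz hC
      (hrun.transition t ht m h hh C hC) hB) f hf

end Run

end CoopLSVI

/-! ### Concentration of the regression noise, and the class of value functions -/

namespace CoopLSVI

variable {S A : Type*} [MeasurableSpace S] [MeasurableSpace A] {M d : ℕ} {Ω : Type*}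
  {alg : CoopLSVI S A M d} {D : Ω → Observations S A M} {E : Fin M → EpisodicMDP S A} {T : ℕ}
  {k : Ω → ℕ → ℕ}

/-- The deviation of `V (x')` from its conditional expectation, in the transition at step `h`
of agent `p.1` in episode `p.2`. -/
def deviation (E : Fin M → EpisodicMDP S A) (D : Observations S A M) (h : ℕ) (V : S → ℝ)
    (p : Fin M × ℕ) : ℝ :=
  V (D.state p.2 p.1 (h + 1))
    - ∫ y, V y ∂((E p.1).transition h (D.state p.2 p.1 h, D.action p.2 p.1 h))

/-- The noise part of the right-hand side of the regression. -/
def noise (alg : CoopLSVI S A M d) (E : Fin M → EpisodicMDP S A) (D : Observations S A M)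
    (m : Fin M) (t k h : ℕ) (V : S → ℝ) : Fin d → ℝ :=
  ∑ p ∈ avail m t k, deviation E D h V p • alg.feat D h p.1 p.2

theorem dotProduct_noise (D : Observations S A M) (m : Fin M) (t k h : ℕ) (V : S → ℝ)
    (θ : Fin d → ℝ) : θ ⬝ᵥ alg.noise E D m t k h V
      = ∑ p ∈ avail m t k, (θ ⬝ᵥ alg.feat D h p.1 p.2) * deviation E D h V p := by
  rw [noise, dotProduct_sum]
  refine Finset.sum_congr rfl fun p _ => ?_
  rw [dotProduct_smul, smul_eq_mul, mul_comm]

theorem gram_eq_regGram (hlam : alg.lam = 1) (D : Observations S A M) (m : Fin M) (t k h : ℕ) :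
    alg.gram D m t k h = regGram (fun p : Fin M × ℕ => alg.feat D h p.1 p.2) (avail m t k) := by
  rw [gram, regGram, hlam, one_smul]

theorem syncGram_eq_regGram (hlam : alg.lam = 1) (D : Observations S A M) (k h : ℕ) :
    alg.syncGram D k h = regGram (fun p : Fin M × ℕ => alg.feat D h p.1 p.2) (syncPairs M k) := by
  rw [syncGram, regGram, hlam, one_smul, syncPairs]

theorem feat_dotProduct_self_le (D : Observations S A M) (h : ℕ) (p : Fin M × ℕ) :
    alg.feat D h p.1 p.2 ⬝ᵥ alg.feat D h p.1 p.2 ≤ 1 := alg.φ.dotProduct_self_le _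

theorem card_avail_le {m : Fin M} {t k : ℕ} (ht : t ≤ T + 1) : (avail m t k).card ≤ M * T :=
  card_syncPairs (M := M) (k := T) ▸ Finset.card_le_card (avail_subset_syncPairs ht)

section Concentration

variable [MeasurableSpace Ω] {P : Measure Ω} [IsProbabilityMeasure P] [Fintype A] [Nonempty A]

/-- With a deterministic index `j` the set `avail m t j` is not random, and with `V` and `θ` fixed
the noise in direction `θ` is a sum of martingale differences. The data-dependent index and value
function are recovered by union bounds. -/
theorem IsRun.measure_noise_le (hrun : alg.IsRun E T P D k) {t : ℕ} (ht : t ∈ Finset.Icc 1 T)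
    (m : Fin M) (j : ℕ) {h : ℕ} (hh : h ∈ Finset.Icc 1 alg.H) {V : S → ℝ} (hV : Measurable V)
    {L : ℝ} (hVL : ∀ x, V x ∈ Set.Icc 0 L) (θ : Fin d → ℝ) {δ : ℝ} (hδ : 0 < δ) :
    P {ω | Real.log (1 / δ) ≤ θ ⬝ᵥ alg.noise E (D ω) m t j h V
        - L ^ 2 / 2 * ∑ p ∈ avail m t j, (alg.feat (D ω) h p.1 p.2 ⬝ᵥ θ) ^ 2}
      ≤ ENNReal.ofReal δ := by
  classical
  -- The predictable multiplier selects step `h` and the available pairs, so the supermartingale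
  -- over all steps of all episodes applies without reindexing.
  set s : ℕ → Fin M → ℕ → Ω → ℝ := fun τ n i ω =>
    if i = h ∧ (n, τ) ∈ avail m t j then alg.φ.toFun ((D ω).state τ n i, (D ω).action τ n i) ⬝ᵥ θ
    else 0 with hs
  set X : ℕ → Fin M → ℕ → Ω → ℝ := fun τ n i ω =>
    s τ n i ω * (V ((D ω).state τ n (i + 1))
      - ∫ y, V y ∂((E n).transition i ((D ω).state τ n i, (D ω).action τ n i)))
      - s τ n i ω ^ 2 * (L - 0) ^ 2 / 8 with hX
  have hsmeas : ∀ τ ∈ Finset.Icc 1 T, ∀ n, ∀ i ∈ Finset.Icc 1 alg.H,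
      Measurable[past D alg.H τ n i] (s τ n i) := by
    intro τ hτ n i hi
    have hz := hrun.follows.measurable_state_action hτ n hi
    by_cases hc : i = h ∧ (n, τ) ∈ avail m t j
    · have hsi : s τ n i
          = fun ω => alg.φ.toFun ((D ω).state τ n i, (D ω).action τ n i) ⬝ᵥ θ :=
        funext fun ω => if_pos hc
      rw [hsi]
      exact @measurable_dotProduct Ω (Fin d) (past D alg.H τ n i) _ _
        (fun ω => alg.φ.toFun ((D ω).state τ n i, (D ω).action τ n i)) (fun _ => θ)
        (fun l => (measurable_pi_apply l).comp (alg.φ.measurable.comp hz))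
        (fun l => measurable_const)
    · simp only [hs, hc, if_false]
      exact measurable_const
  have hXmeas : ∀ τ ∈ Finset.Icc 1 T, ∀ n, ∀ i ∈ Finset.Icc 1 alg.H,
      Measurable[past D alg.H τ n (i + 1)] (X τ n i) := by
    intro τ hτ n i hi
    have hle : past D alg.H τ n i ≤ past D alg.H τ n (i + 1) := past_mono (by omega)
    have hz := (hrun.follows.measurable_state_action hτ n hi).mono hle le_rfl
    have h1 := (hsmeas τ hτ n i hi).mono hle le_rfl
    have hst : Measurable[past D alg.H τ n (i + 1)] fun ω => (D ω).state τ n (i + 1) :=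
      measurable_state_past (Finset.mem_Icc.1 hτ).1 (by rw [Finset.mem_Icc] at *; omega)
        (Or.inr (Or.inr ⟨rfl, rfl, le_rfl⟩))
    have hPV : Measurable fun z => ∫ y, V y ∂((E n).transition i z) :=
      (StronglyMeasurable.integral_kernel hV.stronglyMeasurable).measurable
    exact (h1.mul ((hV.comp hst).sub (hPV.comp hz))).sub (((h1.pow_const 2).mul_const _).div_const _)
  have hstep := lintegral_exp_sum_le (P := P) hXmeas fun τ hτ n i hi G hG =>
    hrun.lintegral_mul_exp_le hτ n hi (g := fun q => V q.2) (hV.comp measurable_snd)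
      (fun q => hVL q.2) (hsmeas τ hτ n i hi) hG
  have hsum : Measurable fun ω => ∑ τ ∈ Finset.Icc 1 T, ∑ n, ∑ i ∈ Finset.Icc 1 alg.H, X τ n i ω :=
    Finset.measurable_sum _ fun τ hτ => Finset.measurable_sum _ fun n _ =>
      Finset.measurable_sum _ fun i hi =>
        (hXmeas τ hτ n i hi).mono (hrun.past_le hτ n (i + 1)) le_rfl
  refine (measure_mono fun ω hω => ?_).trans (measure_log_inv_le_sum hsum hstep hδ)
  rw [Set.mem_ofPred_eq] at hω ⊢
  refine hω.trans ?_
  have heq : ∑ τ ∈ Finset.Icc 1 T, ∑ n, ∑ i ∈ Finset.Icc 1 alg.H, X τ n i ω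
      = ∑ p ∈ avail m t j, ((θ ⬝ᵥ alg.feat (D ω) h p.1 p.2) * deviation E (D ω) h V p
        - (alg.feat (D ω) h p.1 p.2 ⬝ᵥ θ) ^ 2 * L ^ 2 / 8) := by
    have h1 : ∀ τ n, ∑ i ∈ Finset.Icc 1 alg.H, X τ n i ω
        = if (n, τ) ∈ avail m t j then (θ ⬝ᵥ alg.feat (D ω) h n τ) * deviation E (D ω) h V (n, τ)
          - (alg.feat (D ω) h n τ ⬝ᵥ θ) ^ 2 * L ^ 2 / 8 else 0 := by
      intro τ n
      rw [Finset.sum_eq_single_of_mem h hh fun i _ hi => by simp [hX, hs, hi]]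
      by_cases hc : (n, τ) ∈ avail m t j
      · simp only [hX, hs, hc, if_true, and_self, deviation, sub_zero]
        rw [dotProduct_comm θ]
        rfl
      · simp [hX, hs, hc]
    simp only [h1]
    rw [Finset.sum_comm, ← Finset.sum_product' (f := fun n τ => if (n, τ) ∈ avail m t j then
      (θ ⬝ᵥ alg.feat (D ω) h n τ) * deviation E (D ω) h V (n, τ)
          - (alg.feat (D ω) h n τ ⬝ᵥ θ) ^ 2 * L ^ 2 / 8 else 0)]
    have hsub : avail m t j ⊆ Finset.univ ×ˢ Finset.Icc 1 T :=
      avail_subset_syncPairs (by rw [Finset.mem_Icc] at ht; omega)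
    rw [← Finset.sum_subset hsub fun p _ hp => by simp [hp]]
    exact Finset.sum_congr rfl fun p hp => by rw [if_pos hp]
  rw [heq, dotProduct_noise, Finset.sum_sub_distrib, ← Finset.sum_div, ← Finset.sum_mul]
  have h0 : 0 ≤ ∑ p ∈ avail m t j, (alg.feat (D ω) h p.1 p.2 ⬝ᵥ θ) ^ 2 :=
    Finset.sum_nonneg fun p _ => sq_nonneg _
  -- The Hoeffding constant `L² / 8` is relaxed to `L² / 2`.
  nlinarith [mul_nonneg h0 (sq_nonneg L)]

end Concentration

section ValueClass

variable [Fintype A] [Nonempty A]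

/-- The truncated functions of the form of the value estimates: linear part `w`, bonus part `B`. -/
def classValue (φ : FeatureMap S A d) (L : ℝ) (w : Fin d → ℝ) (B : Matrix (Fin d) (Fin d) ℝ)
    (x : S) : ℝ :=
  Finset.univ.sup' Finset.univ_nonempty fun a : A =>
    max 0 (min (φ.toFun (x, a) ⬝ᵥ w + √(φ.toFun (x, a) ⬝ᵥ (B *ᵥ φ.toFun (x, a)))) L)

/-- The cut at zero keeps every member of the class bounded, including those with arbitrary grid
parameters, so that Hoeffding's lemma applies to all of them. -/
theorem classValue_mem (φ : FeatureMap S A d) {L : ℝ} (hL : 0 ≤ L) (w : Fin d → ℝ)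
    (B : Matrix (Fin d) (Fin d) ℝ) (x : S) : classValue φ L w B x ∈ Set.Icc 0 L := by
  constructor
  · obtain ⟨a⟩ := (inferInstance : Nonempty A)
    exact (le_max_left _ _).trans (Finset.le_sup' (fun a : A =>
      max 0 (min (φ.toFun (x, a) ⬝ᵥ w + √(φ.toFun (x, a) ⬝ᵥ (B *ᵥ φ.toFun (x, a)))) L))
      (Finset.mem_univ a))
  · exact Finset.sup'_le _ _ fun a _ => max_le hL (min_le_right _ _)

theorem measurable_classValue (φ : FeatureMap S A d) (L : ℝ) (w : Fin d → ℝ)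
    (B : Matrix (Fin d) (Fin d) ℝ) : Measurable (classValue φ L w B) := by
  have : classValue φ L w B = Finset.univ.sup' Finset.univ_nonempty fun (a : A) (x : S) =>
      max 0 (min (φ.toFun (x, a) ⬝ᵥ w + √(φ.toFun (x, a) ⬝ᵥ (B *ᵥ φ.toFun (x, a)))) L) := by
    funext x
    rw [Finset.sup'_apply, classValue]
  rw [this]
  refine Finset.measurable_sup' _ fun a _ => ?_
  have hφ : ∀ i, Measurable fun x : S => φ.toFun (x, a) i := fun i =>
    (measurable_pi_apply i).comp (φ.measurable.comp measurable_prodMk_right)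
  exact measurable_const.max (((measurable_dotProduct (g := fun _ => w) hφ
    fun i => measurable_const).add (measurable_dotProduct hφ
      (measurable_mulVec (f := fun _ => B) (fun i j => measurable_const) hφ)).sqrt).min
    measurable_const)

theorem abs_sup'_sub_sup'_le {ι : Type*} {s : Finset ι} (hs : s.Nonempty) {f g : ι → ℝ} {ε : ℝ}
    (h : ∀ i ∈ s, |f i - g i| ≤ ε) : |s.sup' hs f - s.sup' hs g| ≤ ε := by
  rw [abs_le]
  constructor
  · have : s.sup' hs g ≤ s.sup' hs f + ε := Finset.sup'_le _ _ fun i hi => by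
      have h1 := (abs_le.1 (h i hi)).1
      have h2 := Finset.le_sup' f hi
      linarith
    linarith
  · have : s.sup' hs f ≤ s.sup' hs g + ε := Finset.sup'_le _ _ fun i hi => by
      have h1 := (abs_le.1 (h i hi)).2
      have h2 := Finset.le_sup' g hi
      linarith
    linarith

theorem abs_dotProduct_le_card_mul {u v : Fin d → ℝ} {a b : ℝ} (ha : 0 ≤ a)
    (hu : ∀ i, |u i| ≤ a) (hv : ∀ i, |v i| ≤ b) : |u ⬝ᵥ v| ≤ d * (a * b) := by
  refine (Finset.abs_sum_le_sum_abs _ _).trans ?_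
  refine (Finset.sum_le_card_nsmul _ _ (a * b) fun i _ => ?_).trans_eq (by simp)
  rw [abs_mul]
  exact mul_le_mul (hu i) (hv i) (abs_nonneg _) ha

/-- No sign is assumed, since a grid matrix need not be positive semidefinite and `Real.sqrt`
vanishes on negative numbers. -/
theorem abs_sqrt_sub_sqrt_le (a b : ℝ) : |√a - √b| ≤ √|a - b| := by
  have key : ∀ a b : ℝ, √a - √b ≤ √|a - b| := fun a b => by
    have h : √a ≤ √(b ⊔ 0) + √|a - b| := by
      refine Real.sqrt_le_iff.2 ⟨by positivity, ?_⟩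
      have h1 := Real.sq_sqrt (le_max_right b 0)
      have h2 := Real.sq_sqrt (abs_nonneg (a - b))
      have h3 := le_abs_self (a - b)
      have h4 := le_max_left b 0
      have h5 := mul_nonneg (Real.sqrt_nonneg (b ⊔ 0)) (Real.sqrt_nonneg |a - b|)
      nlinarith
    have h' : √(b ⊔ 0) = √b := by
      rcases le_total b 0 with hb | hb
      · rw [max_eq_right hb, Real.sqrt_zero, Real.sqrt_eq_zero_of_nonpos hb]
      · rw [max_eq_left hb]
    rw [h'] at h
    linarith
  rw [abs_le]
  constructor
  · have := key b a
    rw [abs_sub_comm] at this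
    linarith
  · exact key a b

/-- Maxima and truncations are 1-Lipschitz, but the square root is only Hölder of order 1/2, whence
the term `d √ε`. -/
theorem abs_classValue_sub_le (φ : FeatureMap S A d) (L : ℝ) {w w' : Fin d → ℝ}
    {B B' : Matrix (Fin d) (Fin d) ℝ} {ε : ℝ} (hw : ∀ i, |w i - w' i| ≤ ε)
    (hB : ∀ i j, |B i j - B' i j| ≤ ε) (x : S) :
    |classValue φ L w B x - classValue φ L w' B' x| ≤ d * ε + d * √ε := by
  refine abs_sup'_sub_sup'_le _ fun a _ => ?_
  set u := φ.toFun (x, a) with hu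
  have hu1 : ∀ i, |u i| ≤ 1 := fun i => (abs_apply_le_euclNorm u i).trans (φ.norm_le _)
  have h1 : |u ⬝ᵥ w - u ⬝ᵥ w'| ≤ d * ε := by
    rw [← dotProduct_sub]
    simpa using abs_dotProduct_le_card_mul zero_le_one hu1 (v := w - w') hw
  have h2 : |√(u ⬝ᵥ (B *ᵥ u)) - √(u ⬝ᵥ (B' *ᵥ u))| ≤ d * √ε := by
    refine (abs_sqrt_sub_sqrt_le _ _).trans ?_
    rw [← dotProduct_sub, ← Matrix.sub_mulVec]
    have h3 : ∀ i, |((B - B') *ᵥ u) i| ≤ d * ε := fun i => by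
      have hεi : 0 ≤ ε := (abs_nonneg _).trans (hB i i)
      have := abs_dotProduct_le_card_mul hεi (u := fun j => (B - B') i j) (hB i) hu1
      rw [mul_one] at this
      exact this
    have h4 := abs_dotProduct_le_card_mul zero_le_one hu1 h3
    refine (Real.sqrt_le_sqrt h4).trans_eq ?_
    rw [one_mul, ← mul_assoc, Real.sqrt_mul (by positivity), Real.sqrt_mul_self (by positivity)]
  have h5 := abs_max_sub_max_le_abs (min (u ⬝ᵥ w + √(u ⬝ᵥ (B *ᵥ u))) L)
    (min (u ⬝ᵥ w' + √(u ⬝ᵥ (B' *ᵥ u))) L) 0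
  rw [max_comm _ (0 : ℝ), max_comm _ (0 : ℝ)] at h5
  refine h5.trans ?_
  have h6 := abs_min_sub_min_le_max (u ⬝ᵥ w + √(u ⬝ᵥ (B *ᵥ u))) L
    (u ⬝ᵥ w' + √(u ⬝ᵥ (B' *ᵥ u))) L
  rw [sub_self, abs_zero, max_eq_left (abs_nonneg _)] at h6
  refine h6.trans ?_
  calc _ = |(u ⬝ᵥ w - u ⬝ᵥ w') + (√(u ⬝ᵥ (B *ᵥ u)) - √(u ⬝ᵥ (B' *ᵥ u)))| := by ring_nf
    _ ≤ _ := (abs_add_le _ _).trans (add_le_add h1 h2)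

end ValueClass

section Grid

/-- The vectors with integer coordinates of absolute value at most `K`. -/
def intBox (ι : Type*) [Fintype ι] [DecidableEq ι] (K : ℕ) : Finset (ι → ℤ) :=
  Fintype.piFinset fun _ => Finset.Icc (-(K : ℤ)) K

theorem card_intBox (ι : Type*) [Fintype ι] [DecidableEq ι] (K : ℕ) :
    (intBox ι K).card = (2 * K + 1) ^ Fintype.card ι := by
  rw [intBox, Fintype.card_piFinset]
  simp only [Int.card_Icc, Finset.prod_const, Finset.card_univ]
  congr 1
  omega

theorem exists_intBox_near {ι : Type*} [Fintype ι] [DecidableEq ι] {q R : ℕ} (hq : 0 < q)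
    {x : ι → ℝ} (hx : ∀ i, |x i| ≤ R) :
    ∃ j ∈ intBox ι (R * q), ∀ i, |x i - (j i : ℝ) / q| ≤ 1 / q := by
  have hq' : (0 : ℝ) < q := by exact_mod_cast hq
  refine ⟨fun i => ⌊x i * q⌋, ?_, fun i => ?_⟩
  · rw [intBox, Fintype.mem_piFinset]
    intro i
    rw [Finset.mem_Icc]
    have h1 := abs_le.1 (hx i)
    have h2 : x i * q ≤ R * q := mul_le_mul_of_nonneg_right h1.2 hq'.le
    have h3 : -(R * q : ℝ) ≤ x i * q := by
      have := mul_le_mul_of_nonneg_right h1.1 hq'.le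
      linarith
    constructor
    · rw [Int.le_floor]; push_cast; exact h3
    · have : (⌊x i * q⌋ : ℝ) ≤ R * q := (Int.floor_le _).trans h2
      exact_mod_cast this
  · have h1 := Int.floor_le (x i * q)
    have h2 := Int.lt_floor_add_one (x i * q)
    have h3 : x i - (⌊x i * q⌋ : ℝ) / q = (x i * q - ⌊x i * q⌋) / q := by field_simp
    rw [h3, abs_div, abs_of_pos hq', abs_of_nonneg (by linarith)]
    gcongr
    linarith

end Grid

end CoopLSVI

theorem Matrix.PosDef.abs_dotProduct_inv_mulVec_le {n : Type*} [Fintype n] [DecidableEq n]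
    {G : Matrix n n ℝ} (hG : G.PosDef) (u v : n → ℝ) :
    |u ⬝ᵥ (G⁻¹ *ᵥ v)| ≤ √(u ⬝ᵥ (G⁻¹ *ᵥ u)) * √(v ⬝ᵥ (G⁻¹ *ᵥ v)) := by
  rw [← Real.sqrt_mul (hG.dotProduct_inv_nonneg u)]
  exact Real.abs_le_sqrt (hG.inv.posSemidef.sq_dotProduct_mulVec_le u v)

theorem dotProduct_self_le_regGram {n ι : Type*} [Fintype n] [DecidableEq n] (v : ι → n → ℝ)
    (s : Finset ι) (x : n → ℝ) : x ⬝ᵥ x ≤ x ⬝ᵥ (regGram v s *ᵥ x) := by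
  rw [dotProduct_regGram]
  have : 0 ≤ ∑ i ∈ s, (v i ⬝ᵥ x) ^ 2 := Finset.sum_nonneg fun i _ => sq_nonneg _
  linarith

/-- The regularized Gram matrix dominates the identity, so its inverse is a contraction. -/
theorem euclNorm_inv_regGram_le {ι : Type*} {d : ℕ} (v : ι → Fin d → ℝ) (s : Finset ι)
    (x : Fin d → ℝ) : euclNorm ((regGram v s)⁻¹ *ᵥ x) ≤ euclNorm x := by
  set y := (regGram v s)⁻¹ *ᵥ x with hy
  have h1 := dotProduct_self_le_regGram v s y
  rw [hy, (posDef_regGram v s).mulVec_inv_mulVec, ← hy, ← euclNorm_mul_self] at h1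
  have h2 := (le_abs_self _).trans (abs_dotProduct_le_euclNorm y x)
  rcases (euclNorm_nonneg y).eq_or_lt with h0 | h0
  · rw [← h0]; exact euclNorm_nonneg x
  · exact le_of_mul_le_mul_left (h1.trans h2) h0

theorem abs_dotProduct_inv_regGram_le {ι : Type*} {d : ℕ} (v : ι → Fin d → ℝ) (s : Finset ι)
    (u x : Fin d → ℝ) : |u ⬝ᵥ ((regGram v s)⁻¹ *ᵥ x)|
      ≤ √(u ⬝ᵥ ((regGram v s)⁻¹ *ᵥ u)) * euclNorm x :=
  ((posDef_regGram v s).abs_dotProduct_inv_mulVec_le u x).trans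
    (mul_le_mul_of_nonneg_left (Real.sqrt_le_sqrt (dotProduct_inv_regGram_le v s x))
      (Real.sqrt_nonneg _))

/-! ### Union bound over the grids and self-normalized noise bound -/

namespace CoopLSVI

variable {S A : Type*} [MeasurableSpace S] [MeasurableSpace A] {M d : ℕ} {Ω : Type*}
  {alg : CoopLSVI S A M d} {E : Fin M → EpisodicMDP S A} {T : ℕ} [Fintype A] [Nonempty A]

/-- The self-normalized bound of the noise, for a grid of directions and a grid of value
functions. -/
def NoiseControlled (alg : CoopLSVI S A M d) (E : Fin M → EpisodicMDP S A) (T R : ℕ) (ℓ : ℝ)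
    (D : Observations S A M) : Prop :=
  ∀ m : Fin M, ∀ t ∈ Finset.Icc 1 T, ∀ j ∈ Finset.range T, ∀ h ∈ Finset.Icc 1 alg.H,
  ∀ a ∈ intBox (Fin d) (R * (d * M * T) ^ 2), ∀ b ∈ intBox (Fin d × Fin d) (R * (d * M * T) ^ 2),
  ∀ c ∈ intBox (Fin d) (M * T * (alg.H * M * T * d)),
    (fun i => (c i : ℝ) / (alg.H * M * T * d : ℕ)) ⬝ᵥ alg.noise E D m t j h
        (classValue alg.φ ((alg.H : ℝ) - h) (fun i => (a i : ℝ) / ((d * M * T) ^ 2 : ℕ))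
          (fun i i' => (b (i, i') : ℝ) / ((d * M * T) ^ 2 : ℕ)))
      - (alg.H : ℝ) ^ 2 / 2 * ∑ p ∈ avail m t j, (alg.feat D h p.1 p.2 ⬝ᵥ
          (fun i => (c i : ℝ) / (alg.H * M * T * d : ℕ))) ^ 2 < ℓ

/-- The number of inequalities in `NoiseControlled`. -/
def noiseCount (M d T H R : ℕ) : ℕ :=
  M * (T * (T * (H * ((2 * (R * (d * M * T) ^ 2) + 1) ^ d *
    ((2 * (R * (d * M * T) ^ 2) + 1) ^ (d * d) * (2 * (M * T * (H * M * T * d)) + 1) ^ d)))))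

/-- Union bound. The index `j` runs through all possible synchronization times, so the event covers
the random one. -/
theorem IsRun.measure_not_noiseControlled_le [MeasurableSpace Ω] {P : Measure Ω}
    [IsProbabilityMeasure P] {D : Ω → Observations S A M} {k : Ω → ℕ → ℕ}
    (hrun : alg.IsRun E T P D k) (R : ℕ) {δ : ℝ} (hδ : 0 < δ) :
    P {ω | ¬ NoiseControlled alg E T R (Real.log (1 / δ)) (D ω)}
      ≤ noiseCount M d T alg.H R * ENNReal.ofReal δ := by
  set I := (Finset.univ : Finset (Fin M)) ×ˢ Finset.Icc 1 T ×ˢ Finset.range T ×ˢ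
    Finset.Icc 1 alg.H ×ˢ intBox (Fin d) (R * (d * M * T) ^ 2) ×ˢ
    intBox (Fin d × Fin d) (R * (d * M * T) ^ 2) ×ˢ
    intBox (Fin d) (M * T * (alg.H * M * T * d)) with hI
  set bad : Fin M × ℕ × ℕ × ℕ × (Fin d → ℤ) × (Fin d × Fin d → ℤ) × (Fin d → ℤ) → Set Ω := fun i =>
    {ω | Real.log (1 / δ) ≤ (fun l => (i.2.2.2.2.2.2 l : ℝ) / (alg.H * M * T * d : ℕ)) ⬝ᵥ
        alg.noise E (D ω) i.1 i.2.1 i.2.2.1 i.2.2.2.1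
        (classValue alg.φ ((alg.H : ℝ) - i.2.2.2.1)
          (fun l => (i.2.2.2.2.1 l : ℝ) / ((d * M * T) ^ 2 : ℕ))
          (fun l l' => (i.2.2.2.2.2.1 (l, l') : ℝ) / ((d * M * T) ^ 2 : ℕ)))
      - (alg.H : ℝ) ^ 2 / 2 * ∑ p ∈ avail i.1 i.2.1 i.2.2.1,
        (alg.feat (D ω) i.2.2.2.1 p.1 p.2 ⬝ᵥ
          (fun l => (i.2.2.2.2.2.2 l : ℝ) / (alg.H * M * T * d : ℕ))) ^ 2} with hbad
  have hsub : {ω | ¬ NoiseControlled alg E T R (Real.log (1 / δ)) (D ω)} ⊆ ⋃ i ∈ I, bad i := by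
    intro ω hω
    rw [Set.mem_ofPred_eq, NoiseControlled] at hω
    push Not at hω
    obtain ⟨m, t, ht, j, hj, h, hh, a, ha, b, hb, c, hc, hle⟩ := hω
    refine Set.mem_biUnion (x := (m, t, j, h, a, b, c)) ?_ hle
    simp only [hI, Finset.coe_product, Set.mem_prod, Finset.mem_coe, Finset.mem_univ, true_and]
    exact ⟨ht, hj, hh, ha, hb, hc⟩
  have hcard : I.card = noiseCount M d T alg.H R := by
    simp only [hI, Finset.card_product, card_intBox, Finset.card_univ, Fintype.card_fin,
      Fintype.card_prod, Nat.card_Icc, Finset.card_range, Nat.add_sub_cancel, noiseCount]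
  calc _ ≤ P (⋃ i ∈ I, bad i) := measure_mono hsub
    _ ≤ ∑ i ∈ I, P (bad i) := measure_biUnion_finset_le I bad
    _ ≤ ∑ _i ∈ I, ENNReal.ofReal δ := by
      refine Finset.sum_le_sum fun i hi => ?_
      simp only [hI, Finset.mem_product] at hi
      have hh : (i.2.2.2.1 : ℝ) ≤ alg.H := by exact_mod_cast (Finset.mem_Icc.1 hi.2.2.2.1).2
      have hh0 : (0 : ℝ) ≤ i.2.2.2.1 := Nat.cast_nonneg _
      refine hrun.measure_noise_le hi.2.1 i.1 i.2.2.1 hi.2.2.2.1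
        (measurable_classValue alg.φ _ _ _) (fun x => ?_) _ hδ
      have := classValue_mem alg.φ (L := (alg.H : ℝ) - i.2.2.2.1) (by linarith)
        (fun l => (i.2.2.2.2.1 l : ℝ) / ((d * M * T) ^ 2 : ℕ))
        (fun l l' => (i.2.2.2.2.2.1 (l, l') : ℝ) / ((d * M * T) ^ 2 : ℕ)) x
      exact ⟨this.1, this.2.trans (by linarith)⟩
    _ = _ := by rw [Finset.sum_const, hcard, nsmul_eq_mul]

theorem abs_deviation_sub_le {D : Observations S A M} {h : ℕ} {V V' : S → ℝ} {L ε : ℝ}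
    (hV : Measurable V) (hV' : Measurable V') (hVL : ∀ x, V x ∈ Set.Icc 0 L)
    (hVL' : ∀ x, V' x ∈ Set.Icc 0 L) (hε : ∀ x, |V x - V' x| ≤ ε) (p : Fin M × ℕ) :
    |deviation E D h V p - deviation E D h V' p| ≤ 2 * ε := by
  set ν := (E p.1).transition h (D.state p.2 p.1 h, D.action p.2 p.1 h) with hν
  have h1 := hε (D.state p.2 p.1 (h + 1))
  have h2 := integral_mem_Icc_of_forall (μ := ν) (hV.sub hV') fun x => abs_le.1 (hε x)
  simp only [Pi.sub_apply] at h2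
  rw [integral_sub (integrable_of_mem_Icc hV hVL) (integrable_of_mem_Icc hV' hVL')] at h2
  have h3 := abs_le.1 h1
  rw [deviation, deviation, abs_le]
  constructor <;> linarith [h2.1, h2.2]

theorem abs_deviation_le {D : Observations S A M} {h : ℕ} {V : S → ℝ} {L : ℝ}
    (hV : Measurable V) (hVL : ∀ x, V x ∈ Set.Icc 0 L) (p : Fin M × ℕ) :
    |deviation E D h V p| ≤ L := by
  have h2 := integral_mem_Icc_of_forall
    (μ := (E p.1).transition h (D.state p.2 p.1 h, D.action p.2 p.1 h)) hV hVL
  have h1 := hVL (D.state p.2 p.1 (h + 1))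
  rw [deviation, abs_le]
  constructor <;> linarith [h1.1, h1.2, h2.1, h2.2]

theorem euclNorm_sum_smul_feat_le {D : Observations S A M} {h : ℕ} {s : Finset (Fin M × ℕ)}
    {c : Fin M × ℕ → ℝ} {ε : ℝ} (hc : ∀ p ∈ s, |c p| ≤ ε) :
    euclNorm (∑ p ∈ s, c p • alg.feat D h p.1 p.2) ≤ s.card * ε := by
  refine (euclNorm_sum_le _ _).trans ?_
  refine (Finset.sum_le_card_nsmul _ _ ε fun p hp => ?_).trans_eq (by simp)
  rw [euclNorm_smul]
  exact (mul_le_of_le_one_right (abs_nonneg _) (alg.φ.norm_le _)).trans (hc p hp)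

/-- Self-normalized bound of the noise for a value function from the grid. -/
theorem noise_quad_le {D : Observations S A M} {m : Fin M} {t j h N q : ℕ} {V : S → ℝ} {L ℓ : ℝ}
    (hL : 0 < L) (hV : Measurable V) (hVL : ∀ x, V x ∈ Set.Icc 0 L) (hL1 : 1 ≤ L)
    (hN : (avail m t j).card ≤ N) (hq : 0 < q)
    (hq2 : L ^ 2 / 2 * ((N + 1) * (d * (1 / (q : ℝ) * (1 / q)))) ≤ 1)
    (hctrl : ∀ c ∈ intBox (Fin d) (N * q),
      (fun i => (c i : ℝ) / q) ⬝ᵥ alg.noise E D m t j h V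
      - L ^ 2 / 2 * ∑ p ∈ avail m t j, (alg.feat D h p.1 p.2 ⬝ᵥ (fun i => (c i : ℝ) / q)) ^ 2 < ℓ) :
    alg.noise E D m t j h V ⬝ᵥ
      ((regGram (fun p : Fin M × ℕ => alg.feat D h p.1 p.2) (avail m t j))⁻¹ *ᵥ
        alg.noise E D m t j h V) ≤ L ^ 2 * (2 * (ℓ + 1)) := by
  set v := fun p : Fin M × ℕ => alg.feat D h p.1 p.2 with hv
  set G := regGram v (avail m t j) with hG
  set s := alg.noise E D m t j h V with hs
  have hGp : G.PosDef := posDef_regGram _ _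
  have hsn : euclNorm s ≤ N * L := by
    refine (euclNorm_sum_smul_feat_le fun p _ => abs_deviation_le hV hVL p).trans ?_
    gcongr
  -- This `x` maximizes `θ·s - (L² / 2) θ·Gθ`, with maximum `s·G⁻¹s / (2 L²)`. A nearby grid point
  -- loses `(L² / 2) (x - θ)·G(x - θ)`, at most one by `hq2`.
  set x : Fin d → ℝ := (L ^ 2)⁻¹ • (G⁻¹ *ᵥ s) with hx
  have hxN : ∀ i, |x i| ≤ N := by
    intro i
    have h1 : |(G⁻¹ *ᵥ s) i| ≤ N * L :=
      (abs_apply_le_euclNorm _ i).trans ((euclNorm_inv_regGram_le v _ s).trans hsn)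
    rw [hx, Pi.smul_apply, smul_eq_mul, abs_mul, abs_of_pos (by positivity),
      inv_mul_le_iff₀ (by positivity)]
    refine h1.trans ?_
    have : (N : ℝ) * L ≤ N * (L * L) := by gcongr; nlinarith
    linarith
  obtain ⟨c, hc, hcx⟩ := exists_intBox_near hq hxN
  have h1 := hctrl c hc
  set θ : Fin d → ℝ := fun i => (c i : ℝ) / q with hθ
  have h2 := hGp.two_mul_dotProduct_sub_add ((L ^ 2)⁻¹ • s) θ
  have h3 : θ - G⁻¹ *ᵥ ((L ^ 2)⁻¹ • s) = -(x - θ) := by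
    rw [Matrix.mulVec_smul, hx]; abel
  rw [h3, Matrix.mulVec_neg, neg_dotProduct_neg, Matrix.mulVec_smul, smul_dotProduct,
    smul_dotProduct, dotProduct_smul, smul_eq_mul, smul_eq_mul, smul_eq_mul] at h2
  have h4 : (x - θ) ⬝ᵥ (G *ᵥ (x - θ)) ≤ (N + 1) * (d * (1 / (q : ℝ) * (1 / q))) := by
    refine (dotProduct_regGram_le (v := v) (feat_dotProduct_self_le D h) _ _).trans ?_
    have h5 := abs_dotProduct_le_card_mul (by positivity) hcx hcx
    have h6 := (le_abs_self _).trans h5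
    have h7 : ((avail m t j).card : ℝ) ≤ N := by exact_mod_cast hN
    exact mul_le_mul (by linarith) h6 (dotProduct_self_nonneg' _) (by positivity)
  have h8 : θ ⬝ᵥ (G *ᵥ θ) ≥ ∑ p ∈ avail m t j, (v p ⬝ᵥ θ) ^ 2 := by
    rw [hG, dotProduct_regGram]
    linarith [dotProduct_self_nonneg' θ]
  have h9 : s ⬝ᵥ (G⁻¹ *ᵥ s) = L ^ 2 * (2 * (θ ⬝ᵥ s - L ^ 2 / 2 * (θ ⬝ᵥ (G *ᵥ θ))
      + L ^ 2 / 2 * ((x - θ) ⬝ᵥ (G *ᵥ (x - θ))))) := by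
    have hL2 : L ^ 2 ≠ 0 := by positivity
    rw [dotProduct_comm s θ] at h2
    have : s ⬝ᵥ (G⁻¹ *ᵥ s) = L ^ 2 * L ^ 2 * ((L ^ 2)⁻¹ * ((L ^ 2)⁻¹ * (s ⬝ᵥ (G⁻¹ *ᵥ s)))) := by
      field_simp
    rw [this, ← h2]
    field_simp
  rw [h9]
  have h10 := mul_le_mul_of_nonneg_left h4 (show 0 ≤ L ^ 2 / 2 by positivity)
  have h11 := mul_le_mul_of_nonneg_left h8 (show 0 ≤ L ^ 2 / 2 by positivity)
  refine mul_le_mul_of_nonneg_left ?_ (sq_nonneg L)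
  linarith

/-- Self-normalized bound of the noise for all value functions of the class. -/
theorem NoiseControlled.abs_dotProduct_noise_le {D : Observations S A M} {R : ℕ} {ℓ : ℝ}
    (hctrl : NoiseControlled alg E T R ℓ D) (hd : 0 < d) (hM : 0 < M) (hT : 0 < T)
    (hH : 0 < alg.H) (m : Fin M) {t : ℕ} (ht : t ∈ Finset.Icc 1 T) {j : ℕ} (hj : j < T) {h : ℕ}
    (hh : h ∈ Finset.Icc 1 alg.H) {w : Fin d → ℝ} {B : Matrix (Fin d) (Fin d) ℝ}
    (hw : ∀ i, |w i| ≤ R) (hB : ∀ i i', |B i i'| ≤ R) (u : Fin d → ℝ) :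
    |u ⬝ᵥ ((regGram (fun p : Fin M × ℕ => alg.feat D h p.1 p.2) (avail m t j))⁻¹ *ᵥ
        alg.noise E D m t j h (classValue alg.φ ((alg.H : ℝ) - h) w B))|
      ≤ √(u ⬝ᵥ ((regGram (fun p : Fin M × ℕ => alg.feat D h p.1 p.2) (avail m t j))⁻¹ *ᵥ u))
        * (alg.H * √(2 * (ℓ + 1)) + 4) := by
  have hd1 : (1 : ℝ) ≤ d := by exact_mod_cast hd
  have hM1 : (1 : ℝ) ≤ M := by exact_mod_cast hM
  have hT1 : (1 : ℝ) ≤ T := by exact_mod_cast hT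
  have hH1 : (1 : ℝ) ≤ alg.H := by exact_mod_cast hH
  have hMT1 : (1 : ℝ) ≤ M * T := by nlinarith
  -- The mesh `(dMT)⁻²` has square root `(dMT)⁻¹`, which brings the approximating value function
  -- within `2 / (MT)`.
  have hq : 0 < (d * M * T) ^ 2 := by positivity
  obtain ⟨a, ha, haw⟩ := exists_intBox_near hq hw
  obtain ⟨b, hb, hbB⟩ := exists_intBox_near (x := fun p : Fin d × Fin d => B p.1 p.2) hq
    fun p => hB p.1 p.2
  set L : ℝ := (alg.H : ℝ) - h with hLdef
  have hL0 : 0 ≤ L := by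
    have : (h : ℝ) ≤ alg.H := by exact_mod_cast (Finset.mem_Icc.1 hh).2
    linarith
  have hLH : L ≤ alg.H := by
    have : (0 : ℝ) ≤ h := Nat.cast_nonneg h
    linarith
  set V := classValue alg.φ L w B with hV
  set V' := classValue alg.φ L (fun i => (a i : ℝ) / ((d * M * T) ^ 2 : ℕ))
    (fun i i' => (b (i, i') : ℝ) / ((d * M * T) ^ 2 : ℕ)) with hV'
  have hVm : Measurable V := measurable_classValue _ _ _ _
  have hVm' : Measurable V' := measurable_classValue _ _ _ _
  have hVL : ∀ x, V x ∈ Set.Icc 0 L := classValue_mem _ hL0 _ _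
  have hVL' : ∀ x, V' x ∈ Set.Icc 0 L := classValue_mem _ hL0 _ _
  have hVH' : ∀ x, V' x ∈ Set.Icc 0 (alg.H : ℝ) := fun x =>
    ⟨(hVL' x).1, (hVL' x).2.trans hLH⟩
  have hcard : (avail m t j).card ≤ M * T :=
    card_avail_le (by rw [Finset.mem_Icc] at ht; omega)
  have hcard' : ((avail m t j).card : ℝ) ≤ M * T := by exact_mod_cast hcard
  have hVV : ∀ x, |V x - V' x| ≤ 2 / (M * T) := by
    intro x
    refine (abs_classValue_sub_le alg.φ L haw (fun i i' => hbB (i, i')) x).trans ?_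
    push_cast
    have h1 : √(1 / ((d : ℝ) * M * T) ^ 2) = 1 / (d * M * T) := by
      rw [Real.sqrt_div zero_le_one, Real.sqrt_one, Real.sqrt_sq (by positivity)]
    rw [h1]
    have h2 : (d : ℝ) * (1 / (d * M * T)) = 1 / (M * T) := by field_simp
    have h3 : (d : ℝ) * (1 / (d * M * T) ^ 2) ≤ 1 / (M * T) := by
      have : (d : ℝ) * (1 / (d * M * T) ^ 2) = 1 / (M * T) * (1 / (d * (M * T))) := by
        field_simp
      rw [this]
      refine mul_le_of_le_one_right (by positivity) ?_
      rw [div_le_one (by positivity)]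
      nlinarith
    rw [h2]
    have h4 : 2 / ((M : ℝ) * T) = 1 / (M * T) + 1 / (M * T) := by ring
    linarith
  set v := fun p : Fin M × ℕ => alg.feat D h p.1 p.2 with hv
  -- The range is taken as `H` instead of `H - h`, which vanishes in the last step.
  have hquad := noise_quad_le (alg := alg) (E := E) (D := D) (m := m) (t := t) (j := j) (h := h)
    (N := M * T) (q := alg.H * M * T * d) (V := V') (L := alg.H) (ℓ := ℓ) (by linarith) hVm' hVH'
    hH1 hcard (by positivity) (by
      push_cast
      have : (alg.H : ℝ) ^ 2 / 2 * (((M : ℝ) * T + 1) * (d * (1 / (alg.H * M * T * d) *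
          (1 / (alg.H * M * T * d))))) = (M * T + 1) / 2 * (1 / (M * T)) * (1 / (d * (M * T))) := by
        field_simp
      rw [this]
      have h1 : ((M : ℝ) * T + 1) / 2 * (1 / (M * T)) ≤ 1 := by
        rw [mul_one_div, div_le_one (by positivity)]
        linarith
      have h2 : 1 / ((d : ℝ) * (M * T)) ≤ 1 := by
        rw [div_le_one (by positivity)]
        nlinarith
      exact mul_le_one₀ h1 (by positivity) h2)
    (fun c hc => hctrl m t ht j (Finset.mem_range.2 hj) h hh a ha b hb c hc)
  -- At most `MT` summands, each changed by at most twice `2 / (MT)`.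
  have hdiff : euclNorm (alg.noise E D m t j h V - alg.noise E D m t j h V') ≤ 4 := by
    rw [noise, noise, ← Finset.sum_sub_distrib]
    simp only [← sub_smul]
    refine (euclNorm_sum_smul_feat_le fun p _ =>
      abs_deviation_sub_le hVm hVm' hVL hVL' hVV p).trans ?_
    refine (mul_le_mul_of_nonneg_right hcard' (by positivity)).trans_eq ?_
    field_simp
    norm_num
  have hsplit : alg.noise E D m t j h V
      = alg.noise E D m t j h V' + (alg.noise E D m t j h V - alg.noise E D m t j h V') := by
    abel
  rw [hsplit, Matrix.mulVec_add, dotProduct_add]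
  refine (abs_add_le _ _).trans ?_
  rw [mul_add]
  refine add_le_add ?_ ?_
  · refine ((posDef_regGram v _).abs_dotProduct_inv_mulVec_le u _).trans ?_
    refine mul_le_mul_of_nonneg_left ?_ (Real.sqrt_nonneg _)
    refine (Real.sqrt_le_sqrt hquad).trans_eq ?_
    rw [Real.sqrt_mul (sq_nonneg _), Real.sqrt_sq (by positivity)]
  · exact (abs_dotProduct_inv_regGram_le v _ u _).trans
      (mul_le_mul_of_nonneg_left hdiff (Real.sqrt_nonneg _))

end CoopLSVI

/-- Ridge regression with small labels: the weighted norm of the right-hand side. -/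
theorem sum_smul_quad_le {ι n : Type*} [Fintype n] [DecidableEq n] (v : ι → n → ℝ) (s : Finset ι)
    (e : ι → ℝ) : (∑ i ∈ s, e i • v i) ⬝ᵥ ((regGram v s)⁻¹ *ᵥ ∑ i ∈ s, e i • v i)
      ≤ ∑ i ∈ s, e i ^ 2 := by
  set x := ∑ i ∈ s, e i • v i with hx
  set y := (regGram v s)⁻¹ *ᵥ x with hy
  have h1 : y ⬝ᵥ (regGram v s *ᵥ y) = x ⬝ᵥ y := by
    rw [hy, (posDef_regGram v s).mulVec_inv_mulVec, dotProduct_comm]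
  rw [dotProduct_regGram] at h1
  have h2 : x ⬝ᵥ y = ∑ i ∈ s, e i * (v i ⬝ᵥ y) := by
    rw [hx, sum_dotProduct]
    simp only [smul_dotProduct, smul_eq_mul]
  -- The sum of `(v i ⬝ᵥ y)²` is at most `x ⬝ᵥ y` by `h1`, so one of the two copies of `x ⬝ᵥ y` is
  -- absorbed.
  have h3 : ∑ i ∈ s, 2 * (e i * (v i ⬝ᵥ y)) ≤ ∑ i ∈ s, (e i ^ 2 + (v i ⬝ᵥ y) ^ 2) :=
    Finset.sum_le_sum fun i _ => by nlinarith [sq_nonneg (e i - v i ⬝ᵥ y)]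
  rw [Finset.sum_add_distrib, ← Finset.mul_sum, ← h2] at h3
  linarith [dotProduct_self_nonneg' y]

theorem abs_inv_regGram_apply_le {ι n : Type*} [Fintype n] [DecidableEq n] (v : ι → n → ℝ)
    (s : Finset ι) (i j : n) : |(regGram v s)⁻¹ i j| ≤ 1 := by
  have h := (posDef_regGram v s).abs_dotProduct_inv_mulVec_le (Pi.single i 1) (Pi.single j 1)
  have h1 : ∀ i : n, √(Pi.single i 1 ⬝ᵥ ((regGram v s)⁻¹ *ᵥ Pi.single i 1)) ≤ 1 := fun i =>
    Real.sqrt_le_one.2 ((dotProduct_inv_regGram_le v s _).trans (by simp))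
  have h2 : Pi.single i 1 ⬝ᵥ ((regGram v s)⁻¹ *ᵥ Pi.single j 1) = (regGram v s)⁻¹ i j := by simp
  rw [h2] at h
  exact h.trans (mul_le_one₀ (h1 i) (Real.sqrt_nonneg _) (h1 j))

/-! ### Confidence intervals and optimism -/

namespace CoopLSVI

variable {S A : Type*} [MeasurableSpace S] [MeasurableSpace A] {M d : ℕ}
  {alg : CoopLSVI S A M d} {E : Fin M → EpisodicMDP S A} {T : ℕ} [Fintype A] [Nonempty A]
  {D : Observations S A M}

/-- The width of the confidence interval of agent `m` at step `h` of episode `t`. -/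
def width (alg : CoopLSVI S A M d) (D : Observations S A M) (m : Fin M) (t k h : ℕ) (z : S × A) :
    ℝ :=
  √(alg.φ.toFun z ⬝ᵥ ((alg.gram D m t k h)⁻¹ *ᵥ alg.φ.toFun z))

/-- Every target is the prediction of agent `m`'s linear weight `w`, plus the discrepancy `e`
between the agents, plus noise. The regression error thus consists of the ridge bias `G⁻¹ w`, the
heterogeneity and the noise, each bounded by Cauchy–Schwarz in the inverse Gram norm. -/
theorem abs_regression_sub_le (hlam : alg.lam = 1) (hE : ∀ m, (E m).IsLinear alg.H alg.φ) {ξ : ℝ}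
    (hξ : 0 ≤ ξ) (hdev : EpisodicMDP.SmallDeviation E alg.H ξ)
    (hrew : ∀ t ∈ Finset.Icc 1 T, ∀ m, ∀ h ∈ Finset.Icc 1 alg.H,
      D.reward t m h = (E m).reward h (D.state t m h, D.action t m h))
    (m : Fin M) {t k h : ℕ} (ht : t ∈ Finset.Icc 1 T) (hh : h ∈ Finset.Icc 1 alg.H)
    {V : S → ℝ} (hV : Measurable V) {L : ℝ} (hL : 0 ≤ L) (hVL : ∀ x, V x ∈ Set.Icc 0 L) {c : ℝ}
    (hnoise : ∀ u : Fin d → ℝ, |u ⬝ᵥ ((alg.gram D m t k h)⁻¹ *ᵥ alg.noise E D m t k h V)|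
      ≤ √(u ⬝ᵥ ((alg.gram D m t k h)⁻¹ *ᵥ u)) * c) (z : S × A) :
    |alg.φ.toFun z ⬝ᵥ ((alg.gram D m t k h)⁻¹ *ᵥ alg.bias D m t k h V)
        - ((E m).reward h z + ∫ y, V y ∂((E m).transition h z))|
      ≤ ((1 + L) * √d + c + (1 + L) * ξ * √(M * T)) * alg.width D m t k h z := by
  obtain ⟨w, hw, hwz⟩ := (hE m).exists_integral_eq hh hV hL hVL
  set v := fun p : Fin M × ℕ => alg.feat D h p.1 p.2 with hv
  set zp := fun p : Fin M × ℕ => (D.state p.2 p.1 h, D.action p.2 p.1 h) with hzp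
  set e := fun p : Fin M × ℕ => ((E p.1).reward h (zp p) + ∫ y, V y ∂((E p.1).transition h (zp p)))
    - ((E m).reward h (zp p) + ∫ y, V y ∂((E m).transition h (zp p))) with he
  have he1 : ∀ p, |e p| ≤ (1 + L) * ξ := by
    intro p
    have h1 := hdev p.1 m h hh (zp p)
    have h2 := abs_integral_sub_le_tvDist ((E p.1).transition h (zp p))
      ((E m).transition h (zp p)) hV hL hVL
    have h3 := mul_le_mul_of_nonneg_left h1.1 hL
    calc |e p| = |((E p.1).reward h (zp p) - (E m).reward h (zp p))
          + (∫ y, V y ∂((E p.1).transition h (zp p)) - ∫ y, V y ∂((E m).transition h (zp p)))| := by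
          rw [he]; ring_nf
      _ ≤ _ := (abs_add_le _ _).trans (by linarith [h1.2])
  have hG := gram_eq_regGram hlam D m t k h
  -- Subtracting `w` removes the contribution of the regularizer.
  have hbias : alg.bias D m t k h V = regGram v (avail m t k) *ᵥ w - w
      + ∑ p ∈ avail m t k, e p • v p + alg.noise E D m t k h V := by
    rw [regGram_mulVec, add_sub_cancel_right, bias, noise, ← Finset.sum_add_distrib,
      ← Finset.sum_add_distrib]
    refine Finset.sum_congr rfl fun p hp => ?_
    have hp' := mem_Ico_of_mem_avail hp
    have hpT : p.2 ∈ Finset.Icc 1 T := by rw [Finset.mem_Icc, Finset.mem_Ico] at *; omega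
    rw [← add_smul, ← add_smul, hrew p.2 hpT p.1 h hh, deviation]
    congr 1
    have h1 : v p ⬝ᵥ w = (E m).reward h (zp p) + ∫ y, V y ∂((E m).transition h (zp p)) :=
      (hwz (zp p)).symm
    rw [h1, he]
    ring
  rw [hG] at hnoise ⊢
  set G := regGram v (avail m t k) with hGdef
  have hGp : G.PosDef := posDef_regGram _ _
  set u := alg.φ.toFun z with hu
  set es := ∑ p ∈ avail m t k, e p • v p with hes
  have hcalc : u ⬝ᵥ (G⁻¹ *ᵥ alg.bias D m t k h V)
      - ((E m).reward h z + ∫ y, V y ∂((E m).transition h z))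
      = -(u ⬝ᵥ (G⁻¹ *ᵥ w)) + u ⬝ᵥ (G⁻¹ *ᵥ es) + u ⬝ᵥ (G⁻¹ *ᵥ alg.noise E D m t k h V) := by
    rw [hbias, hwz z, Matrix.mulVec_add, Matrix.mulVec_add, Matrix.mulVec_sub,
      hGp.inv_mulVec_mulVec, dotProduct_add, dotProduct_add, dotProduct_sub]
    ring
  have hwidth : alg.width D m t k h z = √(u ⬝ᵥ (G⁻¹ *ᵥ u)) := by rw [width, hG]
  have h1 : |u ⬝ᵥ (G⁻¹ *ᵥ w)| ≤ √(u ⬝ᵥ (G⁻¹ *ᵥ u)) * ((1 + L) * √d) :=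
    (abs_dotProduct_inv_regGram_le v _ u w).trans
      (mul_le_mul_of_nonneg_left hw (Real.sqrt_nonneg _))
  have h2 : |u ⬝ᵥ (G⁻¹ *ᵥ es)| ≤ √(u ⬝ᵥ (G⁻¹ *ᵥ u)) * ((1 + L) * ξ * √(M * T)) := by
    refine (hGp.abs_dotProduct_inv_mulVec_le u es).trans
      (mul_le_mul_of_nonneg_left ?_ (Real.sqrt_nonneg _))
    refine Real.sqrt_le_iff.2 ⟨by positivity, (sum_smul_quad_le v _ e).trans ?_⟩
    refine (Finset.sum_le_card_nsmul _ _ (((1 + L) * ξ) ^ 2) fun p _ =>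
      sq_le_sq' (by linarith [(abs_le.1 (he1 p)).1]) (abs_le.1 (he1 p)).2).trans ?_
    rw [nsmul_eq_mul, mul_pow _ √(M * T : ℝ), Real.sq_sqrt (by positivity), mul_comm]
    refine mul_le_mul_of_nonneg_left ?_ (sq_nonneg _)
    have := card_avail_le (M := M) (m := m) (t := t) (k := k) (T := T)
      (by rw [Finset.mem_Icc] at ht; omega)
    exact_mod_cast this
  rw [hcalc, hwidth]
  have h3 := abs_add_le (-(u ⬝ᵥ (G⁻¹ *ᵥ w)) + u ⬝ᵥ (G⁻¹ *ᵥ es))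
    (u ⬝ᵥ (G⁻¹ *ᵥ alg.noise E D m t k h V))
  have h4 := abs_add_le (-(u ⬝ᵥ (G⁻¹ *ᵥ w))) (u ⬝ᵥ (G⁻¹ *ᵥ es))
  rw [abs_neg] at h4
  linarith [hnoise u]

theorem qEst_le_greedy (D : Observations S A M) (m : Fin M) (t k h : ℕ) (x : S) (b : A) :
    alg.qEst D m t k h (x, b) ≤ alg.qEst D m t k h (x, alg.greedy D m t k h x) := by
  classical
  have hne : (Finset.univ.filter (fun a => ∀ b, alg.qEst D m t k h (x, b)
      ≤ alg.qEst D m t k h (x, a))).Nonempty := by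
    obtain ⟨a, ha⟩ := Finite.exists_max fun a => alg.qEst D m t k h (x, a)
    exact ⟨a, by simpa using ha⟩
  have := alg.tie_mem t m h _ hne
  rw [Finset.mem_filter] at this
  have h2 := this.2 b
  rw [greedy]
  convert! h2

theorem vEst_succ_eq (D : Observations S A M) (m : Fin M) (t k : ℕ) {j : ℕ} (hj : j < alg.H)
    (x : S) : alg.vEst D m t k (j + 1) x = alg.qStep D m t k (alg.H - j) (alg.vEst D m t k j)
      (x, alg.greedy D m t k (alg.H - j) x) := by
  have hq : ∀ z, alg.qEst D m t k (alg.H - j) z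
      = alg.qStep D m t k (alg.H - j) (alg.vEst D m t k j) z := fun z => by
    rw [qEst, Nat.sub_sub_self hj.le]
  rw [vEst]
  refine le_antisymm (Finset.sup'_le _ _ fun a _ => ?_)
    (Finset.le_sup' (fun a => alg.qStep D m t k (alg.H - j) (alg.vEst D m t k j) (x, a))
      (Finset.mem_univ _))
  rw [← hq, ← hq]
  exact qEst_le_greedy D m t k _ x a

/-- The algorithm does not cut at zero but the class does; this reconciles them once the estimate is
known to be nonnegative. -/
theorem sup'_max_zero {ι : Type*} {s : Finset ι} (hs : s.Nonempty) (f : ι → ℝ)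
    (h0 : 0 ≤ s.sup' hs f) : s.sup' hs (fun i => max 0 (f i)) = s.sup' hs f := by
  refine le_antisymm (Finset.sup'_le _ _ fun i hi => max_le h0 (Finset.le_sup' f hi))
    (Finset.sup'_le _ _ fun i hi => (le_max_right 0 (f i)).trans
      (Finset.le_sup' (fun i => max 0 (f i)) hi))

/-- The assumptions under which the value estimates are optimistic: all deterministic properties of
the observations, the bonus `b`, and the control of the noise. -/
structure Regular (alg : CoopLSVI S A M d) (E : Fin M → EpisodicMDP S A) (T R : ℕ) (ℓ b ξ : ℝ)
    (D : Observations S A M) : Prop where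
  lam : alg.lam = 1
  linear : ∀ m, (E m).IsLinear alg.H alg.φ
  nonneg : 0 ≤ ξ
  deviation : EpisodicMDP.SmallDeviation E alg.H ξ
  reward : ∀ t ∈ Finset.Icc 1 T, ∀ m, ∀ h ∈ Finset.Icc 1 alg.H,
    D.reward t m h = (E m).reward h (D.state t m h, D.action t m h)
  bonus : ∀ t m h, alg.β t m h = b
  bonus_ge : 2 * alg.H * √d + (alg.H * √(2 * (ℓ + 1)) + 4) + 2 * alg.H * ξ * √(M * T) ≤ b
  range_weight : alg.H * (M * T) ≤ R
  range_bonus : b ^ 2 ≤ R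
  noise : NoiseControlled alg E T R ℓ D
  dim_pos : 0 < d
  agents_pos : 0 < M
  episodes_pos : 0 < T
  horizon_pos : 0 < alg.H

namespace Regular

variable {R : ℕ} {ℓ b ξ : ℝ} {m : Fin M} {t k : ℕ}

theorem bonus_nonneg (hr : Regular alg E T R ℓ b ξ D) : 0 ≤ b := by
  have := hr.nonneg
  exact le_trans (by positivity) hr.bonus_ge

/-- The three summands of `bonus_ge` dominate the ridge bias, the noise and the heterogeneity,
respectively. -/
theorem abs_regression_le (hr : Regular alg E T R ℓ b ξ D) (ht : t ∈ Finset.Icc 1 T) (hk : k < T)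
    {j : ℕ} (hj : j < alg.H) {V : S → ℝ} {w : Fin d → ℝ} {B : Matrix (Fin d) (Fin d) ℝ}
    (hw : ∀ i, |w i| ≤ R) (hB : ∀ i i', |B i i'| ≤ R) (hVwB : V = classValue alg.φ j w B)
    (z : S × A) :
    |alg.φ.toFun z ⬝ᵥ ((alg.gram D m t k (alg.H - j))⁻¹ *ᵥ alg.bias D m t k (alg.H - j) V)
        - ((E m).reward (alg.H - j) z + ∫ y, V y ∂((E m).transition (alg.H - j) z))|
      ≤ b * alg.width D m t k (alg.H - j) z := by
  have hh : alg.H - j ∈ Finset.Icc 1 alg.H := by rw [Finset.mem_Icc]; omega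
  have hcast : (alg.H : ℝ) - ((alg.H - j : ℕ) : ℝ) = j := by
    rw [Nat.cast_sub hj.le]; ring
  have hj0 : (0 : ℝ) ≤ j := Nat.cast_nonneg j
  have hjH : (1 : ℝ) + j ≤ alg.H := by
    have : j + 1 ≤ alg.H := hj
    have : ((j + 1 : ℕ) : ℝ) ≤ alg.H := by exact_mod_cast this
    push_cast at this; linarith
  have h1 := abs_regression_sub_le (D := D) hr.lam hr.linear hr.nonneg hr.deviation hr.reward m ht
    (k := k) hh (V := V) (hVwB ▸ measurable_classValue alg.φ _ w B) hj0
    (hVwB ▸ classValue_mem alg.φ hj0 w B) (c := alg.H * √(2 * (ℓ + 1)) + 4) (fun u => by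
      have := hr.noise.abs_dotProduct_noise_le hr.dim_pos hr.agents_pos hr.episodes_pos
        hr.horizon_pos m ht hk hh hw hB u
      rw [hcast, ← hVwB, ← gram_eq_regGram hr.lam] at this
      exact this) z
  refine h1.trans (mul_le_mul_of_nonneg_right (le_trans ?_ hr.bonus_ge) (Real.sqrt_nonneg _))
  have h0 : (0 : ℝ) ≤ alg.H := Nat.cast_nonneg _
  have hξ := hr.nonneg
  have h2 : (1 + (j : ℝ)) * √d ≤ 2 * alg.H * √d :=
    mul_le_mul_of_nonneg_right (by linarith) (Real.sqrt_nonneg _)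
  have h3 : (1 + (j : ℝ)) * ξ * √(M * T) ≤ 2 * alg.H * ξ * √(M * T) :=
    mul_le_mul_of_nonneg_right (mul_le_mul_of_nonneg_right (by linarith) hξ) (Real.sqrt_nonneg _)
  linarith

/-- The value estimates are optimistic, bounded, and of the form covered by the control of the
noise. -/
theorem vEst_spec (hr : Regular alg E T R ℓ b ξ D) (ht : t ∈ Finset.Icc 1 T) (hk : k < T) {j : ℕ}
    (hj : j ≤ alg.H) :
    (∀ π x, (E m).value alg.H π (alg.H + 1 - j) x ≤ alg.vEst D m t k j x) ∧
    ∃ (w : Fin d → ℝ) (B : Matrix (Fin d) (Fin d) ℝ), (∀ i, |w i| ≤ R) ∧ (∀ i i', |B i i'| ≤ R) ∧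
      alg.vEst D m t k j = classValue alg.φ j w B := by
  -- The two claims support each other: membership in the class gives noise control at the next
  -- step, hence optimism, and optimism gives the nonnegativity needed for membership.
  induction j with
  | zero =>
    refine ⟨fun π x => ?_, 0, 0, by simp, by simp, ?_⟩
    · rw [Nat.sub_zero, EpisodicMDP.value_top]; rfl
    · funext x
      simp [classValue, vEst, Finset.sup'_const]
  | succ j ih =>
    have hjH : j < alg.H := hj
    obtain ⟨hopt, w, B, hw, hB, hV⟩ := ih (by omega)
    set V := alg.vEst D m t k j with hVdef
    have hj0 : (0 : ℝ) ≤ j := Nat.cast_nonneg j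
    have hVm : Measurable V := hV ▸ measurable_classValue alg.φ _ w B
    have hVL : ∀ x, V x ∈ Set.Icc (0 : ℝ) j := hV ▸ classValue_mem alg.φ hj0 w B
    have hreg := hr.abs_regression_le (m := m) (k := k) ht hk hjH hw hB hV
    have hcast : (alg.H : ℝ) - ((alg.H - j : ℕ) : ℝ) + 1 = j + 1 := by
      rw [Nat.cast_sub hjH.le]; ring
    have hq : ∀ z, alg.qStep D m t k (alg.H - j) V z = min (alg.φ.toFun z ⬝ᵥ
        ((alg.gram D m t k (alg.H - j))⁻¹ *ᵥ alg.bias D m t k (alg.H - j) V)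
        + b * alg.width D m t k (alg.H - j) z) (j + 1) := fun z => by
      rw [qStep, hr.bonus, hcast, width]
    have hbell : ∀ z, (E m).reward (alg.H - j) z + ∫ y, V y ∂((E m).transition (alg.H - j) z)
        ≤ alg.qStep D m t k (alg.H - j) V z := by
      intro z
      rw [hq, le_min_iff]
      constructor
      · linarith [(abs_le.1 (hreg z)).1]
      · have h1 := ((E m).reward_mem (alg.H - j) z).2
        have h2 := (integral_mem_Icc_of_forall (μ := (E m).transition (alg.H - j) z) hVm hVL).2
        linarith
    have hsup : ∀ x a, alg.qStep D m t k (alg.H - j) V (x, a) ≤ alg.vEst D m t k (j + 1) x :=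
      fun x a => Finset.le_sup' (fun a => alg.qStep D m t k (alg.H - j) V (x, a))
        (Finset.mem_univ a)
    have hidx : alg.H + 1 - (j + 1) = alg.H - j := by omega
    have hidx' : alg.H - j + 1 = alg.H + 1 - j := by omega
    have hopt' : ∀ π x, (E m).value alg.H π (alg.H + 1 - (j + 1)) x
        ≤ alg.vEst D m t k (j + 1) x := by
      intro π x
      rw [hidx, (E m).value_bellman π (by omega)]
      have hpt : ∀ a, (E m).reward (alg.H - j) (x, a) + ∫ y, (E m).value alg.H π (alg.H - j + 1) y
          ∂((E m).transition (alg.H - j) (x, a)) ≤ alg.vEst D m t k (j + 1) x := by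
        intro a
        refine le_trans ?_ ((hbell (x, a)).trans (hsup x a))
        gcongr
        · exact integrable_of_mem_Icc ((E m).measurable_value π _ _) ((E m).value_mem π _ _)
        · exact integrable_of_mem_Icc hVm hVL
        · rw [hidx']; exact fun y => hopt π y
      have hmeas : Measurable fun a => (E m).reward (alg.H - j) (x, a)
          + ∫ y, (E m).value alg.H π (alg.H - j + 1) y
            ∂((E m).transition (alg.H - j) (x, a)) := by
        have h1 : Measurable fun z => ∫ y, (E m).value alg.H π (alg.H - j + 1) y
            ∂((E m).transition (alg.H - j) z) :=
          (StronglyMeasurable.integral_kernel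
            ((E m).measurable_value π _ _).stronglyMeasurable).measurable
        exact (((E m).measurable_reward _).comp measurable_prodMk_left).add
          (h1.comp measurable_prodMk_left)
      have hbd : ∀ a, (E m).reward (alg.H - j) (x, a)
          + ∫ y, (E m).value alg.H π (alg.H - j + 1) y ∂((E m).transition (alg.H - j) (x, a))
          ∈ Set.Icc 0 (alg.vEst D m t k (j + 1) x) := fun a =>
        ⟨add_nonneg ((E m).reward_mem _ _).1
          (integral_nonneg fun y => ((E m).value_mem π _ _ y).1), hpt a⟩
      exact (integral_mem_Icc_of_forall hmeas hbd).2
    -- The bonus `b √(φ·Λ⁻¹φ)` is the square root of a quadratic form with matrix `b² Λ⁻¹`.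
    refine ⟨hopt', (alg.gram D m t k (alg.H - j))⁻¹ *ᵥ alg.bias D m t k (alg.H - j) V,
      b ^ 2 • (alg.gram D m t k (alg.H - j))⁻¹, ?_, ?_, ?_⟩
    · intro i
      rw [gram_eq_regGram hr.lam]
      refine (abs_apply_le_euclNorm _ i).trans ((euclNorm_inv_regGram_le _ _ _).trans ?_)
      have hlab : ∀ p ∈ avail m t k, |D.reward p.2 p.1 (alg.H - j)
          + V (D.state p.2 p.1 (alg.H - j + 1))| ≤ alg.H := by
        intro p hp
        have hp' := mem_Ico_of_mem_avail hp
        have hpT : p.2 ∈ Finset.Icc 1 T := by rw [Finset.mem_Icc, Finset.mem_Ico] at *; omega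
        rw [hr.reward p.2 hpT p.1 _ (by rw [Finset.mem_Icc]; omega)]
        have h1 := (E p.1).reward_mem (alg.H - j)
          (D.state p.2 p.1 (alg.H - j), D.action p.2 p.1 (alg.H - j))
        have h2 := hVL (D.state p.2 p.1 (alg.H - j + 1))
        have h3 : ((j + 1 : ℕ) : ℝ) ≤ alg.H := by exact_mod_cast hj
        push_cast at h3
        rw [abs_of_nonneg (add_nonneg h1.1 h2.1)]
        linarith [h1.2, h2.2]
      refine (euclNorm_sum_smul_feat_le hlab).trans ?_
      have h4 := card_avail_le (M := M) (m := m) (t := t) (k := k) (T := T)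
        (by rw [Finset.mem_Icc] at ht; omega)
      have h5 : (avail m t k).card * alg.H ≤ R :=
        (Nat.mul_le_mul_right _ h4).trans ((mul_comm _ _).trans_le (by exact hr.range_weight))
      exact_mod_cast h5
    · intro i i'
      rw [gram_eq_regGram hr.lam, Matrix.smul_apply, smul_eq_mul, abs_mul, abs_of_nonneg (sq_nonneg b)]
      exact (mul_le_of_le_one_right (sq_nonneg b) (abs_inv_regGram_apply_le _ _ i i')).trans
        hr.range_bonus
    · funext x
      have h0 : 0 ≤ alg.vEst D m t k (j + 1) x :=
        ((E m).value_mem (alg.greedyPolicy D m t k) _ _ x).1.trans (hopt' _ x)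
      rw [vEst] at h0 ⊢
      rw [← hVdef] at h0 ⊢
      rw [← sup'_max_zero _ _ h0, classValue]
      refine Finset.sup'_congr _ rfl fun a _ => ?_
      rw [hq, Matrix.smul_mulVec, dotProduct_smul, smul_eq_mul, Real.sqrt_mul (sq_nonneg b),
        Real.sqrt_sq hr.bonus_nonneg, width]
      push_cast
      rfl

end Regular

end CoopLSVI

theorem measurable_integral_kernel_comp {Ω S Z : Type*} [MeasurableSpace Ω] [MeasurableSpace S]
    [MeasurableSpace Z] {κ : Kernel Z S} [IsMarkovKernel κ] {z : Ω → Z} (hz : Measurable z)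
    {f : Ω × S → ℝ} (hf : Measurable f) : Measurable fun ω => ∫ y, f (ω, y) ∂(κ (z ω)) :=
  (StronglyMeasurable.integral_kernel_prod_right' (κ := κ.comap z hz) hf.stronglyMeasurable).measurable

/-! ### Regret decomposition and Azuma–Hoeffding -/

namespace CoopLSVI

variable {S A : Type*} [MeasurableSpace S] [MeasurableSpace A] [DiscreteMeasurableSpace A] {M d : ℕ}
  {alg : CoopLSVI S A M d} {E : Fin M → EpisodicMDP S A} {T : ℕ} [Fintype A] [Nonempty A]

/-- The difference of the (truncated) value estimate and the value of the greedy policy, at step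
`h + 1`. -/
def gap (alg : CoopLSVI S A M d) (E : Fin M → EpisodicMDP S A) (D : Observations S A M) (m : Fin M)
    (t k h : ℕ) (y : S) : ℝ :=
  max 0 (min (alg.vEst D m t k (alg.H - h) y) alg.H)
    - (E m).value alg.H (alg.greedyPolicy D m t k) (h + 1) y

/-- The deviation of the gap after step `h` from its conditional expectation. -/
def gapNoise (alg : CoopLSVI S A M d) (E : Fin M → EpisodicMDP S A) (D : Observations S A M)
    (m : Fin M) (t k h : ℕ) : ℝ :=
  ∫ y, alg.gap E D m t k h y ∂((E m).transition h (D.state t m h, D.action t m h))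
    - alg.gap E D m t k h (D.state t m (h + 1))

theorem value_greedyPolicy (E : EpisodicMDP S A) (D : Observations S A M) (m : Fin M) (t k : ℕ)
    {h : ℕ} (hh : h ≤ alg.H) (x : S) :
    E.value alg.H (alg.greedyPolicy D m t k) h x
      = E.reward h (x, alg.greedy D m t k h x)
        + ∫ y, E.value alg.H (alg.greedyPolicy D m t k) (h + 1) y
          ∂(E.transition h (x, alg.greedy D m t k h x)) := by
  rw [E.value_bellman _ hh]
  simp only [greedyPolicy, Kernel.deterministic_apply]
  rw [integral_dirac]

/-- By optimism it suffices to compare the estimate with the value of the greedy policy. At a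
visited pair the estimate exceeds its Bellman backup by at most `2 b` widths; the backups differ by
the expected next gap, and exchanging this for the realized gap leaves `gapNoise`. -/
theorem Regular.episode_regret_le {D : Observations S A M} {R : ℕ} {ℓ b ξ : ℝ} {m : Fin M}
    {t k : ℕ} (hr : Regular alg E T R ℓ b ξ D) (ht : t ∈ Finset.Icc 1 T) (hk : k < T)
    (hact : ∀ h ∈ Finset.Icc 1 alg.H,
      D.action t m h = alg.greedy D m t k h (D.state t m h)) :
    (E m).optValue alg.H 1 (D.state t m 1)
      - (E m).value alg.H (alg.greedyPolicy D m t k) 1 (D.state t m 1)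
      ≤ ∑ h ∈ Finset.Icc 1 alg.H,
        (2 * b * alg.width D m t k h (D.state t m h, D.action t m h)
          + alg.gapNoise E D m t k h) := by
  set π := alg.greedyPolicy D m t k with hπ
  set f : ℕ → ℝ := fun h => 2 * b * alg.width D m t k h (D.state t m h, D.action t m h)
          + alg.gapNoise E D m t k h with hf
  have key : ∀ j ≤ alg.H, alg.vEst D m t k j (D.state t m (alg.H + 1 - j))
      - (E m).value alg.H π (alg.H + 1 - j) (D.state t m (alg.H + 1 - j))
      ≤ ∑ h ∈ Finset.Icc (alg.H + 1 - j) alg.H, f h := by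
    intro j hj
    induction j with
    | zero => simp [EpisodicMDP.value_top, vEst]
    | succ j ih =>
      have hjH : j < alg.H := hj
      have ih := ih (by omega)
      obtain ⟨-, w, B, hw, hB, hV⟩ := hr.vEst_spec (m := m) (k := k) ht hk hjH.le
      set V := alg.vEst D m t k j with hVdef
      have hj0 : (0 : ℝ) ≤ j := Nat.cast_nonneg j
      have hVm : Measurable V := hV ▸ measurable_classValue alg.φ _ w B
      have hVL : ∀ x, V x ∈ Set.Icc (0 : ℝ) j := hV ▸ classValue_mem alg.φ hj0 w B
      have hidx : alg.H + 1 - (j + 1) = alg.H - j := by omega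
      have hidx' : alg.H + 1 - j = alg.H - j + 1 := by omega
      rw [hidx' ] at ih
      rw [hidx]
      set h := alg.H - j with hh
      have hhm : h ∈ Finset.Icc 1 alg.H := by rw [Finset.mem_Icc]; omega
      -- On the regular event the truncation in `gap` is inactive.
      have hgap : ∀ y, alg.gap E D m t k h y = V y - (E m).value alg.H π (h + 1) y := by
        intro y
        have hjH' : (j : ℝ) ≤ alg.H := by exact_mod_cast hjH.le
        rw [gap, hh, Nat.sub_sub_self hjH.le, ← hVdef,
          min_eq_left ((hVL y).2.trans hjH'), max_eq_right (hVL y).1]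
      have hIcc : Finset.Icc h alg.H = insert h (Finset.Icc (h + 1) alg.H) := by
        ext i; rw [Finset.mem_insert, Finset.mem_Icc, Finset.mem_Icc]; omega
      rw [hIcc, Finset.sum_insert (by simp)]
      have hreg := abs_le.1 (hr.abs_regression_le (m := m) (k := k) ht hk hjH hw hB hV
        (D.state t m h, D.action t m h))
      have hv1 : alg.vEst D m t k (j + 1) (D.state t m h)
          ≤ alg.φ.toFun (D.state t m h, D.action t m h) ⬝ᵥ
            ((alg.gram D m t k h)⁻¹ *ᵥ alg.bias D m t k h V)
            + b * alg.width D m t k h (D.state t m h, D.action t m h) := by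
        rw [vEst_succ_eq D m t k hjH, ← hh, ← hact h hhm, qStep, hr.bonus]
        exact min_le_left _ _
      have hv2 := value_greedyPolicy (alg := alg) (E m) D m t k (h := h) (by omega)
        (D.state t m h)
      rw [← hact h hhm, ← hπ] at hv2
      have hnoise : alg.gapNoise E D m t k h
          = (∫ y, V y ∂((E m).transition h (D.state t m h, D.action t m h))
            - ∫ y, (E m).value alg.H π (h + 1) y
              ∂((E m).transition h (D.state t m h, D.action t m h)))
            - (V (D.state t m (h + 1)) - (E m).value alg.H π (h + 1) (D.state t m (h + 1))) := by
        rw [gapNoise, hgap]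
        simp only [hgap]
        rw [integral_sub (integrable_of_mem_Icc hVm hVL)
          (integrable_of_mem_Icc ((E m).measurable_value π _ _) ((E m).value_mem π _ _))]
      have hfh : f h = 2 * b * alg.width D m t k h (D.state t m h, D.action t m h)
          + alg.gapNoise E D m t k h := rfl
      rw [hfh, hnoise, hv2]
      linarith [hreg.2]
  have h1 := key alg.H le_rfl
  rw [Nat.add_sub_cancel_left] at h1
  have h2 : (E m).optValue alg.H 1 (D.state t m 1) ≤ alg.vEst D m t k alg.H (D.state t m 1) := by
    have : Nonempty (Policy S A) := ⟨π⟩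
    refine ciSup_le fun π' => ?_
    have := (hr.vEst_spec (m := m) (k := k) ht hk le_rfl).1 π' (D.state t m 1)
    rwa [Nat.add_sub_cancel_left] at this
  linarith

/-- The policy itself is random, so joint measurability is obtained by backward recursion with the
Bellman equation. -/
theorem HistoryMeasurable.value_greedy {Ω : Type*} [MeasurableSpace Ω] {D : Ω → Observations S A M}
    {t : ℕ} (hD : HistoryMeasurable alg D t) (E : EpisodicMDP S A) (m : Fin M) {K : Ω → ℕ}
    (hK : Measurable K) {j : ℕ} (hj : j ≤ alg.H) :
    Measurable fun q : Ω × S => E.value alg.H (alg.greedyPolicy (D q.1) m t (K q.1))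
      (alg.H + 1 - j) q.2 := by
  induction j with
  | zero =>
    simp only [Nat.sub_zero, EpisodicMDP.value_top]
    exact measurable_const
  | succ j ih =>
    have ih := ih (by omega)
    have hidx : alg.H + 1 - (j + 1) = alg.H - j := by omega
    have hidx' : alg.H + 1 - j = alg.H - j + 1 := by omega
    rw [hidx'] at ih
    rw [hidx]
    have hg := hD.greedy_random (h := alg.H - j) (by rw [Finset.mem_Icc]; omega) m hK
    have hz : Measurable fun q : Ω × S => (q.2, alg.greedy (D q.1) m t (K q.1) (alg.H - j) q.2) :=
      measurable_snd.prodMk hg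
    simp only [value_greedyPolicy E _ m t _ (Nat.sub_le alg.H j)]
    refine ((E.measurable_reward _).comp hz).add ?_
    have hf : Measurable fun r : (Ω × S) × S => E.value alg.H
        (alg.greedyPolicy (D r.1.1) m t (K r.1.1)) (alg.H - j + 1) r.2 :=
      ih.comp ((measurable_fst.comp measurable_fst).prodMk measurable_snd)
    exact measurable_integral_kernel_comp hz hf

theorem HistoryMeasurable.gap {Ω : Type*} [MeasurableSpace Ω] {D : Ω → Observations S A M}
    {t : ℕ} (hD : HistoryMeasurable alg D t) (E : Fin M → EpisodicMDP S A) (m : Fin M) {K : Ω → ℕ}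
    (hK : Measurable K) {h : ℕ} (hh : h ≤ alg.H) :
    Measurable fun q : Ω × S => alg.gap E (D q.1) m t (K q.1) h q.2 := by
  have h1 := hD.vEst_random m hK (Nat.sub_le alg.H h)
  have h2 := hD.value_greedy (E m) m hK (Nat.sub_le alg.H h)
  have hidx : alg.H + 1 - (alg.H - h) = h + 1 := by omega
  rw [hidx] at h2
  unfold CoopLSVI.gap
  exact (measurable_const.max (h1.min measurable_const)).sub h2

/-- Thanks to the truncation the bound holds for all observations, not only on the good event, so
the martingale bound needs no conditioning. -/
theorem gap_mem (D : Observations S A M) (m : Fin M) (t k h : ℕ) (y : S) :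
    alg.gap E D m t k h y ∈ Set.Icc (-(alg.H : ℝ)) alg.H := by
  have h1 := (E m).value_mem (alg.greedyPolicy D m t k) alg.H (h + 1) y
  have h2 : ((alg.H + 1 - (h + 1) : ℕ) : ℝ) ≤ alg.H := by exact_mod_cast (by omega)
  have h3 : max 0 (min (alg.vEst D m t k (alg.H - h) y) alg.H) ≤ (alg.H : ℝ) :=
    max_le (Nat.cast_nonneg _) (min_le_right _ _)
  have h4 := le_max_left 0 (min (alg.vEst D m t k (alg.H - h) y) (alg.H : ℝ))
  rw [gap]
  constructor <;> linarith [h1.1, h1.2]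

/-- Azuma–Hoeffding bound for the gaps. -/
theorem IsRun.measure_gapNoise_le {Ω : Type*} [MeasurableSpace Ω] {P : Measure Ω}
    [IsProbabilityMeasure P] {D : Ω → Observations S A M} {k : Ω → ℕ → ℕ}
    (hrun : alg.IsRun E T P D k) (hM : 0 < M) (hT : 0 < T) (hH : 0 < alg.H) {δ : ℝ} (hδ : 0 < δ)
    (hδ1 : δ < 1) :
    P {ω | √(2 * (T * (M * alg.H)) * alg.H ^ 2 * Real.log (1 / δ))
        ≤ ∑ t ∈ Finset.Icc 1 T, ∑ m, ∑ h ∈ Finset.Icc 1 alg.H,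
          alg.gapNoise E (D ω) m t (k ω t) h} ≤ ENNReal.ofReal δ := by
  set N : ℝ := T * (M * alg.H) with hN
  set r : ℝ := √(2 * N * alg.H ^ 2 * Real.log (1 / δ)) with hr
  have hN0 : 0 < N := by positivity
  have hH0 : (0 : ℝ) < alg.H := by exact_mod_cast hH
  have hlog : 0 < Real.log (1 / δ) := Real.log_pos (by rw [lt_div_iff₀ hδ]; linarith)
  have hr0 : 0 < r := Real.sqrt_pos.2 (by positivity)
  have hr2 : r ^ 2 = 2 * N * alg.H ^ 2 * Real.log (1 / δ) := Real.sq_sqrt (by positivity)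
  -- The optimal exponent: it maximizes `s r - N s² H² / 2`, whose maximum is `log (1 / δ)` by the
  -- choice of `r`.
  set s : ℝ := r / (N * alg.H ^ 2) with hs
  -- The sign is negative because `gapNoise` is expectation minus realization.
  set X : ℕ → Fin M → ℕ → Ω → ℝ := fun t m h ω =>
    (-s) * (alg.gap E (D ω) m t (k ω t) h ((D ω).state t m (h + 1))
      - ∫ y, alg.gap E (D ω) m t (k ω t) h y
        ∂((E m).transition h ((D ω).state t m h, (D ω).action t m h)))
      - (-s) ^ 2 * ((alg.H : ℝ) - -(alg.H : ℝ)) ^ 2 / 8 with hX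
  have hgap : ∀ t ∈ Finset.Icc 1 T, ∀ m, ∀ h ∈ Finset.Icc 1 alg.H, ∀ i,
      Measurable[(past D alg.H t m i).prod inferInstance]
        fun q : Ω × S => alg.gap E (D q.1) m t (k q.1 t) h q.2 := by
    intro t ht m h hh i
    obtain ⟨hHist, hk⟩ := hrun.follows.historyMeasurable_past ht m i
    exact @HistoryMeasurable.gap S A _ _ _ M d alg _ _ Ω (past D alg.H t m i) D t hHist E m _ hk h
      (Finset.mem_Icc.1 hh).2
  have hXmeas : ∀ t ∈ Finset.Icc 1 T, ∀ m, ∀ h ∈ Finset.Icc 1 alg.H,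
      Measurable[past D alg.H t m (h + 1)] (X t m h) := by
    intro t ht m h hh
    have hle : past D alg.H t m h ≤ past D alg.H t m (h + 1) := past_mono (by omega)
    have hz := (hrun.follows.measurable_state_action ht m hh).mono hle le_rfl
    have hst : Measurable[past D alg.H t m (h + 1)] fun ω => (D ω).state t m (h + 1) :=
      measurable_state_past (Finset.mem_Icc.1 ht).1 (by rw [Finset.mem_Icc] at *; omega)
        (Or.inr (Or.inr ⟨rfl, rfl, le_rfl⟩))
    have hg := hgap t ht m h hh (h + 1)
    have h1 : Measurable[past D alg.H t m (h + 1)] fun ω =>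
        alg.gap E (D ω) m t (k ω t) h ((D ω).state t m (h + 1)) :=
      @Measurable.comp _ _ _ (past D alg.H t m (h + 1)) ((past D alg.H t m (h + 1)).prod inferInstance)
        _ _ _ hg (measurable_id.prodMk hst)
    have h2 : Measurable[past D alg.H t m (h + 1)] fun ω =>
        ∫ y, alg.gap E (D ω) m t (k ω t) h y
          ∂((E m).transition h ((D ω).state t m h, (D ω).action t m h)) :=
      @measurable_integral_kernel_comp Ω S (S × A) (past D alg.H t m (h + 1)) _ _
        ((E m).transition h) _ _ hz _ hg
    exact ((h1.sub h2).const_mul _).sub_const _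
  have hstep := lintegral_exp_sum_le (P := P) hXmeas fun t ht m h hh G hG =>
    hrun.lintegral_mul_exp_le ht m hh (hgap t ht m h hh h) (fun q => gap_mem (D q.1) m t _ h q.2)
      (s := fun _ => -s) measurable_const hG
  have hsum : Measurable fun ω => ∑ t ∈ Finset.Icc 1 T, ∑ m, ∑ h ∈ Finset.Icc 1 alg.H, X t m h ω :=
    Finset.measurable_sum _ fun t ht => Finset.measurable_sum _ fun m _ =>
      Finset.measurable_sum _ fun h hh =>
        (hXmeas t ht m h hh).mono (hrun.past_le ht m (h + 1)) le_rfl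
  refine (measure_mono fun ω hω => ?_).trans (measure_log_inv_le_sum hsum hstep hδ)
  rw [Set.mem_ofPred_eq] at hω ⊢
  set y := ∑ t ∈ Finset.Icc 1 T, ∑ m, ∑ h ∈ Finset.Icc 1 alg.H,
          alg.gapNoise E (D ω) m t (k ω t) h with hy
  have heq : ∑ t ∈ Finset.Icc 1 T, ∑ m, ∑ h ∈ Finset.Icc 1 alg.H, X t m h ω
      = s * y - N * (s ^ 2 * alg.H ^ 2 / 2) := by
    have hXeq : ∀ t m h, X t m h ω
        = s * alg.gapNoise E (D ω) m t (k ω t) h - s ^ 2 * alg.H ^ 2 / 2 := by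
      intro t m h
      simp only [hX, gapNoise]
      ring
    simp only [hXeq, Finset.sum_sub_distrib, ← Finset.mul_sum]
    rw [← hy]
    simp [hN]
    ring
  rw [heq]
  have hs0 : 0 < s := by positivity
  have h1 := mul_le_mul_of_nonneg_left hω hs0.le
  have h2 : s * r - N * (s ^ 2 * alg.H ^ 2 / 2) = r ^ 2 / (2 * (N * alg.H ^ 2)) := by
    rw [hs]
    field_simp
    ring
  have h3 : r ^ 2 / (2 * (N * alg.H ^ 2)) = Real.log (1 / δ) := by
    rw [hr2]
    field_simp
  linarith

end CoopLSVI

/-! ### The regret on the good event -/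

namespace CoopLSVI

variable {S A : Type*} [MeasurableSpace S] [MeasurableSpace A] [DiscreteMeasurableSpace A] {M d : ℕ}
  {alg : CoopLSVI S A M d} {E : Fin M → EpisodicMDP S A} {T : ℕ} [Fintype A] [Nonempty A]

/-- A test that does not fire bounds the growth for all agents and steps, so a single schedule
serves the features of every step. -/
theorem Follows.isSyncSchedule {Ω : Type*} {D : Ω → Observations S A M} {k : Ω → ℕ → ℕ}
    (hf : alg.Follows E T D k) (hlam : alg.lam = 1) (ω : Ω) {h : ℕ} (hh : h ∈ Finset.Icc 1 alg.H) :
    IsSyncSchedule (fun p : Fin M × ℕ => alg.feat (D ω) h p.1 p.2) alg.thr T (k ω) := by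
  refine ⟨hf.sync_start ω, fun t ht => ?_⟩
  by_cases hs : alg.Sync (D ω) t (k ω t)
  · exact Or.inl (hf.sync_of_test ω t ht hs)
  · refine Or.inr ⟨hf.sync_of_not_test ω t ht hs, fun m => ?_⟩
    rw [Sync] at hs
    push Not at hs
    have := hs m h hh
    rwa [gram_eq_regGram hlam, syncGram_eq_regGram hlam,
      ← regGram_insert (v := fun p : Fin M × ℕ => alg.feat (D ω) h p.1 p.2)
        (notMem_avail (m := m) (t := t) (k := k ω t))] at this

theorem Regular.regret_le {Ω : Type*} {D : Ω → Observations S A M} {k : Ω → ℕ → ℕ}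
    (hf : alg.Follows E T D k) {ω : Ω} {R : ℕ} {ℓ b ξ : ℝ} (hr : Regular alg E T R ℓ b ξ (D ω)) :
    alg.regret E T D k ω ≤ 2 * b * (alg.H * (√(M * T * (2 * Real.exp 1 * (d * Real.log (d + M * T))))
        + M * (d * Real.log (d + M * T) * (√(2 * alg.thr) + 1))))
      + ∑ t ∈ Finset.Icc 1 T, ∑ m, ∑ h ∈ Finset.Icc 1 alg.H,
          alg.gapNoise E (D ω) m t (k ω t) h := by
  have h1 : alg.regret E T D k ω ≤ ∑ m, ∑ t ∈ Finset.Icc 1 T, ∑ h ∈ Finset.Icc 1 alg.H,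
        (2 * b * alg.width (D ω) m t (k ω t) h ((D ω).state t m h, (D ω).action t m h)
          + alg.gapNoise E (D ω) m t (k ω t) h) := by
    refine Finset.sum_le_sum fun m _ => Finset.sum_le_sum fun t ht => ?_
    have hk : k ω t < T := by
      rw [Finset.mem_Icc] at ht
      exact (hf.sync_le ω ht.1 (by omega)).trans_le ht.2
    exact hr.episode_regret_le ht hk fun h hh => hf.action_eq ω t ht m h hh
  refine h1.trans ?_
  simp only [Finset.sum_add_distrib]
  refine add_le_add ?_ (Finset.sum_comm).le
  have h2 : ∀ h ∈ Finset.Icc 1 alg.H, ∑ m, ∑ t ∈ Finset.Icc 1 T,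
      alg.width (D ω) m t (k ω t) h ((D ω).state t m h, (D ω).action t m h)
      ≤ √(M * T * (2 * Real.exp 1 * (d * Real.log (d + M * T))))
        + M * (d * Real.log (d + M * T) * (√(2 * alg.thr) + 1)) := by
    intro h hh
    have h3 := log_det_regGram_le (v := fun p : Fin M × ℕ => alg.feat (D ω) h p.1 p.2)
      (feat_dotProduct_self_le (D ω) h) (syncPairs M T)
    rw [card_syncPairs, Fintype.card_fin] at h3
    push_cast at h3
    refine le_trans (le_of_eq ?_) ((hf.isSyncSchedule hr.lam ω hh).sum_bonus_le
      (feat_dotProduct_self_le (D ω) h) h3)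
    refine Finset.sum_congr rfl fun m _ => Finset.sum_congr rfl fun t _ => ?_
    rw [width, gram_eq_regGram hr.lam]
    rfl
  have h4 := Finset.sum_le_card_nsmul _ _ _ h2
  rw [nsmul_eq_mul, Nat.card_Icc, Nat.add_sub_cancel] at h4
  have h5 := mul_le_mul_of_nonneg_left h4 (show 0 ≤ 2 * b by linarith [hr.bonus_nonneg])
  refine le_trans (le_of_eq ?_) h5
  have h6 : ∀ F : Fin M → ℕ → ℕ → ℝ, ∑ m, ∑ t ∈ Finset.Icc 1 T, ∑ h ∈ Finset.Icc 1 alg.H, F m t h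
      = ∑ h ∈ Finset.Icc 1 alg.H, ∑ m, ∑ t ∈ Finset.Icc 1 T, F m t h := by
    intro F
    rw [Finset.sum_comm (s := Finset.Icc 1 alg.H)]
    exact Finset.sum_congr rfl fun m _ => Finset.sum_comm
  rw [h6]
  simp only [← Finset.mul_sum]

/-- In dimension zero the whole space would have probability zero. -/
theorem dim_pos_of_isLinear {E : EpisodicMDP S A} {H : ℕ} {φ : FeatureMap S A d} [Nonempty S]
    (hH : 0 < H) (hE : E.IsLinear H φ) : 0 < d := by
  obtain ⟨x⟩ := ‹Nonempty S›
  obtain ⟨a⟩ := ‹Nonempty A›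
  obtain ⟨μ, θ, hμ, -⟩ := hE 1 (Finset.mem_Icc.2 ⟨le_rfl, hH⟩)
  by_contra hd
  obtain rfl : d = 0 := by omega
  simpa using hμ (x, a) Set.univ MeasurableSet.univ

theorem noiseCount_pos {M d T H R : ℕ} (hM : 0 < M) (hT : 0 < T) (hH : 0 < H) :
    0 < noiseCount M d T H R := by
  rw [noiseCount]
  positivity

end CoopLSVI

/-- Four powers of `Y` count agents, episodes, indices and steps. Every grid has at most `Y ^ 12`
points per coordinate, with `d + d² + d` coordinates in all. -/
theorem noiseCount_le {M d T H R : ℕ} {Y : ℝ} (hd : 0 < d) (hM : 0 < M) (hT : 0 < T) (hH : 0 < H)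
    (hY : 2 ≤ Y) (hprod : (d : ℝ) * M * T * H ≤ Y) (hR : (R : ℝ) ≤ Y ^ 8) :
    (CoopLSVI.noiseCount M d T H R : ℝ) ≤ Y ^ (4 + 24 * d + 12 * (d * d)) := by
  have hd1 : (1 : ℝ) ≤ d := by exact_mod_cast hd
  have hM1 : (1 : ℝ) ≤ M := by exact_mod_cast hM
  have hT1 : (1 : ℝ) ≤ T := by exact_mod_cast hT
  have hH1 : (1 : ℝ) ≤ H := by exact_mod_cast hH
  have hdMT : (d : ℝ) * M * T ≤ Y :=
    (le_mul_of_one_le_right (by positivity) hH1).trans hprod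
  have hdM : (d : ℝ) * M ≤ Y := (le_mul_of_one_le_right (by positivity) hT1).trans hdMT
  have hMY : (M : ℝ) ≤ Y := (le_mul_of_one_le_left (by positivity) hd1).trans hdM
  have hTY : (T : ℝ) ≤ Y := by
    refine (le_mul_of_one_le_left (by positivity) ?_).trans hdMT
    nlinarith
  have hHY : (H : ℝ) ≤ Y := by
    refine (le_mul_of_one_le_left (by positivity) ?_).trans hprod
    have : (1 : ℝ) ≤ d * M := by nlinarith
    nlinarith
  have hMT : (M : ℝ) * T ≤ Y := by
    refine (le_mul_of_one_le_left (by positivity) hd1).trans (le_trans (le_of_eq ?_) hdMT)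
    ring
  have hY0 : 0 ≤ Y := by linarith
  have h1 : (2 * (R * ((d : ℝ) * M * T) ^ 2) + 1) ≤ Y ^ 12 := by
    have ha : (R : ℝ) * ((d : ℝ) * M * T) ^ 2 ≤ Y ^ 8 * Y ^ 2 := by gcongr
    have hb : (1 : ℝ) ≤ Y ^ 10 := one_le_pow₀ (by linarith)
    have hc : Y ^ 12 = Y ^ 10 * Y ^ 2 := by ring
    have hd : 4 ≤ Y ^ 2 := by nlinarith
    have he : Y ^ 8 * Y ^ 2 = Y ^ 10 := by ring
    nlinarith
  have h2 : (2 * ((M : ℝ) * T * (H * M * T * d)) + 1) ≤ Y ^ 12 := by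
    have ha : (M : ℝ) * T * (H * M * T * d) ≤ Y * Y := by
      refine mul_le_mul hMT (le_trans (le_of_eq ?_) hprod) (by positivity) hY0
      ring
    have hb : Y ^ 4 ≤ Y ^ 12 := pow_le_pow_right₀ (by linarith) (by norm_num)
    have hd : 4 ≤ Y ^ 2 := by nlinarith
    nlinarith
  rw [CoopLSVI.noiseCount]
  push_cast
  calc _ ≤ Y * (Y * (Y * (Y * ((Y ^ 12) ^ d * ((Y ^ 12) ^ (d * d) * (Y ^ 12) ^ d))))) := by
        gcongr
    _ = _ := by
        rw [← pow_mul, ← pow_mul]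
        ring

/-! ### The bonus parameter dominates the confidence radius -/

section BonusParameter

variable {M d T H : ℕ} {c ξ α b : ℝ}

/-- The term `c d H √ι` is cut into quarters, of which three cover the ridge bias, the noise and the
discretization error `4`; the `ξ` term covers the heterogeneity. -/
theorem add_sqrt_le_mul_sqrt_log (hd : 0 < d) (hH : 0 < H) {ι ℓ : ℝ} (hc : 64 ≤ c) (hξ0 : 0 ≤ ξ)
    (hι : 1 / 2 ≤ ι) (hℓ : 2 * (ℓ + 1) ≤ (c / 4 * (d * √ι)) ^ 2) :
    2 * H * √d + (H * √(2 * (ℓ + 1)) + 4) + 2 * H * ξ * √(M * T)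
      ≤ c * (d * H * (√ι + ξ * √(d * M * T))) := by
  have hd1 : (1 : ℝ) ≤ d := by exact_mod_cast hd
  have hH1 : (1 : ℝ) ≤ H := by exact_mod_cast hH
  have hsι : 1 / 2 ≤ √ι := Real.le_sqrt_of_sq_le (by linarith)
  have hsd : √(d : ℝ) ≤ d := Real.sqrt_le_iff.2 ⟨by linarith, by nlinarith⟩
  have hA : (H : ℝ) * √(2 * (ℓ + 1)) ≤ H * (c / 4 * (d * √ι)) := by
    gcongr
    exact Real.sqrt_le_iff.2 ⟨by positivity, hℓ⟩
  have hHd : (1 : ℝ) ≤ H * d := one_le_mul_of_one_le_of_one_le hH1 hd1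
  have hcι : 4 ≤ c / 4 * √ι := by
    calc (4 : ℝ) ≤ 16 * (1 / 2) := by norm_num
      _ ≤ c / 4 * √ι := by gcongr; linarith
  have hB : 2 * H * √d ≤ H * d * (c / 4 * √ι) := by
    calc 2 * H * √d ≤ 2 * H * d := by gcongr
      _ = H * d * 2 := by ring
      _ ≤ _ := by gcongr; linarith
  have hC : 1 * 4 ≤ H * d * (c / 4 * √ι) := by gcongr
  have hD : 2 * H * ξ * √(M * T) ≤ c * (d * H * (ξ * √(d * M * T))) := by
    have h1 : √((M : ℝ) * T) ≤ √(d * M * T) := by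
      apply Real.sqrt_le_sqrt
      rw [mul_assoc]
      exact le_mul_of_one_le_left (by positivity) hd1
    calc 2 * H * ξ * √(M * T) ≤ (c * d) * H * ξ * √(d * M * T) := by
          gcongr
          calc (2 : ℝ) = 2 * 1 := by norm_num
            _ ≤ c * d := by gcongr; linarith
      _ = _ := by ring
  have hbb : c * (d * H * (√ι + ξ * √(d * M * T)))
      = 4 * (H * d * (c / 4 * √ι)) + c * (d * H * (ξ * √(d * M * T))) := by ring
  have hA' : (H : ℝ) * (c / 4 * (d * √ι)) = H * d * (c / 4 * √ι) := by ring
  rw [hbb]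
  rw [hA'] at hA
  linarith

/-- The grid depends on `β` and hence on `c`, but only through `log c ≤ c - 1`. The left side is
thus at most linear in `c` and the right side quadratic, so an absolute lower bound on `c` resolves
the circularity. -/
theorem log_count_add_one_le {Z n : ℝ} (hd : 0 < d) (hc : 6000 ≤ c) (hα0 : 0 < α)
    (hZ2 : 2 ≤ Z) (hZα : 2 / α ≤ Z) (hn : 1 ≤ n)
    (hcount : n ≤ (c * Z) ^ (4 + 24 * d + 12 * (d * d))) :
    2 * (Real.log (1 / (α / (2 * n))) + 1) ≤ (c / 4 * (d * √(Real.log Z))) ^ 2 := by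
  have hd1 : (1 : ℝ) ≤ d := by exact_mod_cast hd
  have hc0 : 0 < c := by linarith
  have hι2 : 1 / 2 ≤ Real.log Z := by
    have := Real.log_two_gt_d9
    have := Real.log_le_log two_pos hZ2
    linarith
  have hY : Z ≤ c * Z := le_mul_of_one_le_left (by linarith) (by linarith)
  have hlogY : Real.log (c * Z) = Real.log c + Real.log Z := Real.log_mul hc0.ne' (by linarith)
  have hlogY0 : 0 ≤ Real.log (c * Z) := Real.log_nonneg (by linarith)
  have hd2 : (d : ℝ) ≤ d ^ 2 := by nlinarith
  have hℓY : Real.log (1 / (α / (2 * n))) ≤ 41 * d ^ 2 * Real.log (c * Z) := by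
    have h1 : 1 / (α / (2 * n)) ≤ (c * Z) ^ (5 + 24 * d + 12 * (d * d)) := by
      have : 1 / (α / (2 * n)) = 2 / α * n := by field_simp
      rw [this]
      calc 2 / α * n ≤ (c * Z) * (c * Z) ^ (4 + 24 * d + 12 * (d * d)) := by
            gcongr
            exact hZα.trans hY
        _ = _ := by rw [← pow_succ']; congr 1; ring
    have h2 := Real.log_le_log (by positivity) h1
    rw [Real.log_pow] at h2
    refine h2.trans (mul_le_mul_of_nonneg_right ?_ hlogY0)
    push_cast
    nlinarith
  have hlogc : Real.log c ≤ c - 1 := Real.log_le_sub_one_of_pos hc0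
  have h1 : (c / 4 * (d * √(Real.log Z))) ^ 2 = c ^ 2 / 16 * (d ^ 2 * Real.log Z) := by
    rw [mul_pow, mul_pow, Real.sq_sqrt (by linarith)]; ring
  have h2 : Real.log (c * Z) + 1 ≤ 4 * c * Real.log Z := by
    rw [hlogY]
    have : c * (1 / 2) ≤ c * Real.log Z := by gcongr
    have : 1 * Real.log Z ≤ c * Real.log Z := by gcongr; linarith
    linarith
  calc 2 * (Real.log (1 / (α / (2 * n))) + 1)
      ≤ 2 * (41 * d ^ 2 * Real.log (c * Z) + 41 * d ^ 2) := by linarith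
    _ = 82 * d ^ 2 * (Real.log (c * Z) + 1) := by ring
    _ ≤ 82 * d ^ 2 * (4 * c * Real.log Z) := by gcongr
    _ = 328 * c * (d ^ 2 * Real.log Z) := by ring
    -- This is where `c` must be large: `328 c ≤ c² / 16` holds from `c = 5248` on.
    _ ≤ c ^ 2 / 16 * (d ^ 2 * Real.log Z) := by gcongr; nlinarith
    _ = _ := h1.symm

/-- The bonus parameter dominates the confidence radius of the value estimates. -/
theorem confidence_radius_le {R : ℕ} (hd : 0 < d) (hM : 0 < M) (hT : 0 < T) (hH : 0 < H)
    (hc : 6000 ≤ c) (hξ0 : 0 ≤ ξ) (hξ1 : ξ < 1) (hα0 : 0 < α) (hα1 : α < 1)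
    (hb : b = c * (d * H * (√(Real.log (2 * d * M * H * T / α)) + ξ * √(d * M * T))))
    (hR : (R : ℝ) ≤ H * (M * T) + b ^ 2 + 1) :
    2 * H * √d + (H * √(2 * (Real.log (1 / (α / (2 * CoopLSVI.noiseCount M d T H R))) + 1)) + 4)
      + 2 * H * ξ * √(M * T) ≤ b := by
  have hd1 : (1 : ℝ) ≤ d := by exact_mod_cast hd
  have hM1 : (1 : ℝ) ≤ M := by exact_mod_cast hM
  have hT1 : (1 : ℝ) ≤ T := by exact_mod_cast hT
  have hH1 : (1 : ℝ) ≤ H := by exact_mod_cast hH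
  obtain ⟨q, hq⟩ : ∃ q : ℝ, q = d * M * T * H := ⟨_, rfl⟩
  obtain ⟨Z, hZ⟩ : ∃ Z : ℝ, Z = 2 * d * M * H * T / α := ⟨_, rfl⟩
  have hMT1 : (1 : ℝ) ≤ M * T := one_le_mul_of_one_le_of_one_le hM1 hT1
  have hdMTq : (d : ℝ) * M * T ≤ q := by
    rw [hq]; exact le_mul_of_one_le_right (by positivity) hH1
  have hdHq : (d : ℝ) * H ≤ q := by
    have : q = d * H * (M * T) := by rw [hq]; ring
    rw [this]
    exact le_mul_of_one_le_right (by positivity) hMT1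
  have hHMTq : (H : ℝ) * (M * T) ≤ q := by
    have : q = d * (H * (M * T)) := by rw [hq]; ring
    rw [this]
    exact le_mul_of_one_le_left (by positivity) hd1
  have hq1 : 1 ≤ q := (one_le_mul_of_one_le_of_one_le hd1 hH1).trans hdHq
  have hZq : Z = 2 * q / α := by rw [hZ, hq]; ring
  have hZ2q : 2 * q ≤ Z := by rw [hZq, le_div_iff₀ hα0]; nlinarith
  have hZ2 : 2 ≤ Z := by linarith
  have hZα : 2 / α ≤ Z := by rw [hZq]; gcongr; linarith
  have hιZ : Real.log Z ≤ Z := (Real.log_le_sub_one_of_pos (by linarith)).trans (by linarith)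
  have hι2 : 1 / 2 ≤ Real.log Z := by
    have := Real.log_two_gt_d9
    have := Real.log_le_log two_pos hZ2
    linarith
  have hsqrtZ : ∀ x, x ≤ Z → √x ≤ Z := fun x hx =>
    Real.sqrt_le_iff.2 ⟨by linarith, by nlinarith⟩
  have hc0 : 0 < c := by linarith
  have hYZ : Z ≤ c * Z := le_mul_of_one_le_left (by linarith) (by linarith)
  rw [← hZ] at hb
  have hb0 : 0 ≤ b := by rw [hb]; positivity
  have hcount : (CoopLSVI.noiseCount M d T H R : ℝ) ≤ (c * Z) ^ (4 + 24 * d + 12 * (d * d)) := by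
    have hbY : b ≤ (c * Z) ^ 3 := by
      have h1 : √(Real.log Z) + ξ * √(d * M * T) ≤ Z + 1 * Z := by
        gcongr
        · exact hsqrtZ _ hιZ
        · exact hsqrtZ _ (by linarith)
      calc b ≤ c * (Z * (Z + 1 * Z)) := by
            rw [hb]
            gcongr
            linarith
        _ = (c * Z) * 2 * Z := by ring
        _ ≤ (c * Z) * (c * Z) * (c * Z) := by
            gcongr
            linarith
        _ = _ := by ring
    generalize c * Z = Y at hbY hYZ ⊢
    have hY2 : 2 ≤ Y := by linarith
    refine noiseCount_le hd hM hT hH hY2 (by linarith) ?_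
    have h1 : b ^ 2 ≤ (Y ^ 3) ^ 2 := by gcongr
    have h2 : (1 : ℝ) ≤ Y ^ 5 := one_le_pow₀ (by linarith)
    have h6 : Y ≤ Y * Y ^ 5 := le_mul_of_one_le_right (by linarith) h2
    calc (R : ℝ) ≤ Y * Y ^ 5 + (Y ^ 3) ^ 2 + Y * Y ^ 5 := by linarith
      _ = Y ^ 6 * 3 := by ring
      _ ≤ Y ^ 6 * Y ^ 2 := by gcongr; nlinarith
      _ = Y ^ 8 := by ring
  have hn1 : (1 : ℝ) ≤ CoopLSVI.noiseCount M d T H R := by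
    exact_mod_cast CoopLSVI.noiseCount_pos hM hT hH
  rw [hb]
  exact add_sqrt_le_mul_sqrt_log hd hH (by linarith) hξ0 hι2
    (log_count_add_one_le hd hc hα0 hZ2 hZα hn1 hcount)

end BonusParameter

/-! ### Arithmetic of the final bound -/

section RegretBound

variable {M d T H : ℕ} {c ξ α α₀ s s₀ b : ℝ}

/-- Since `α ≤ α₀ < 1`, the number `log (1 / α)` is bounded away from zero, and additive logarithms
become multiplicative factors. -/
theorem log_two_add_log_inv_le (hα0 : 0 < α) (hα : α ≤ α₀) (hα1 : α₀ < 1) {l : ℝ} (hl : 1 ≤ l) :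
    l + Real.log (1 / α) ≤ (l * (√(1 / Real.log (1 / α₀) + 1) * √(Real.log (1 / α)))) ^ 2 := by
  have hα₀ : 0 < α₀ := by linarith
  have ha₀0 : 0 < Real.log (1 / α₀) := Real.log_pos (by rw [lt_div_iff₀ hα₀]; linarith)
  have haa : Real.log (1 / α₀) ≤ Real.log (1 / α) :=
    Real.log_le_log (by positivity) (by gcongr)
  generalize Real.log (1 / α₀) = a₀ at *
  generalize Real.log (1 / α) = a at *
  have ha0 : 0 < a := by linarith
  have h1a : 1 ≤ a / a₀ := by rw [one_le_div ha₀0]; exact haa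
  rw [mul_pow, mul_pow, Real.sq_sqrt (by positivity), Real.sq_sqrt ha0.le]
  have h2 : l ≤ l ^ 2 := by nlinarith
  have h3 : l ^ 2 ≤ l ^ 2 * (a / a₀) := le_mul_of_one_le_right (by positivity) h1a
  have h4 : a ≤ l ^ 2 * a := le_mul_of_one_le_left ha0.le (by nlinarith)
  have h5 : l ^ 2 * ((1 / a₀ + 1) * a) = l ^ 2 * (a / a₀) + l ^ 2 * a := by ring
  linarith

/-- The lower bound `s₀` on the threshold absorbs the `+ 1` per period into `√s / √s₀`. -/
theorem sum_width_bound_le (hd : 0 < d) (hM : 0 < M) (hT : 0 < T) (hs0 : 0 < s₀) (hs : s₀ ≤ s)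
    {l : ℝ} (hl1 : 1 ≤ l) (hl : Real.log (d + M * T) ≤ l) :
    √(M * T * (2 * Real.exp 1 * (d * Real.log (d + M * T))))
        + M * (d * Real.log (d + M * T) * (√(2 * s) + 1))
      ≤ l * ((3 + 1 / √s₀) * (d * M * √s + √(d * M * T))) := by
  have hd1 : (1 : ℝ) ≤ d := by exact_mod_cast hd
  have hlog0 : 0 ≤ Real.log (d + M * T) := Real.log_nonneg (by
    have : (0 : ℝ) ≤ M * T := by positivity
    linarith)
  generalize Real.log (d + M * T) = r at *
  have hs1 : 1 ≤ √s / √s₀ := by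
    rw [one_le_div (Real.sqrt_pos.2 hs0)]; exact Real.sqrt_le_sqrt hs
  have hW1 : √(M * T * (2 * Real.exp 1 * (d * r))) ≤ l * (3 * √(d * M * T)) := by
    refine Real.sqrt_le_iff.2 ⟨by positivity, ?_⟩
    rw [mul_pow, mul_pow, Real.sq_sqrt (by positivity)]
    have he : Real.exp 1 ≤ 3 := by linarith [Real.exp_one_lt_d9]
    calc (M : ℝ) * T * (2 * Real.exp 1 * (d * r))
        ≤ M * T * (2 * 3 * (d * l)) := by gcongr
      _ = l * (6 * (d * M * T)) := by ring
      _ ≤ l ^ 2 * (3 ^ 2 * (d * M * T)) := by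
          have h2 : l ≤ l ^ 2 := by nlinarith
          gcongr
          norm_num
  have hW2 : M * (d * r * (√(2 * s) + 1)) ≤ l * ((2 + 1 / √s₀) * (d * M * √s)) := by
    have h2 : √(2 * s) ≤ 2 * √s := by
      rw [Real.sqrt_mul zero_le_two]
      gcongr
      exact Real.sqrt_le_iff.2 ⟨by norm_num, by norm_num⟩
    calc (M : ℝ) * (d * r * (√(2 * s) + 1))
        ≤ M * (d * l * (2 * √s + √s / √s₀)) := by gcongr
      _ = _ := by ring
  have h4 : 3 * √(d * M * T) + (2 + 1 / √s₀) * (d * M * √s)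
      ≤ (3 + 1 / √s₀) * (d * M * √s + √(d * M * T)) := by
    have h5 : 0 ≤ d * M * √s := by positivity
    have h6 : 0 ≤ 1 / √s₀ * √(d * M * T) := by positivity
    linarith
  have h5 := mul_le_mul_of_nonneg_left h4 (show 0 ≤ l by linarith)
  linarith

theorem azuma_bound_le (hd : 0 < d) (hH : 0 < H) {a κ : ℝ}
    (ha : 0 ≤ a) (hκ : 0 ≤ κ) (h : 1 + a ≤ (κ * √a) ^ 2) :
    √(2 * (T * (M * H)) * H ^ 2 * (Real.log 2 + a)) ≤ 2 * κ * (d * H ^ 2 * √(d * M * T) * √a) := by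
  have hd1 : (1 : ℝ) ≤ d := by exact_mod_cast hd
  have hH1 : (1 : ℝ) ≤ H := by exact_mod_cast hH
  rw [mul_pow, Real.sq_sqrt ha] at h
  refine Real.sqrt_le_iff.2 ⟨by positivity, ?_⟩
  have h2 : Real.log 2 + a ≤ κ ^ 2 * a := by linarith [Real.log_two_lt_d9]
  have h3 : (1 : ℝ) ≤ d ^ 3 := one_le_pow₀ hd1
  calc 2 * ((T : ℝ) * (M * H)) * H ^ 2 * (Real.log 2 + a)
      ≤ 2 * (T * (M * H)) * H ^ 2 * (κ ^ 2 * a) := by gcongr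
    _ = (2 * κ ^ 2 * a * T * M * H ^ 2) * (1 * (H * 1)) := by ring
    _ ≤ (2 * κ ^ 2 * a * T * M * H ^ 2) * (2 * d ^ 3 * (H * H)) := by
        gcongr
        linarith
    _ = (2 * κ) ^ 2 * ((d * H ^ 2) ^ 2 * (d * M * T) * a) := by ring
    _ = _ := by
        simp only [mul_pow, Real.sq_sqrt (show (0 : ℝ) ≤ d * M * T by positivity),
          Real.sq_sqrt ha]

/-- The sum of the widths, weighted by the bonus parameter, and the martingale deviation are of the
order of the asserted regret bound. -/
theorem regret_bound_le (hd : 0 < d) (hM : 0 < M) (hT : 0 < T) (hH : 0 < H)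
    (hc : 0 < c) (hξ0 : 0 ≤ ξ) (hα0 : 0 < α) (hα : α ≤ α₀) (hα1 : α₀ < 1)
    (hs0 : 0 < s₀) (hs : s₀ ≤ s)
    (hb : b = c * (d * H * (√(Real.log (2 * d * M * H * T / α)) + ξ * √(d * M * T)))) :
    2 * b * (H * (√(M * T * (2 * Real.exp 1 * (d * Real.log (d + M * T))))
        + M * (d * Real.log (d + M * T) * (√(2 * s) + 1))))
      + √(2 * (T * (M * H)) * H ^ 2 * Real.log (1 / (α / 2)))
      ≤ (2 * c * (√(1 / Real.log (1 / α₀) + 1) + 1) * (3 + 1 / √s₀)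
          + 2 * √(1 / Real.log (1 / α₀) + 1)) * (1 + Real.log (d * M * T * H)) ^ 2 *
        (d * H ^ 2 * (d * M * √s + √(d * M * T)) *
          (√(Real.log (1 / α)) + 2 * ξ * √(d * M * T))) := by
  have hd1 : (1 : ℝ) ≤ d := by exact_mod_cast hd
  have hM1 : (1 : ℝ) ≤ M := by exact_mod_cast hM
  have hT1 : (1 : ℝ) ≤ T := by exact_mod_cast hT
  have hH1 : (1 : ℝ) ≤ H := by exact_mod_cast hH
  have hMT1 : (1 : ℝ) ≤ M * T := one_le_mul_of_one_le_of_one_le hM1 hT1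
  have hα₀ : 0 < α₀ := by linarith
  have hdMTq : (d : ℝ) * (M * T) ≤ d * M * T * H := by
    rw [← mul_assoc]; exact le_mul_of_one_le_right (by positivity) hH1
  have hq1 : (1 : ℝ) ≤ d * M * T * H := (one_le_mul_of_one_le_of_one_le hd1 hMT1).trans hdMTq
  have hl1 : 1 ≤ 1 + Real.log (d * M * T * H) := by linarith [Real.log_nonneg hq1]
  have hlogd : Real.log (d + M * T) ≤ 1 + Real.log (d * M * T * H) := by
    have h1 : (d : ℝ) ≤ d * (M * T) := le_mul_of_one_le_right (by positivity) hMT1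
    have h2 : (M : ℝ) * T ≤ d * (M * T) := le_mul_of_one_le_left (by positivity) hd1
    have h3 : (d : ℝ) + M * T ≤ 2 * (d * M * T * H) := by linarith
    have h4 := Real.log_le_log (by positivity) h3
    rw [Real.log_mul two_ne_zero (by positivity)] at h4
    linarith [Real.log_two_lt_d9]
  have hW := sum_width_bound_le hd hM hT hs0 hs hl1 hlogd
  have hι := log_two_add_log_inv_le hα0 hα hα1 hl1
  have hι1 := log_two_add_log_inv_le hα0 hα hα1 le_rfl
  rw [one_mul] at hι1
  have ha0 : 0 ≤ Real.log (1 / α) := Real.log_nonneg (by rw [le_div_iff₀ hα0]; linarith)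
  have hazuma := azuma_bound_le (M := M) (T := T) hd hH ha0 (Real.sqrt_nonneg _) hι1
  have hlogZ : √(Real.log (2 * d * M * H * T / α)) ≤ (1 + Real.log (d * M * T * H)) *
      (√(1 / Real.log (1 / α₀) + 1) * √(Real.log (1 / α))) := by
    refine Real.sqrt_le_iff.2 ⟨by positivity, le_trans ?_ hι⟩
    have h1 : 2 * (d : ℝ) * M * H * T / α = 2 * (d * M * T * H) * (1 / α) := by ring
    rw [h1, Real.log_mul (by positivity) (by positivity), Real.log_mul two_ne_zero (by positivity)]
    linarith [Real.log_two_lt_d9]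
  have hlogα : Real.log (1 / (α / 2)) = Real.log 2 + Real.log (1 / α) := by
    rw [← Real.log_mul two_ne_zero (by positivity)]
    congr 1
    field_simp
  rw [hlogα]
  have hσ0 : 0 ≤ 3 + 1 / √s₀ := by positivity
  have hWs : 0 ≤ d * M * √s := by positivity
  have hHW : 0 ≤ H * (√(M * T * (2 * Real.exp 1 * (d * Real.log (d + M * T))))
        + M * (d * Real.log (d + M * T) * (√(2 * s) + 1))) := by
    have hlog0 : 0 ≤ Real.log (d + M * T) := Real.log_nonneg (by linarith)
    positivity
  -- All roots and logarithms now become opaque nonnegative quantities, leaving a polynomial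
  -- inequality.
  have hκ0 : 0 ≤ √(1 / Real.log (1 / α₀) + 1) := Real.sqrt_nonneg _
  have hu0 : 0 ≤ √((d : ℝ) * M * T) := Real.sqrt_nonneg _
  have hv0 : 0 ≤ √(Real.log (1 / α)) := Real.sqrt_nonneg _
  generalize √(1 / Real.log (1 / α₀) + 1) = κ at *
  generalize √(M * T * (2 * Real.exp 1 * (d * Real.log (d + M * T))))
        + M * (d * Real.log (d + M * T) * (√(2 * s) + 1)) = W at *
  generalize √(2 * (T * (M * H)) * H ^ 2 * (Real.log 2 + Real.log (1 / α))) = V at *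
  generalize √(Real.log (2 * d * M * H * T / α)) = y at *
  generalize 1 + Real.log (d * M * T * H) = l at *
  generalize √(Real.log (1 / α)) = v at *
  generalize √((d : ℝ) * M * T) = u at *
  generalize d * M * √s = w at *
  generalize 3 + 1 / √s₀ = σ at *
  clear hι hι1 hlogα hα hα₀ hα0 hα1 hs hs0 hdMTq hq1 hlogd ha0
  have hξu : 0 ≤ ξ * u := by positivity
  have hbb : b ≤ c * (d * H * (l * ((κ + 1) * (v + 2 * ξ * u)))) := by
    rw [hb]
    have h1 : y + ξ * u ≤ l * ((κ + 1) * (v + 2 * ξ * u)) := by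
      have h3 : 1 * (ξ * u) ≤ l * (ξ * u) := by gcongr
      have h4 : 0 ≤ l * v := by positivity
      have h5 : 0 ≤ l * (κ * (2 * (ξ * u))) := by positivity
      have h6 : 0 ≤ l * (ξ * u) := by positivity
      linarith
    gcongr
  have hfirst : 2 * b * (H * W) ≤ 2 * (c * (d * H * (l * ((κ + 1) * (v + 2 * ξ * u)))))
      * (H * (l * (σ * (w + u)))) := by
    have : 0 ≤ v + 2 * ξ * u := by linarith
    gcongr
  have hsecond : V ≤ 2 * κ * (l ^ 2 * (d * H ^ 2 * (w + u) * (v + 2 * ξ * u))) := by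
    refine hazuma.trans ?_
    have h1 : d * H ^ 2 * u * v ≤ d * H ^ 2 * (w + u) * (v + 2 * ξ * u) := by
      gcongr <;> linarith
    have h2 : (1 : ℝ) ≤ l ^ 2 := one_le_pow₀ hl1
    have h3 : d * H ^ 2 * u * v ≤ l ^ 2 * (d * H ^ 2 * (w + u) * (v + 2 * ξ * u)) :=
      h1.trans (le_mul_of_one_le_left (le_trans (by positivity) h1) h2)
    gcongr
  calc 2 * b * (H * W) + V ≤ _ := add_le_add hfirst hsecond
    _ = _ := by ring

end RegretBound

end

/-! ### The main theorem -/

open MeasureTheory ProbabilityTheory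
open scoped Matrix
theorem theorem2 :
    ∃ c₀ : ℝ, 0 < c₀ ∧ ∃ p : ℕ, ∀ c : ℝ, c₀ ≤ c → ∀ s₀ : ℝ, 0 < s₀ → ∀ α₀ : ℝ, 0 < α₀ → α₀ < 1 →
    ∃ C : ℝ, 0 < C ∧
    ∀ (S A : Type*) [MeasurableSpace S] [MeasurableSpace A] [DiscreteMeasurableSpace A]
      [Fintype A] [Nonempty A] (M d T : ℕ) (_ : 0 < M) (_ : 0 < T)
      (alg : CoopLSVI S A M d) (_ : 0 < alg.H)
      (E : Fin M → EpisodicMDP S A) (ξ α : ℝ)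
      (_ : ∀ m, (E m).IsLinear alg.H alg.φ)
      (_ : 0 ≤ ξ) (_ : ξ < 1) (_ : EpisodicMDP.SmallDeviation E alg.H ξ)
      (_ : 0 < α) (_ : α ≤ α₀)
      (_ : s₀ ≤ alg.thr) (_ : alg.lam = 1)
      (_ : ∀ t m h, alg.β t m h =
        c * (d * alg.H * (√(Real.log (2 * d * M * alg.H * T / α)) + ξ * √(d * M * T))))
      (Ω : Type*) [MeasurableSpace Ω] (P : Measure Ω) [IsProbabilityMeasure P]
      (D : Ω → Observations S A M) (k : Ω → ℕ → ℕ) (_ : alg.IsRun E T P D k),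
      ENNReal.ofReal (1 - α) ≤
        P {ω | alg.regret E T D k ω ≤
          C * (1 + Real.log (d * M * T * alg.H)) ^ p *
            (d * alg.H ^ 2 * (d * M * √alg.thr + √(d * M * T)) *
              (√(Real.log (1 / α)) + 2 * ξ * √(d * M * T)))} := by
  -- The logarithm enters twice: once through the bonus parameter and once through the
  -- log-determinant in the sum of widths.
  refine ⟨6000, by norm_num, 2, fun c hc s₀ hs₀ α₀ hα₀ hα₀1 =>
    ⟨2 * c * (√(1 / Real.log (1 / α₀) + 1) + 1) * (3 + 1 / √s₀)
      + 2 * √(1 / Real.log (1 / α₀) + 1), by positivity, ?_⟩⟩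
  intro S A _ _ _ _ _ M d T hM hT alg hH E ξ α hlin hξ0 hξ1 hdev hα hαα₀ hthr hlam hβ Ω _ P _ D k
    hrun
  obtain ⟨ω₀⟩ : Nonempty Ω := P.nonempty_of_neZero
  have : Nonempty S := ⟨(D ω₀).state 1 ⟨0, hM⟩ 1⟩
  have hd : 0 < d := CoopLSVI.dim_pos_of_isLinear hH (hlin ⟨0, hM⟩)
  have hα1 : α < 1 := hαα₀.trans_lt hα₀1
  obtain ⟨b, hb⟩ : ∃ b : ℝ, b = c * (d * alg.H *
    (√(Real.log (2 * d * M * alg.H * T / α)) + ξ * √(d * M * T))) := ⟨_, rfl⟩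
  simp only [← hb] at hβ
  -- The grid range covers the entries of the regression weights, at most `H M T`, and of the bonus
  -- matrix, at most `b²`.
  obtain ⟨R, hR⟩ : ∃ R : ℕ, R = alg.H * (M * T) + ⌈b ^ 2⌉₊ := ⟨_, rfl⟩
  have hRcast : (R : ℝ) = alg.H * (M * T) + (⌈b ^ 2⌉₊ : ℝ) := by rw [hR]; push_cast; rfl
  have hceil : b ^ 2 ≤ (⌈b ^ 2⌉₊ : ℝ) := Nat.le_ceil _
  have hceil' : (⌈b ^ 2⌉₊ : ℝ) < b ^ 2 + 1 := Nat.ceil_lt_add_one (sq_nonneg b)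
  have hHMT : (0 : ℝ) ≤ alg.H * (M * T) := by positivity
  have hn : (0 : ℝ) < CoopLSVI.noiseCount M d T alg.H R := by
    exact_mod_cast CoopLSVI.noiseCount_pos hM hT hH
  have hradius := confidence_radius_le (R := R) hd hM hT hH hc hξ0 hξ1 hα hα1 hb
    (by rw [hRcast]; linarith)
  -- Half of `α` is spread evenly over the noise inequalities, the other half goes to the gaps.
  have hnoise := hrun.measure_not_noiseControlled_le R
    (δ := α / (2 * CoopLSVI.noiseCount M d T alg.H R)) (by positivity)
  have hgap := hrun.measure_gapNoise_le hM hT hH (half_pos hα) (by linarith)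
  have hmul : (CoopLSVI.noiseCount M d T alg.H R : ENNReal) *
      ENNReal.ofReal (α / (2 * CoopLSVI.noiseCount M d T alg.H R)) = ENNReal.ofReal (α / 2) := by
    rw [← ENNReal.ofReal_natCast, ← ENNReal.ofReal_mul hn.le]
    congr 1
    field_simp
  rw [hmul] at hnoise
  have hbound := regret_bound_le hd hM hT hH (by linarith) hξ0 hα hαα₀ hα₀1 hs₀ hthr hb
  have hbad := (measure_union_le _ _).trans (add_le_add hnoise hgap)
  rw [← ENNReal.ofReal_add (by positivity) (by positivity), add_halves] at hbad
  rw [ENNReal.ofReal_sub _ hα.le, ENNReal.ofReal_one, tsub_le_iff_right, ← measure_univ (μ := P)]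
  -- Subadditivity over a cover of the whole space avoids proving that the regret event is
  -- measurable.
  refine (measure_mono fun ω _ => ?_).trans ((measure_union_le _ _).trans (add_le_add le_rfl hbad))
  by_cases h1 : CoopLSVI.NoiseControlled alg E T R
      (Real.log (1 / (α / (2 * CoopLSVI.noiseCount M d T alg.H R)))) (D ω)
  swap
  · exact Or.inr (Or.inl h1)
  by_cases h2 : √(2 * (T * (M * alg.H)) * alg.H ^ 2 * Real.log (1 / (α / 2)))
      ≤ ∑ t ∈ Finset.Icc 1 T, ∑ m, ∑ h ∈ Finset.Icc 1 alg.H, alg.gapNoise E (D ω) m t (k ω t) h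
  · exact Or.inr (Or.inr h2)
  left
  have hreg : CoopLSVI.Regular alg E T R _ b ξ (D ω) :=
    { lam := hlam
      linear := hlin
      nonneg := hξ0
      deviation := hdev
      reward := hrun.reward_eq ω
      bonus := hβ
      bonus_ge := hradius
      range_weight := hR ▸ Nat.le_add_right _ _
      range_bonus := by rw [hRcast]; linarith
      noise := h1
      dim_pos := hd
      agents_pos := hM
      episodes_pos := hT
      horizon_pos := hH }
  have h3 := hreg.regret_le hrun.follows
  exact h3.trans (le_trans (by linarith) hbound)
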